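/- Let $a,b>0$ and let $g$ be the standard Euclidean Taub-NUT metric on $\mathbb{R}^4$, that is, the smooth complete Riemannian metric which in the coordinates $r=|x|^2$ and the Euler angles $(\theta,\varphi,\chi)$ of $S^3$ is $$f(r)\,(dr^2+r^2d\theta^2+r^2\sin^2\theta\,d\varphi^2)+h(r)\,(d\chi+\cos\theta\,d\varphi)^2,\qquad f(r)=\frac{a+br}{r},\quad h(r)=\frac{ar+br^2}{1+\frac{2b}{a}r+\frac{b^2}{a^2}r^2}.$$ Let $\Sigma_4=\Sigma_4^+\oplus\Sigma_4^-$ be the complex spinor bundle of the unique spin structure of $\mathbb{R}^4$, and let $D$ be the Dirac operator of $g$. If $\psi\in L^2(\mathbb{R}^4,\Sigma_4,g)$ satisfies $D\psi=0$ in the sense of distributions, then $\psi=0$. In particular the $L^2$-kernels of the chiral parts $D^{+}$ and $D^{-}$ of $D$ are finite-dimensional and the $L^2$-index $\dim\ker_{L^2}D^+-\dim\ker_{L^2}D^-$ (the axial anomaly) is $0$. -/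

import Mathlib

open MeasureTheory
open scoped ContDiff Matrix

noncomputable section

namespace TaubNUT

/-- The underlying manifold `ℝ⁴`. -/
abbrev E4 : Type := EuclideanSpace ℝ (Fin 4)

/-- The complex spinor space `Σ₄ = ℂ⁴` with its standard Hermitian inner product. -/
abbrev Spinor : Type := EuclideanSpace ℂ (Fin 4)

/-! ### Riemannian metrics on `ℝ⁴`, orthonormal frames, volume -/

/-- A smooth Riemannian metric on `ℝ⁴`, given by its matrix in the standard coordinates. -/
structure RiemannianMetric where
  toMatrix : E4 → Matrix (Fin 4) (Fin 4) ℝ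
  smooth : ∀ i j, ContDiff ℝ ∞ (fun x => toMatrix x i j)
  symm : ∀ x i j, toMatrix x i j = toMatrix x j i
  pos : ∀ x (v : E4), v ≠ 0 → 0 < ∑ i, ∑ j, toMatrix x i j * v i * v j

/-- The inner product `g_x(u, v)`. -/
def RiemannianMetric.inner (g : RiemannianMetric) (x u v : E4) : ℝ :=
  ∑ i, ∑ j, g.toMatrix x i j * u i * v j

/-- The Riemannian volume measure `√(det g) dx`. -/
def RiemannianMetric.vol (g : RiemannianMetric) : Measure E4 :=
  volume.withDensity fun x => ENNReal.ofReal (Real.sqrt (g.toMatrix x).det)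

/-- A smooth global orthonormal frame for `g`. -/
structure OrthonormalFrame (g : RiemannianMetric) where
  vec : Fin 4 → E4 → E4
  smooth : ∀ i, ContDiff ℝ ∞ (vec i)
  orthonormal : ∀ x i j, g.inner x (vec i x) (vec j x) = if i = j then 1 else 0

/-- The Levi-Civita connection coefficients `Γ i j k = g(∇_{e_i} e_j, e_k)` of an orthonormal
frame, by the Koszul formula. -/
def OrthonormalFrame.christoffel {g : RiemannianMetric} (e : OrthonormalFrame g)
    (i j k : Fin 4) (x : E4) : ℝ :=
  (1 / 2) * (g.inner x (VectorField.lieBracket ℝ (e.vec i) (e.vec j) x) (e.vec k x)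
    - g.inner x (VectorField.lieBracket ℝ (e.vec j) (e.vec k) x) (e.vec i x)
    + g.inner x (VectorField.lieBracket ℝ (e.vec k) (e.vec i) x) (e.vec j x))

/-! ### Clifford multiplication -/

/-- Skew-Hermitian Clifford matrices: `γ_i γ_j + γ_j γ_i = -2 δ_ij`. -/
def gamma : Fin 4 → Matrix (Fin 4) (Fin 4) ℂ :=
  ![!![0, 0, -1, 0; 0, 0, 0, -1; 1, 0, 0, 0; 0, 1, 0, 0],
    !![0, 0, 0, Complex.I; 0, 0, Complex.I, 0; 0, Complex.I, 0, 0; Complex.I, 0, 0, 0],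
    !![0, 0, 0, 1; 0, 0, -1, 0; 0, 1, 0, 0; -1, 0, 0, 0],
    !![0, 0, Complex.I, 0; 0, 0, 0, -Complex.I; Complex.I, 0, 0, 0; 0, -Complex.I, 0, 0]]

theorem gamma_clifford (i j : Fin 4) :
    gamma i * gamma j + gamma j * gamma i = (if i = j then -2 else 0 : ℂ) • 1 := by
  have h0 : (0 : Matrix (Fin 4) (Fin 4) ℂ) =
      !![0, 0, 0, 0; 0, 0, 0, 0; 0, 0, 0, 0; 0, 0, 0, 0] := by
    ext k l; fin_cases k <;> fin_cases l <;> rfl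
  have h1 : (1 : Matrix (Fin 4) (Fin 4) ℂ) =
      !![1, 0, 0, 0; 0, 1, 0, 0; 0, 0, 1, 0; 0, 0, 0, 1] := by
    ext k l; fin_cases k <;> fin_cases l <;> simp
  fin_cases i <;> fin_cases j <;> simp [gamma, h0, h1] <;> norm_num

theorem gamma_skew (i : Fin 4) : (gamma i)ᴴ = -gamma i := by
  fin_cases i <;> ext k l <;> fin_cases k <;> fin_cases l <;> simp [gamma]

/-- Clifford multiplication by the `i`-th frame vector. -/
def cliff (i : Fin 4) : Spinor →L[ℂ] Spinor := Matrix.toEuclideanCLM (𝕜 := ℂ) (gamma i)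

/-- The chirality operator `γ₀γ₁γ₂γ₃`, an involution whose `±1`-eigenspaces are the two
half-spinor spaces. -/
def chirality : Spinor →L[ℂ] Spinor :=
  cliff 0 ∘L cliff 1 ∘L cliff 2 ∘L cliff 3

/-! ### The Dirac operator

Since `ℝ⁴` is contractible, its spin structure is unique, and a global orthonormal frame
trivializes the spinor bundle. -/

/-- The spin connection
`∇_{e_i} φ = ∂_{e_i} φ + ¼ ∑_{j,k} g(∇_{e_i} e_j, e_k) c(e_j) c(e_k) φ`. -/
def OrthonormalFrame.spinConnection {g : RiemannianMetric} (e : OrthonormalFrame g)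
    (i : Fin 4) (φ : E4 → Spinor) (x : E4) : Spinor :=
  fderiv ℝ φ x (e.vec i x) +
    (1 / 4 : ℂ) • ∑ j, ∑ k, (e.christoffel i j k x : ℂ) • cliff j (cliff k (φ x))

/-- The Dirac operator `D φ = ∑ᵢ c(e_i) ∇_{e_i} φ`. -/
def OrthonormalFrame.dirac {g : RiemannianMetric} (e : OrthonormalFrame g)
    (φ : E4 → Spinor) (x : E4) : Spinor :=
  ∑ i, cliff i (e.spinConnection i φ x)

/-- `D ψ = 0` in the sense of distributions (the Dirac operator is formally self-adjoint for
the Riemannian volume). -/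
def OrthonormalFrame.IsWeakSolution {g : RiemannianMetric} (e : OrthonormalFrame g)
    (ψ : E4 → Spinor) : Prop :=
  ∀ φ : E4 → Spinor, ContDiff ℝ ∞ φ → HasCompactSupport φ →
    ∫ x, inner ℂ (e.dirac φ x) (ψ x) ∂g.vol = 0

theorem RiemannianMetric.continuous_inner (g : RiemannianMetric) {u v : E4 → E4}
    (hu : Continuous u) (hv : Continuous v) : Continuous fun x => g.inner x (u x) (v x) := by
  have h := fun i j => (g.smooth i j).continuous
  unfold RiemannianMetric.inner
  fun_prop

instance RiemannianMetric.isLocallyFiniteMeasure_vol (g : RiemannianMetric) :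
    IsLocallyFiniteMeasure g.vol := by
  have h := fun i j => (g.smooth i j).continuous
  have hG : Continuous g.toMatrix := continuous_matrix h
  unfold RiemannianMetric.vol
  exact IsLocallyFiniteMeasure.withDensity_ofReal (by fun_prop)

theorem OrthonormalFrame.continuous_christoffel {g : RiemannianMetric} (e : OrthonormalFrame g)
    (i j k : Fin 4) : Continuous (e.christoffel i j k) := by
  have hb : ∀ i j, Continuous (VectorField.lieBracket ℝ (e.vec i) (e.vec j)) := fun i j =>
    (ContDiff.lieBracket_vectorField (m := 0) (e.smooth i) (e.smooth j) (by simp)).continuous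
  have hv := fun i => (e.smooth i).continuous
  unfold OrthonormalFrame.christoffel
  exact continuous_const.mul
    (((g.continuous_inner (hb _ _) (hv _)).sub (g.continuous_inner (hb _ _) (hv _))).add
      (g.continuous_inner (hb _ _) (hv _)))

theorem OrthonormalFrame.memLp_dirac {g : RiemannianMetric} (e : OrthonormalFrame g)
    {φ : E4 → Spinor} (hφ : ContDiff ℝ ∞ φ) (hc : HasCompactSupport φ) :
    MemLp (e.dirac φ) 2 g.vol := by
  refine Continuous.memLp_of_hasCompactSupport ?_ ?_
  · have h1 := fun i j k => Complex.continuous_ofReal.comp (e.continuous_christoffel i j k)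
    have h2 := hφ.continuous
    have h3 : ∀ i, Continuous fun x => fderiv ℝ φ x (e.vec i x) := fun i =>
      (hφ.continuous_fderiv (by simp)).clm_apply (e.smooth i).continuous
    unfold OrthonormalFrame.dirac OrthonormalFrame.spinConnection
    have h4 : ∀ i j k, Continuous fun x => (e.christoffel i j k x : ℂ) := h1
    fun_prop
  · refine HasCompactSupport.of_support_subset_isCompact hc.isCompact fun x hx => ?_
    by_contra hxs
    apply hx
    have h0 : φ x = 0 := image_eq_zero_of_notMem_tsupport hxs
    have h1 : fderiv ℝ φ x = 0 := by
      by_contra hne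
      exact hxs (support_fderiv_subset ℝ hne)
    simp [OrthonormalFrame.dirac, OrthonormalFrame.spinConnection, h0, h1]

/-! ### The `L²`-kernel and the `L²`-index -/

theorem integrable_inner {g : RiemannianMetric} {φ : E4 → Spinor} (hφ : MemLp φ 2 g.vol)
    (ψ : Lp Spinor 2 g.vol) : Integrable (fun x => inner ℂ (φ x) (ψ x)) g.vol := by
  refine (L2.integrable_inner (𝕜 := ℂ) (hφ.toLp φ) ψ).congr ?_
  filter_upwards [hφ.coeFn_toLp] with x hx
  rw [hx]

/-- The space of square-integrable solutions of `D ψ = 0` (in the sense of distributions). -/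
def OrthonormalFrame.l2Kernel {g : RiemannianMetric} (e : OrthonormalFrame g) :
    Submodule ℂ (Lp Spinor 2 g.vol) where
  carrier := {ψ | e.IsWeakSolution ψ}
  zero_mem' := by
    intro φ _ _
    refine integral_eq_zero_of_ae ?_
    filter_upwards [Lp.coeFn_zero Spinor 2 g.vol] with x hx
    rw [hx]
    exact inner_zero_right _
  add_mem' := by
    intro ψ₁ ψ₂ h₁ h₂ φ hφ hc
    have hD := e.memLp_dirac hφ hc
    have key : ∫ x, inner ℂ (e.dirac φ x) ((ψ₁ + ψ₂ : Lp Spinor 2 g.vol) x) ∂g.vol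
        = ∫ x, (inner ℂ (e.dirac φ x) (ψ₁ x) + inner ℂ (e.dirac φ x) (ψ₂ x)) ∂g.vol := by
      refine integral_congr_ae ?_
      filter_upwards [Lp.coeFn_add ψ₁ ψ₂] with x hx
      rw [hx]
      exact inner_add_right _ _ _
    rw [key, integral_add (integrable_inner hD ψ₁) (integrable_inner hD ψ₂), h₁ φ hφ hc,
      h₂ φ hφ hc, add_zero]
  smul_mem' := by
    intro c ψ h φ hφ hc
    have key : ∫ x, inner ℂ (e.dirac φ x) ((c • ψ : Lp Spinor 2 g.vol) x) ∂g.vol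
        = ∫ x, c * inner ℂ (e.dirac φ x) (ψ x) ∂g.vol := by
      refine integral_congr_ae ?_
      filter_upwards [Lp.coeFn_smul c ψ] with x hx
      rw [hx]
      exact inner_smul_right _ _ _
    rw [key, integral_const_mul, h φ hφ hc, mul_zero]

/-- The `L²`-sections of the half-spinor bundle on which the chirality operator is `s = ±1`. -/
def halfSpinors (g : RiemannianMetric) (s : ℂ) : Submodule ℂ (Lp Spinor 2 g.vol) where
  carrier := {ψ | ∀ᵐ x ∂g.vol, chirality (ψ x) = s • ψ x}
  zero_mem' := by
    filter_upwards [Lp.coeFn_zero Spinor 2 g.vol] with x hx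
    simp only [hx, Pi.zero_apply, map_zero, smul_zero]
  add_mem' := by
    intro ψ₁ ψ₂ h₁ h₂
    filter_upwards [h₁, h₂, Lp.coeFn_add ψ₁ ψ₂] with x h₁ h₂ hx
    simp only [hx, Pi.add_apply, map_add, smul_add, h₁, h₂]
  smul_mem' := by
    intro c ψ h
    filter_upwards [h, Lp.coeFn_smul c ψ] with x h hx
    simp only [hx, Pi.smul_apply, map_smul, h, smul_comm c s]

/-- The `L²`-kernel of the chiral part `D⁺` (`s = 1`) or `D⁻` (`s = -1`) of the Dirac operator. -/
def OrthonormalFrame.chiralKernel {g : RiemannianMetric} (e : OrthonormalFrame g) (s : ℂ) :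
    Submodule ℂ (Lp Spinor 2 g.vol) :=
  e.l2Kernel ⊓ halfSpinors g s

/-- The `L²`-index `dim ker D⁺ - dim ker D⁻` (meaningful when both kernels have finite
dimension). -/
def OrthonormalFrame.l2Index {g : RiemannianMetric} (e : OrthonormalFrame g) : ℤ :=
  (Module.finrank ℂ (e.chiralKernel 1) : ℤ) - (Module.finrank ℂ (e.chiralKernel (-1)) : ℤ)

/-! ### The Taub-NUT metric -/

/-- The vector field generating the Hopf circle action `(z₁, z₂) ↦ (e^{it} z₁, e^{it} z₂)`
on `ℝ⁴ = ℂ²`. -/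
def hopf (x : E4) : E4 := !₂[-x 1, x 0, -x 3, x 2]

/-- The matrix, in the Cartesian coordinates of `ℝ⁴`, of the metric which in the coordinates
`r = |x|²` and the Euler angles `(θ, φ, χ)` of `S³` is
`f(r)(dr² + r² dθ² + r² sin² θ dφ²) + g(r)(dχ + cos θ dφ)²`, where `f(r) = (a + b r) / r` and
`g(r) = (a r + b r²) / (1 + c r + d r²)`; see `polar_form`. -/
def kepler (a b c d : ℝ) (x : E4) : Matrix (Fin 4) (Fin 4) ℝ := fun i j =>
  4 * (a + b * ‖x‖ ^ 2) * ((if i = j then 1 else 0)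
    - (c + d * ‖x‖ ^ 2) / (1 + c * ‖x‖ ^ 2 + d * (‖x‖ ^ 2) ^ 2) * hopf x i * hopf x j)

/-- Euler coordinates on `ℝ⁴ = ℂ²`:
`z₁ = √r cos(θ/2) e^{i(χ+φ)/2}`, `z₂ = √r sin(θ/2) e^{i(χ-φ)/2}`. -/
def euler (r θ φ χ : ℝ) : E4 :=
  !₂[√r * Real.cos (θ / 2) * Real.cos ((χ + φ) / 2),
    √r * Real.cos (θ / 2) * Real.sin ((χ + φ) / 2),
    √r * Real.sin (θ / 2) * Real.cos ((χ - φ) / 2),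
    √r * Real.sin (θ / 2) * Real.sin ((χ - φ) / 2)]

theorem norm_sq_eq (x : E4) : ‖x‖ ^ 2 = x 0 ^ 2 + x 1 ^ 2 + x 2 ^ 2 + x 3 ^ 2 := by
  rw [EuclideanSpace.real_norm_sq_eq, Fin.sum_univ_four]

theorem kepler_form (a b c d : ℝ) (x u v : E4) :
    ∑ i, ∑ j, kepler a b c d x i j * u i * v j =
      4 * (a + b * ‖x‖ ^ 2) * ((u 0 * v 0 + u 1 * v 1 + u 2 * v 2 + u 3 * v 3)
        - (c + d * ‖x‖ ^ 2) / (1 + c * ‖x‖ ^ 2 + d * (‖x‖ ^ 2) ^ 2)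
          * (-x 1 * u 0 + x 0 * u 1 - x 3 * u 2 + x 2 * u 3)
          * (-x 1 * v 0 + x 0 * v 1 - x 3 * v 2 + x 2 * v 3)) := by
  simp [Fin.sum_univ_four, kepler, hopf]
  ring

theorem sum_sq_aux {c s C S K L : ℝ} (p q h α β : ℝ) (e1 : s ^ 2 + c ^ 2 = 1)
    (e2 : S ^ 2 + C ^ 2 = 1) (e3 : L ^ 2 + K ^ 2 = 1) :
    ((p * c + q * (-s * h)) * C + q * c * (-S * α)) * ((p * c + q * (-s * h)) * C + q * c * (-S * α))
      + ((p * c + q * (-s * h)) * S + q * c * (C * α)) * ((p * c + q * (-s * h)) * S + q * c * (C * α))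
      + ((p * s + q * (c * h)) * K + q * s * (-L * β)) * ((p * s + q * (c * h)) * K + q * s * (-L * β))
      + ((p * s + q * (c * h)) * L + q * s * (K * β)) * ((p * s + q * (c * h)) * L + q * s * (K * β))
      = p ^ 2 + q ^ 2 * (h ^ 2 + c ^ 2 * α ^ 2 + s ^ 2 * β ^ 2) := by
  linear_combination ((p * c - q * s * h) ^ 2 + q ^ 2 * c ^ 2 * α ^ 2) * e2
    + ((p * s + q * c * h) ^ 2 + q ^ 2 * s ^ 2 * β ^ 2) * e3 + (p ^ 2 + q ^ 2 * h ^ 2) * e1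

theorem hopf_form_aux {c s C S K L : ℝ} (p q h α β : ℝ)
    (e2 : S ^ 2 + C ^ 2 = 1) (e3 : L ^ 2 + K ^ 2 = 1) :
    -(q * c * S) * ((p * c + q * (-s * h)) * C + q * c * (-S * α))
      + q * c * C * ((p * c + q * (-s * h)) * S + q * c * (C * α))
      - q * s * L * ((p * s + q * (c * h)) * K + q * s * (-L * β))
      + q * s * K * ((p * s + q * (c * h)) * L + q * s * (K * β))
      = q ^ 2 * (c ^ 2 * α + s ^ 2 * β) := by
  linear_combination q ^ 2 * c ^ 2 * α * e2 + q ^ 2 * s ^ 2 * β * e3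

theorem hasDerivAt_vec {f₀ f₁ f₂ f₃ : ℝ → ℝ} {d₀ d₁ d₂ d₃ t : ℝ} (h₀ : HasDerivAt f₀ d₀ t)
    (h₁ : HasDerivAt f₁ d₁ t) (h₂ : HasDerivAt f₂ d₂ t) (h₃ : HasDerivAt f₃ d₃ t) :
    HasDerivAt (fun s => (!₂[f₀ s, f₁ s, f₂ s, f₃ s] : E4)) !₂[d₀, d₁, d₂, d₃] t := by
  have h : HasDerivAt (fun s => ![f₀ s, f₁ s, f₂ s, f₃ s]) ![d₀, d₁, d₂, d₃] t := by
    refine hasDerivAt_pi.2 fun i => ?_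
    fin_cases i
    exacts [h₀, h₁, h₂, h₃]
  exact (PiLp.continuousLinearEquiv 2 ℝ (fun _ : Fin 4 => ℝ)).symm.hasFDerivAt.comp_hasDerivAt t h

/-- The line element of the metric `kepler a b c d` in Euler coordinates, along any curve. -/
theorem polar_form (a b c d : ℝ) {r θ φ χ : ℝ → ℝ} {r' θ' φ' χ' t : ℝ}
    (hr : HasDerivAt r r' t) (hθ : HasDerivAt θ θ' t) (hφ : HasDerivAt φ φ' t)
    (hχ : HasDerivAt χ χ' t) (hpos : 0 < r t) (hden : 1 + c * r t + d * r t ^ 2 ≠ 0) :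
    ∃ v : E4, HasDerivAt (fun s => euler (r s) (θ s) (φ s) (χ s)) v t ∧
      ∑ i, ∑ j, kepler a b c d (euler (r t) (θ t) (φ t) (χ t)) i j * v i * v j =
        (a + b * r t) / r t *
            (r' ^ 2 + r t ^ 2 * θ' ^ 2 + r t ^ 2 * Real.sin (θ t) ^ 2 * φ' ^ 2)
          + (a * r t + b * r t ^ 2) / (1 + c * r t + d * r t ^ 2)
            * (χ' + Real.cos (θ t) * φ') ^ 2 := by
  have hq := hr.sqrt hpos.ne'
  have hc := (hθ.div_const 2).cos
  have hs := (hθ.div_const 2).sin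
  have hcA := ((hχ.add hφ).div_const 2).cos
  have hsA := ((hχ.add hφ).div_const 2).sin
  have hcB := ((hχ.sub hφ).div_const 2).cos
  have hsB := ((hχ.sub hφ).div_const 2).sin
  have h0 := (hq.mul hc).mul hcA
  have h1 := (hq.mul hc).mul hsA
  have h2 := (hq.mul hs).mul hcB
  have h3 := (hq.mul hs).mul hsB
  refine ⟨_, hasDerivAt_vec h0 h1 h2 h3, ?_⟩
  · rw [kepler_form, norm_sq_eq]
    have hqq : √(r t) ^ 2 = r t := Real.sq_sqrt hpos.le
    have hq0 : √(r t) ≠ 0 := (Real.sqrt_pos.2 hpos).ne'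
    have e1 := Real.sin_sq_add_cos_sq (θ t / 2)
    have e2 := Real.sin_sq_add_cos_sq ((χ t + φ t) / 2)
    have e3 := Real.sin_sq_add_cos_sq ((χ t - φ t) / 2)
    have e4 : Real.cos (θ t) = Real.cos (θ t / 2) ^ 2 - Real.sin (θ t / 2) ^ 2 := by
      rw [← Real.cos_two_mul']; ring_nf
    have e5 : Real.sin (θ t) = 2 * Real.sin (θ t / 2) * Real.cos (θ t / 2) := by
      rw [← Real.sin_two_mul]; ring_nf
    have hN : (√(r t) * Real.cos (θ t / 2) * Real.cos ((χ t + φ t) / 2)) ^ 2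
        + (√(r t) * Real.cos (θ t / 2) * Real.sin ((χ t + φ t) / 2)) ^ 2
        + (√(r t) * Real.sin (θ t / 2) * Real.cos ((χ t - φ t) / 2)) ^ 2
        + (√(r t) * Real.sin (θ t / 2) * Real.sin ((χ t - φ t) / 2)) ^ 2 = r t := by
      linear_combination √(r t) ^ 2 * Real.cos (θ t / 2) ^ 2 * e2
        + √(r t) ^ 2 * Real.sin (θ t / 2) ^ 2 * e3 + √(r t) ^ 2 * e1 + hqq
    have hp : (r' / (2 * √(r t))) ^ 2 = r' ^ 2 / (4 * r t) := by
      rw [div_pow, mul_pow, hqq]; norm_num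
    have hS := sum_sq_aux (r' / (2 * √(r t))) (√(r t)) (θ' / 2) ((χ' + φ') / 2) ((χ' - φ') / 2)
      e1 e2 e3
    have hW := hopf_form_aux (c := Real.cos (θ t / 2)) (s := Real.sin (θ t / 2))
      (r' / (2 * √(r t))) (√(r t)) (θ' / 2) ((χ' + φ') / 2) ((χ' - φ') / 2) e2 e3
    rw [hqq] at hS hW
    rw [hp] at hS
    change 4 * (a + b * ((√(r t) * Real.cos (θ t / 2) * Real.cos ((χ t + φ t) / 2)) ^ 2
        + (√(r t) * Real.cos (θ t / 2) * Real.sin ((χ t + φ t) / 2)) ^ 2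
        + (√(r t) * Real.sin (θ t / 2) * Real.cos ((χ t - φ t) / 2)) ^ 2
        + (√(r t) * Real.sin (θ t / 2) * Real.sin ((χ t - φ t) / 2)) ^ 2)) * (_ - (c + d *
        ((√(r t) * Real.cos (θ t / 2) * Real.cos ((χ t + φ t) / 2)) ^ 2
        + (√(r t) * Real.cos (θ t / 2) * Real.sin ((χ t + φ t) / 2)) ^ 2
        + (√(r t) * Real.sin (θ t / 2) * Real.cos ((χ t - φ t) / 2)) ^ 2
        + (√(r t) * Real.sin (θ t / 2) * Real.sin ((χ t - φ t) / 2)) ^ 2)) / (1 + c *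
        ((√(r t) * Real.cos (θ t / 2) * Real.cos ((χ t + φ t) / 2)) ^ 2
        + (√(r t) * Real.cos (θ t / 2) * Real.sin ((χ t + φ t) / 2)) ^ 2
        + (√(r t) * Real.sin (θ t / 2) * Real.cos ((χ t - φ t) / 2)) ^ 2
        + (√(r t) * Real.sin (θ t / 2) * Real.sin ((χ t - φ t) / 2)) ^ 2) + d *
        ((√(r t) * Real.cos (θ t / 2) * Real.cos ((χ t + φ t) / 2)) ^ 2
        + (√(r t) * Real.cos (θ t / 2) * Real.sin ((χ t + φ t) / 2)) ^ 2
        + (√(r t) * Real.sin (θ t / 2) * Real.cos ((χ t - φ t) / 2)) ^ 2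
        + (√(r t) * Real.sin (θ t / 2) * Real.sin ((χ t - φ t) / 2)) ^ 2) ^ 2) * _ * _) = _
    rw [hN]
    refine (congrArg₂ (fun A B => 4 * (a + b * r t) * (A - (c + d * r t) /
      (1 + c * r t + d * r t ^ 2) * B * B)) hS hW).trans ?_
    have e6 : Real.sin (θ t / 2) ^ 2 = 1 - Real.cos (θ t / 2) ^ 2 := by linarith
    have e7 : c + d * r t = (1 + c * r t + d * r t ^ 2 - 1) / r t := by
      field_simp
      ring
    rw [e4, e5, mul_pow, mul_pow, e6, e7]
    generalize 1 + c * r t + d * r t ^ 2 = X at hden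
    field_simp
    ring

theorem kepler_den {a b : ℝ} (ha : 0 < a) (r : ℝ) :
    1 + 2 * b / a * r + b ^ 2 / a ^ 2 * r ^ 2 = ((a + b * r) / a) ^ 2 := by
  field_simp
  ring

theorem hopf_smooth : ContDiff ℝ ∞ hopf := by
  rw [contDiff_euclidean]
  intro i
  fin_cases i <;> simp [hopf] <;> fun_prop

/-- The standard Euclidean Taub-NUT metric with parameters `a, b > 0`: the case `c = 2 b / a`,
`d = b² / a²`. -/
def taubNUT (a b : ℝ) (ha : 0 < a) (hb : 0 < b) : RiemannianMetric where
  toMatrix := kepler a b (2 * b / a) (b ^ 2 / a ^ 2)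
  smooth i j := by
    have h := contDiff_euclidean.1 hopf_smooth
    have h0 : ContDiff ℝ ∞ fun x : E4 => ‖x‖ ^ 2 := contDiff_norm_sq ℝ
    have h1 : ∀ x : E4,
        1 + 2 * b / a * ‖x‖ ^ 2 + b ^ 2 / a ^ 2 * (‖x‖ ^ 2) ^ 2 ≠ 0 := fun x => by positivity
    unfold kepler
    refine (contDiff_const.mul (contDiff_const.add (contDiff_const.mul h0))).mul
      (contDiff_const.sub ((ContDiff.mul (ContDiff.div ?_ ?_ h1) (h i)).mul (h j)))
    · exact contDiff_const.add (contDiff_const.mul h0)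
    · exact (contDiff_const.add (contDiff_const.mul h0)).add (contDiff_const.mul (h0.pow 2))
  symm x i j := by
    simp only [kepler, eq_comm (a := i) (b := j)]
    ring
  pos x v hv := by
    rw [kepler_form]
    have hr : 0 ≤ ‖x‖ ^ 2 := by positivity
    have hv2 : 0 < ‖v‖ ^ 2 := by positivity
    rw [norm_sq_eq] at hv2
    have hx := norm_sq_eq x
    generalize ‖x‖ ^ 2 = r at hr hx
    have hk : (2 * b / a + b ^ 2 / a ^ 2 * r) / (1 + 2 * b / a * r + b ^ 2 / a ^ 2 * r ^ 2) * r
        < 1 := by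
      rw [div_mul_eq_mul_div, div_lt_one (by positivity)]
      nlinarith
    have hk0 : 0 ≤ (2 * b / a + b ^ 2 / a ^ 2 * r) / (1 + 2 * b / a * r + b ^ 2 / a ^ 2 * r ^ 2) := by
      positivity
    generalize (2 * b / a + b ^ 2 / a ^ 2 * r) / (1 + 2 * b / a * r + b ^ 2 / a ^ 2 * r ^ 2) = k
      at hk hk0
    have hcs : (-x 1 * v 0 + x 0 * v 1 - x 3 * v 2 + x 2 * v 3) ^ 2
        ≤ r * (v 0 ^ 2 + v 1 ^ 2 + v 2 ^ 2 + v 3 ^ 2) := by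
      rw [hx]
      nlinarith [sq_nonneg (x 0 * v 0 + x 1 * v 1), sq_nonneg (x 2 * v 2 + x 3 * v 3),
        sq_nonneg (x 0 * v 2 + x 3 * v 1), sq_nonneg (x 1 * v 2 - x 3 * v 0),
        sq_nonneg (x 0 * v 3 - x 2 * v 1), sq_nonneg (x 1 * v 3 + x 2 * v 0)]
    have hfac : 0 < 4 * (a + b * r) := by positivity
    refine mul_pos hfac ?_
    nlinarith [mul_le_mul_of_nonneg_left hcs hk0]

theorem frame_dot (l k : ℝ) (x : E4) (i j : Fin 4) :
    (l • (EuclideanSpace.single i 1 + (k * hopf x i) • hopf x) : E4) 0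
        * (l • (EuclideanSpace.single j 1 + (k * hopf x j) • hopf x) : E4) 0
      + (l • (EuclideanSpace.single i 1 + (k * hopf x i) • hopf x) : E4) 1
        * (l • (EuclideanSpace.single j 1 + (k * hopf x j) • hopf x) : E4) 1
      + (l • (EuclideanSpace.single i 1 + (k * hopf x i) • hopf x) : E4) 2
        * (l • (EuclideanSpace.single j 1 + (k * hopf x j) • hopf x) : E4) 2
      + (l • (EuclideanSpace.single i 1 + (k * hopf x i) • hopf x) : E4) 3
        * (l • (EuclideanSpace.single j 1 + (k * hopf x j) • hopf x) : E4) 3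
      = l ^ 2 * ((if i = j then 1 else 0)
        + (2 * k + k ^ 2 * ‖x‖ ^ 2) * (hopf x i * hopf x j)) := by
  rw [norm_sq_eq]
  fin_cases i <;> fin_cases j <;> simp [hopf] <;> ring

theorem frame_hopf (l k : ℝ) (x : E4) (i : Fin 4) :
    -x 1 * (l • (EuclideanSpace.single i 1 + (k * hopf x i) • hopf x) : E4) 0
      + x 0 * (l • (EuclideanSpace.single i 1 + (k * hopf x i) • hopf x) : E4) 1
      - x 3 * (l • (EuclideanSpace.single i 1 + (k * hopf x i) • hopf x) : E4) 2
      + x 2 * (l • (EuclideanSpace.single i 1 + (k * hopf x i) • hopf x) : E4) 3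
      = l * (1 + k * ‖x‖ ^ 2) * hopf x i := by
  rw [norm_sq_eq]
  fin_cases i <;> simp [hopf] <;> ring

/-- The orthonormal frame of the Taub-NUT metric `g` obtained by applying the positive square
root `g^{-1/2}` to the standard coordinate frame of `ℝ⁴`. -/
def taubNUTFrame (a b : ℝ) (ha : 0 < a) (hb : 0 < b) : OrthonormalFrame (taubNUT a b ha hb) where
  vec i x := (1 / (2 * √(a + b * ‖x‖ ^ 2))) •
    (EuclideanSpace.single i 1 + (b / a * hopf x i) • hopf x)
  smooth i := by
    have h0 : ContDiff ℝ ∞ fun x : E4 => ‖x‖ ^ 2 := contDiff_norm_sq ℝ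
    have h1 : ContDiff ℝ ∞ fun x : E4 => √(a + b * ‖x‖ ^ 2) :=
      (contDiff_const.add (contDiff_const.mul h0)).sqrt fun x => by positivity
    refine (contDiff_const.div (contDiff_const.mul h1) fun x => by positivity).smul
      (contDiff_const.add ((contDiff_const.mul (contDiff_euclidean.1 hopf_smooth i)).smul
        hopf_smooth))
  orthonormal x i j := by
    have hr : 0 ≤ ‖x‖ ^ 2 := by positivity
    have hx := norm_sq_eq x
    have hp : 0 < a + b * ‖x‖ ^ 2 := by positivity
    have hs : √(a + b * ‖x‖ ^ 2) ^ 2 = a + b * ‖x‖ ^ 2 := Real.sq_sqrt hp.le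
    have hs0 : √(a + b * ‖x‖ ^ 2) ≠ 0 := (Real.sqrt_pos.2 hp).ne'
    have ha0 := ha.ne'
    rw [RiemannianMetric.inner, show (taubNUT a b ha hb).toMatrix = kepler a b (2 * b / a)
      (b ^ 2 / a ^ 2) from rfl, kepler_form, frame_dot, frame_hopf, frame_hopf, kepler_den ha]
    generalize √(a + b * ‖x‖ ^ 2) = q at hs hs0 ⊢
    generalize ‖x‖ ^ 2 = ρ at *
    generalize hopf x i = u
    generalize hopf x j = v
    have hp0 := hp.ne'
    have key : (2 * b / a + b ^ 2 / a ^ 2 * ρ) / ((a + b * ρ) / a) ^ 2 * (1 + b / a * ρ) ^ 2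
        = 2 * (b / a) + (b / a) ^ 2 * ρ := by
      field_simp
    have hl : 4 * (a + b * ρ) * (1 / (2 * q)) ^ 2 = 1 := by
      rw [← hs]
      field_simp
      norm_num
    linear_combination (if i = j then 1 else 0) * hl
      - 4 * (a + b * ρ) * (1 / (2 * q)) ^ 2 * u * v * key

end TaubNUT

end

open MeasureTheory
open scoped ContDiff Matrix

namespace TaubNUT

/-! ### Explicit form of the Dirac operator of the Taub-NUT metric -/

/-! Taub-NUT is hyperkähler, hence scalar-flat, so the Lichnerowicz formula carries no curvature
term: `∫ |Dφ|² = ∫ |∇φ|²` for test spinors. Heuristically an `L²` harmonic spinor is then parallel,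
so of constant length, and must vanish because the volume is infinite. The proof makes this
quantitative and thereby avoids elliptic regularity: a Hardy inequality bounds the energy from
below, it is extended to weak derivatives, and it is applied to cutoffs of `ψ`.

Write `m = a + b‖x‖²`, `κ = b/a`, `β = b/m`, and let `h` be the Hopf field. The orthonormal frame is
`E_i / (2√m)` with `E_i = ∂_i + κ h_i h`, and `D = (2√m)⁻¹ · flatDirac` (`dirac_taubNUT`). The
volume density is `16am`, so `|Dφ|² dvol` is `4a |flatDirac φ|² dx`, and likewise for `∇`: the
weight `m` disappears and everything happens over Lebesgue measure. In this frame the spin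
connection vanishes on chirality `+1`, where the constant spinors are parallel, and equals
`spinForm` on chirality `-1`.

The Lichnerowicz formula is proved without computing curvature. In the expansion of `|∑ c_i ∇_i φ|²`
the cross terms are 2×2 minors of frame derivatives, that is, null Lagrangians; on chirality `-1` a
radial divergence is left over as well (`lichnerowicz_pos`, `lichnerowicz_neg`). Since `x = ∑ x_i
E_i` and the connection has no radial component, the energy controls the radial derivative, and
Hardy's inequality gives `∫ |φ|²/(1+‖x‖²) ≤ ∫ |flatDirac φ|²` (`hardy_dirac`).

Friedrichs mollification extends this, with a worse constant, to compactly supported `u ∈ L²` whose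
weak `flatDirac u` is in `L²` (`hardy_weak`). For `u = χ_R ψ` with `Dψ = 0` weakly, only the
derivative of the cutoff contributes, of size `O(1/R)|ψ|`; letting `R → ∞` forces `ψ = 0`. Both
chiral kernels are therefore trivial and the index is `0`. -/

theorem cliff_ofLp (i : Fin 4) (ψ : Spinor) (k : Fin 4) :
    cliff i ψ k = (gamma i *ᵥ ψ.ofLp) k := by
  rw [cliff, Matrix.ofLp_toEuclideanCLM]

theorem cliff_zero (ψ : Spinor) : cliff 0 ψ = !₂[-ψ 2, -ψ 3, ψ 0, ψ 1] := by
  ext k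
  rw [cliff_ofLp]
  fin_cases k <;> simp [gamma, Matrix.mulVec, dotProduct, Fin.sum_univ_four]

theorem cliff_one (ψ : Spinor) : cliff 1 ψ =
    !₂[Complex.I * ψ 3, Complex.I * ψ 2, Complex.I * ψ 1, Complex.I * ψ 0] := by
  ext k
  rw [cliff_ofLp]
  fin_cases k <;> simp [gamma, Matrix.mulVec, dotProduct, Fin.sum_univ_four]

theorem cliff_two (ψ : Spinor) : cliff 2 ψ = !₂[ψ 3, -ψ 2, ψ 1, -ψ 0] := by
  ext k
  rw [cliff_ofLp]
  fin_cases k <;> simp [gamma, Matrix.mulVec, dotProduct, Fin.sum_univ_four]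

theorem cliff_three (ψ : Spinor) : cliff 3 ψ =
    !₂[Complex.I * ψ 2, -(Complex.I * ψ 3), Complex.I * ψ 0, -(Complex.I * ψ 1)] := by
  ext k
  rw [cliff_ofLp]
  fin_cases k <;> simp [gamma, Matrix.mulVec, dotProduct, Fin.sum_univ_four]

/-- The generator of the Hopf circle action as a linear map. -/
noncomputable def hopfCLM : E4 →L[ℝ] E4 :=
  LinearMap.toContinuousLinearMap
    { toFun := hopf
      map_add' := fun x y => by ext i; fin_cases i <;> simp [hopf] <;> ring
      map_smul' := fun c x => by ext i; fin_cases i <;> simp [hopf] }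

theorem hopfCLM_apply (x : E4) : hopfCLM x = hopf x := rfl

theorem hasFDerivAt_hopf (x : E4) : HasFDerivAt hopf hopfCLM x := hopfCLM.hasFDerivAt

theorem hasFDerivAt_hopf_apply (i : Fin 4) (x : E4) :
    HasFDerivAt (fun y => hopf y i) ((EuclideanSpace.proj i : E4 →L[ℝ] ℝ) ∘L hopfCLM) x :=
  (EuclideanSpace.proj i : E4 →L[ℝ] ℝ).hasFDerivAt.comp x (hasFDerivAt_hopf x)

/-- The frame `∂_i + (b/a) h_i h`, with `h` the Hopf field. -/
noncomputable def flatFrame (κ : ℝ) (i : Fin 4) (x : E4) : E4 :=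
  EuclideanSpace.single i 1 + (κ * hopf x i) • hopf x

theorem inner_self_hopf (x : E4) : inner ℝ x (hopf x) = 0 := by
  simp [hopf, PiLp.inner_apply, Fin.sum_univ_four]; ring

theorem inner_flatFrame (κ : ℝ) (i : Fin 4) (x : E4) : inner ℝ x (flatFrame κ i x) = x i := by
  rw [flatFrame, inner_add_right, inner_smul_right, inner_self_hopf]
  simp [EuclideanSpace.inner_single_right]

theorem conformal_pos {a b : ℝ} (ha : 0 < a) (hb : 0 < b) (x : E4) : 0 < a + b * ‖x‖ ^ 2 := by positivity

theorem hasFDerivAt_scale {a b : ℝ} (ha : 0 < a) (hb : 0 < b) (x : E4) :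
    HasFDerivAt (fun y : E4 => 1 / (2 * √(a + b * ‖y‖ ^ 2)))
      (-(1 / (2 * √(a + b * ‖x‖ ^ 2)) * (b / (a + b * ‖x‖ ^ 2))) • innerSL ℝ x) x := by
  have hm := conformal_pos ha hb x
  have h1 : HasFDerivAt (fun y : E4 => ‖y‖ ^ 2) (2 • innerSL ℝ x) x :=
    (hasStrictFDerivAt_norm_sq x).hasFDerivAt
  have h2 : HasDerivAt (fun r : ℝ => 1 / (2 * √(a + b * r)))
      (-(1 / (2 * √(a + b * ‖x‖ ^ 2)) * (b / (2 * (a + b * ‖x‖ ^ 2))))) (‖x‖ ^ 2) := by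
    have h3 : HasDerivAt (fun r : ℝ => a + b * r) b (‖x‖ ^ 2) := by
      simpa using ((hasDerivAt_id (‖x‖ ^ 2)).const_mul b).const_add a
    have h4 := ((h3.sqrt hm.ne').const_mul 2).inv (by positivity)
    have hs : √(a + b * ‖x‖ ^ 2) ^ 2 = a + b * ‖x‖ ^ 2 := Real.sq_sqrt hm.le
    have hs0 : √(a + b * ‖x‖ ^ 2) ≠ 0 := (Real.sqrt_pos.2 hm).ne'
    simp only [one_div]
    refine h4.congr_deriv ?_
    generalize √(a + b * ‖x‖ ^ 2) = s at hs hs0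
    rw [← hs]
    field_simp
  have h5 := h2.comp_hasFDerivAt x h1
  refine h5.congr_fderiv ?_
  ext v
  have hm0 := hm.ne'
  simp
  field_simp

theorem hasFDerivAt_flatFrame (κ : ℝ) (i : Fin 4) (x : E4) :
    HasFDerivAt (flatFrame κ i)
      ((κ * hopf x i) • hopfCLM
        + (κ • ((EuclideanSpace.proj i : E4 →L[ℝ] ℝ) ∘L hopfCLM)).smulRight (hopf x)) x :=
  (((hasFDerivAt_hopf_apply i x).const_mul κ).smul (hasFDerivAt_hopf x)).const_add _

theorem fderiv_frame {a b : ℝ} (ha : 0 < a) (hb : 0 < b) (i : Fin 4) (x v : E4) :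
    fderiv ℝ ((taubNUTFrame a b ha hb).vec i) x v =
      (1 / (2 * √(a + b * ‖x‖ ^ 2))) •
        ((b / a * hopf x i) • hopf v + (b / a * hopf v i) • hopf x
          - (b / (a + b * ‖x‖ ^ 2) * inner ℝ x v) • flatFrame (b / a) i x) := by
  have h : HasFDerivAt ((taubNUTFrame a b ha hb).vec i) _ x :=
    (hasFDerivAt_scale ha hb x).smul (hasFDerivAt_flatFrame (b / a) i x)
  rw [h.fderiv]
  ext l
  simp [hopfCLM_apply, flatFrame]
  split_ifs <;> ring

theorem frame_eq {a b : ℝ} (ha : 0 < a) (hb : 0 < b) (i : Fin 4) (x : E4) : (taubNUTFrame a b ha hb).vec i x =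
    (1 / (2 * √(a + b * ‖x‖ ^ 2))) • flatFrame (b / a) i x := rfl

/-- The frame is `g^{-1/2}` applied to the standard basis, so pairing with its `k`-th vector reads
off the `k`-th coordinate of `g^{1/2} u`. The two forms match because `(1 + κ h ⊗ h)⁻¹ = 1 - β h ⊗
h`, using `‖h‖ = ‖x‖`. -/
theorem inner_frame {a b : ℝ} (ha : 0 < a) (hb : 0 < b) (x u : E4) (k : Fin 4) :
    (taubNUT a b ha hb).inner x u ((taubNUTFrame a b ha hb).vec k x) =
      2 * √(a + b * ‖x‖ ^ 2) *
        (u k - b / (a + b * ‖x‖ ^ 2) * hopf x k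
          * (-x 1 * u 0 + x 0 * u 1 - x 3 * u 2 + x 2 * u 3)) := by
  have hm := conformal_pos ha hb x
  have hs : √(a + b * ‖x‖ ^ 2) ^ 2 = a + b * ‖x‖ ^ 2 := Real.sq_sqrt hm.le
  have hs0 : √(a + b * ‖x‖ ^ 2) ≠ 0 := (Real.sqrt_pos.2 hm).ne'
  have hd : u 0 * (flatFrame (b / a) k x) 0 + u 1 * (flatFrame (b / a) k x) 1
      + u 2 * (flatFrame (b / a) k x) 2 + u 3 * (flatFrame (b / a) k x) 3
      = u k + b / a * hopf x k * (-x 1 * u 0 + x 0 * u 1 - x 3 * u 2 + x 2 * u 3) := by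
    fin_cases k <;> simp [flatFrame, hopf] <;> ring
  have hh : -x 1 * (flatFrame (b / a) k x) 0 + x 0 * (flatFrame (b / a) k x) 1
      - x 3 * (flatFrame (b / a) k x) 2 + x 2 * (flatFrame (b / a) k x) 3
      = (1 + b / a * ‖x‖ ^ 2) * hopf x k := by
    rw [norm_sq_eq]
    fin_cases k <;> simp [flatFrame, hopf] <;> ring
  rw [RiemannianMetric.inner, show (taubNUT a b ha hb).toMatrix = kepler a b (2 * b / a)
      (b ^ 2 / a ^ 2) from rfl, kepler_form, frame_eq, kepler_den ha]
  simp only [PiLp.smul_apply, smul_eq_mul]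
  generalize √(a + b * ‖x‖ ^ 2) = q at *
  generalize ‖x‖ ^ 2 = ρ at *
  generalize (flatFrame (b / a) k x) 0 = w0 at *
  generalize (flatFrame (b / a) k x) 1 = w1 at *
  generalize (flatFrame (b / a) k x) 2 = w2 at *
  generalize (flatFrame (b / a) k x) 3 = w3 at *
  generalize hopf x k = hk at *
  generalize u k = uk at *
  have key : (2 * b / a + b ^ 2 / a ^ 2 * ρ) / ((a + b * ρ) / a) ^ 2 * (1 + b / a * ρ)
      = b / a + b / (a + b * ρ) := by
    field_simp
    ring
  have h4 : 4 * (a + b * ρ) * (1 / (2 * q)) = 2 * q := by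
    rw [← hs]; field_simp; norm_num
  set U := -x 1 * u 0 + x 0 * u 1 - x 3 * u 2 + x 2 * u 3
  calc _ = 4 * (a + b * ρ) * (1 / (2 * q)) * ((u 0 * w0 + u 1 * w1 + u 2 * w2 + u 3 * w3)
        - (2 * b / a + b ^ 2 / a ^ 2 * ρ) / ((a + b * ρ) / a) ^ 2 * U
          * (-x 1 * w0 + x 0 * w1 - x 3 * w2 + x 2 * w3)) := by ring
    _ = _ := by
      rw [hd, hh, h4]
      linear_combination (-2 * q * U * hk) * key

/-- The matrix of the Hopf field. -/
def hopfMatrix : Matrix (Fin 4) (Fin 4) ℝ :=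
  !![0, -1, 0, 0; 1, 0, 0, 0; 0, 0, 0, -1; 0, 0, 1, 0]

set_option maxHeartbeats 1600000 in
theorem inner_lieBracket_frame {a b : ℝ} (ha : 0 < a) (hb : 0 < b) (i j k : Fin 4) (x : E4) :
    (taubNUT a b ha hb).inner x (VectorField.lieBracket ℝ ((taubNUTFrame a b ha hb).vec i)
      ((taubNUTFrame a b ha hb).vec j) x) ((taubNUTFrame a b ha hb).vec k x) =
      1 / (2 * √(a + b * ‖x‖ ^ 2)) * (-2 * (b / (a + b * ‖x‖ ^ 2)) * hopfMatrix i j * hopf x k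
        + b / a * (hopf x j * hopfMatrix k i - hopf x i * hopfMatrix k j)
        - b / (a + b * ‖x‖ ^ 2) * ((if j = k then x i else 0) - (if i = k then x j else 0))) := by
  have hm := conformal_pos ha hb x
  have hs0 : √(a + b * ‖x‖ ^ 2) ≠ 0 := (Real.sqrt_pos.2 hm).ne'
  set l := 1 / (2 * √(a + b * ‖x‖ ^ 2)) with hl
  have hl2 : 2 * √(a + b * ‖x‖ ^ 2) * l = 1 := by rw [hl]; field_simp
  have hr : a + b * ‖x‖ ^ 2 ≠ 0 := hm.ne'
  have ha' := ha.ne'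
  have e : b / (a + b * ‖x‖ ^ 2) * (1 + b / a * (x 0 ^ 2 + x 1 ^ 2 + x 2 ^ 2 + x 3 ^ 2)) = b / a := by
    rw [← norm_sq_eq]; field_simp
  have hZ : VectorField.lieBracket ℝ ((taubNUTFrame a b ha hb).vec i)
      ((taubNUTFrame a b ha hb).vec j) x = (l * l) •
        ((b / a * hopf x j) • hopf (flatFrame (b / a) i x)
          + (b / a * hopf (flatFrame (b / a) i x) j) • hopf x
          - (b / (a + b * ‖x‖ ^ 2) * x i) • flatFrame (b / a) j x
          - ((b / a * hopf x i) • hopf (flatFrame (b / a) j x)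
          + (b / a * hopf (flatFrame (b / a) j x) i) • hopf x
          - (b / (a + b * ‖x‖ ^ 2) * x j) • flatFrame (b / a) i x)) := by
    rw [VectorField.lieBracket, fderiv_frame, fderiv_frame, frame_eq, frame_eq, ← hl]
    simp only [inner_smul_right, inner_flatFrame, ← hopfCLM_apply, map_smul]
    ext k
    simp only [PiLp.smul_apply, PiLp.add_apply, PiLp.sub_apply, smul_eq_mul]
    ring
  rw [inner_frame, hZ]
  simp only [PiLp.smul_apply, PiLp.add_apply, PiLp.sub_apply, smul_eq_mul]
  generalize b / (a + b * ‖x‖ ^ 2) = β at e ⊢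
  generalize √(a + b * ‖x‖ ^ 2) = q at hl2 ⊢
  generalize b / a = κ at e ⊢
  suffices h : ∀ Z : E4, 2 * q * (l * l * Z k - β * hopf x k * (-x 1 * (l * l * Z 0)
      + x 0 * (l * l * Z 1) - x 3 * (l * l * Z 2) + x 2 * (l * l * Z 3))) =
      l * (Z k - β * hopf x k * (-x 1 * Z 0 + x 0 * Z 1 - x 3 * Z 2 + x 2 * Z 3)) by
    refine (h ((κ * hopf x j) • hopf (flatFrame κ i x)
          + (κ * hopf (flatFrame κ i x) j) • hopf x
          - (β * x i) • flatFrame κ j x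
          - ((κ * hopf x i) • hopf (flatFrame κ j x)
          + (κ * hopf (flatFrame κ j x) i) • hopf x
          - (β * x j) • flatFrame κ i x))).trans ?_
    congr 1
    -- `key` adds a multiple of `β(1 + κ‖x‖²) - κ`, which is zero. With this correction the claim is
    -- a polynomial identity for each triple of indices.
    have key : ∀ A : ℝ, A + hopf x k * (β * (x i * hopf x j - x j * hopf x i)
        - (-2 * hopfMatrix i j + κ * (hopf x j * x i - hopf x i * x j)))
        * (β * (1 + κ * (x 0 ^ 2 + x 1 ^ 2 + x 2 ^ 2 + x 3 ^ 2)) - κ) = A := fun A => by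
      rw [e]; ring
    clear hZ hm hs0 h
    rw [← key (-2 * _ * _ * _ + _ - _)]
    fin_cases i <;> fin_cases j <;> fin_cases k <;>
      simp [hopf, flatFrame, hopfMatrix] <;> ring
  intro Z
  linear_combination (l * (Z k - β * hopf x k * (-x 1 * Z 0 + x 0 * Z 1 - x 3 * Z 2 + x 2 * Z 3))) * hl2

end TaubNUT

namespace TaubNUT

/-! ### The spin connection, the rescaled Dirac operator and the volume density. -/

theorem christoffel_taubNUT {a b : ℝ} (ha : 0 < a) (hb : 0 < b) (i j k : Fin 4) (x : E4) :
    (taubNUTFrame a b ha hb).christoffel i j k x =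
      1 / (2 * √(a + b * ‖x‖ ^ 2)) *
        (b / (a + b * ‖x‖ ^ 2) * (hopf x i * hopfMatrix j k + hopf x j * hopfMatrix i k
            - hopf x k * hopfMatrix i j)
          + b / a * (hopf x i * hopfMatrix j k)
          - b / (a + b * ‖x‖ ^ 2) * ((if i = j then x k else 0) - (if i = k then x j else 0))) := by
  have anti : ∀ p q, hopfMatrix p q = -hopfMatrix q p := by
    intro p q
    fin_cases p <;> fin_cases q <;> simp [hopfMatrix]
  rw [OrthonormalFrame.christoffel, inner_lieBracket_frame, inner_lieBracket_frame,
    inner_lieBracket_frame, anti k i, anti k j, anti j i]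
  simp only [eq_comm (a := k), eq_comm (a := j) (b := i)]
  split_ifs <;> ring

/-- The projection onto the half-spinors of chirality `-1`. -/
noncomputable def negPart (ψ : Spinor) : Spinor := !₂[ψ 0, ψ 1, 0, 0]

/-- The Levi-Civita connection form, in a rescaled frame, of the Taub-NUT metric. -/
noncomputable def spinForm (κ β : ℝ) (x : E4) (i : Fin 4) (ψ : Spinor) : Spinor :=
  !₂[Complex.I * (((κ + β) * hopf x i : ℝ) : ℂ) * ψ 1
      - ((β * ![-x 2, x 3, x 0, -x 1] i : ℝ) : ℂ) * ψ 1
      - Complex.I * ((β * ![-x 3, -x 2, x 1, x 0] i : ℝ) : ℂ) * ψ 0,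
    Complex.I * (((κ + β) * hopf x i : ℝ) : ℂ) * ψ 0
      + ((β * ![-x 2, x 3, x 0, -x 1] i : ℝ) : ℂ) * ψ 0
      + Complex.I * ((β * ![-x 3, -x 2, x 1, x 0] i : ℝ) : ℂ) * ψ 1, 0, 0]

-- Only one chirality survives: the self-dual combinations of the connection coefficients cancel,
-- which is the hyperkähler property. In this frame constant spinors of chirality `+1` are parallel.
set_option maxHeartbeats 1600000 in
theorem spinForm_taubNUT {a b : ℝ} (ha : 0 < a) (hb : 0 < b) (i : Fin 4) (x : E4) (ψ : Spinor) :
    (1 / 4 : ℂ) • ∑ j, ∑ k, ((taubNUTFrame a b ha hb).christoffel i j k x : ℂ)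
        • cliff j (cliff k ψ) =
      ((1 / (2 * √(a + b * ‖x‖ ^ 2)) : ℝ) : ℂ) •
        spinForm (b / a) (b / (a + b * ‖x‖ ^ 2)) x i ψ := by
  simp only [christoffel_taubNUT]
  generalize 1 / (2 * √(a + b * ‖x‖ ^ 2)) = l
  generalize b / (a + b * ‖x‖ ^ 2) = β
  generalize b / a = κ
  simp only [Fin.sum_univ_four, cliff_zero, cliff_one, cliff_two, cliff_three]
  fin_cases i <;> ext c <;> fin_cases c <;>
    simp [hopf, hopfMatrix, spinForm] <;> ring_nf <;> simp only [Complex.I_sq] <;> ring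

/-- The Dirac operator of the Taub-NUT metric up to its conformal factor. -/
noncomputable def flatDirac (κ β : ℝ) (φ : E4 → Spinor) (x : E4) : Spinor :=
  ∑ i, cliff i (fderiv ℝ φ x (flatFrame κ i x)) +
    ((β - κ : ℝ) : ℂ) • ∑ i, (x i : ℂ) • cliff i (negPart (φ x))

-- After Clifford contraction, the Hopf part and the two other quaternionic rotations in the
-- connection all collapse to Clifford multiplication by the radial field. This is the zeroth-order
-- term of `flatDirac`.
set_option maxHeartbeats 1600000 in
theorem sum_cliff_spinForm (κ β : ℝ) (x : E4) (ψ : Spinor) :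
    ∑ i, cliff i (spinForm κ β x i ψ) =
      ((β - κ : ℝ) : ℂ) • ∑ i, (x i : ℂ) • cliff i (negPart ψ) := by
  simp only [Fin.sum_univ_four, cliff_zero, cliff_one, cliff_two, cliff_three]
  ext c
  fin_cases c <;> simp [hopf, spinForm, negPart] <;> ring_nf <;>
    simp only [Complex.I_sq] <;> ring

theorem dirac_taubNUT {a b : ℝ} (ha : 0 < a) (hb : 0 < b) (φ : E4 → Spinor) (x : E4) :
    (taubNUTFrame a b ha hb).dirac φ x =
      ((1 / (2 * √(a + b * ‖x‖ ^ 2)) : ℝ) : ℂ) •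
        flatDirac (b / a) (b / (a + b * ‖x‖ ^ 2)) φ x := by
  rw [flatDirac, ← sum_cliff_spinForm, ← Finset.sum_add_distrib, Finset.smul_sum,
    OrthonormalFrame.dirac]
  refine Finset.sum_congr rfl fun i _ => ?_
  rw [OrthonormalFrame.spinConnection, spinForm_taubNUT, frame_eq, ← map_add, ← map_smul,
    smul_add, map_smul]
  simp only [Complex.coe_smul]

/-- The metric is conformal to a rank-one perturbation of the identity, so the matrix determinant
lemma applies: `(4m)⁴ · (a/m)² = (16am)²`. -/
theorem det_kepler {a b : ℝ} (ha : 0 < a) (hb : 0 < b) (x : E4) :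
    (kepler a b (2 * b / a) (b ^ 2 / a ^ 2) x).det = (16 * a * (a + b * ‖x‖ ^ 2)) ^ 2 := by
  have hk : kepler a b (2 * b / a) (b ^ 2 / a ^ 2) x = (4 * (a + b * ‖x‖ ^ 2)) •
      (1 + Matrix.replicateCol Unit (fun i => -((2 * b / a + b ^ 2 / a ^ 2 * ‖x‖ ^ 2)
        / (1 + 2 * b / a * ‖x‖ ^ 2 + b ^ 2 / a ^ 2 * (‖x‖ ^ 2) ^ 2)) * hopf x i)
        * Matrix.replicateRow Unit fun i => hopf x i) := by
    ext i j
    simp [kepler, Matrix.mul_apply, Matrix.one_apply]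
    left
    ring
  have hd : (fun i => hopf x i) ⬝ᵥ (fun i => -((2 * b / a + b ^ 2 / a ^ 2 * ‖x‖ ^ 2)
        / (1 + 2 * b / a * ‖x‖ ^ 2 + b ^ 2 / a ^ 2 * (‖x‖ ^ 2) ^ 2)) * hopf x i) =
      -((2 * b / a + b ^ 2 / a ^ 2 * ‖x‖ ^ 2)
        / (1 + 2 * b / a * ‖x‖ ^ 2 + b ^ 2 / a ^ 2 * (‖x‖ ^ 2) ^ 2)) * ‖x‖ ^ 2 := by
    generalize (2 * b / a + b ^ 2 / a ^ 2 * ‖x‖ ^ 2)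
        / (1 + 2 * b / a * ‖x‖ ^ 2 + b ^ 2 / a ^ 2 * (‖x‖ ^ 2) ^ 2) = t
    rw [norm_sq_eq]
    simp [dotProduct, Fin.sum_univ_four, hopf]
    ring
  have hm := (conformal_pos ha hb x).ne'
  rw [hk, Matrix.det_smul, Matrix.det_one_add_replicateCol_mul_replicateRow, hd, kepler_den ha,
    Fintype.card_fin]
  field_simp
  ring

theorem vol_taubNUT {a b : ℝ} (ha : 0 < a) (hb : 0 < b) :
    (taubNUT a b ha hb).vol =
      volume.withDensity fun x : E4 => ENNReal.ofReal (16 * a * (a + b * ‖x‖ ^ 2)) := by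
  rw [RiemannianMetric.vol]
  congr 1
  ext x
  have hm := conformal_pos ha hb x
  rw [show (taubNUT a b ha hb).toMatrix = kepler a b (2 * b / a) (b ^ 2 / a ^ 2) from rfl,
    det_kepler ha hb, Real.sqrt_sq (by positivity)]

end TaubNUT

namespace TaubNUT

/-! ### The Lichnerowicz formula and Hardy's inequality for the rescaled Dirac operator -/

theorem one_add_one_le_infty : (1 + 1 : WithTop ℕ∞) ≤ ∞ :=
  WithTop.coe_le_coe.2 (le_top : (1 + 1 : ℕ∞) ≤ ⊤)

/-- The standard basis of `ℝ⁴`. -/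
noncomputable abbrev basisVec (i : Fin 4) : E4 := EuclideanSpace.single i 1

theorem clm_hopf (D : E4 →L[ℝ] ℝ) (x : E4) :
    D (hopf x) = -x 1 * D (basisVec 0) + x 0 * D (basisVec 1) - x 3 * D (basisVec 2)
      + x 2 * D (basisVec 3) := by
  have h : hopf x = (-x 1) • basisVec 0 + x 0 • basisVec 1 + (-x 3) • basisVec 2
      + x 2 • basisVec 3 := by
    ext l; fin_cases l <;> simp [hopf]
  rw [h]
  simp only [map_add, map_smul, smul_eq_mul]
  ring

/-- The vector field `∑ᵢⱼ` of the torsion of the pair `(i, j)` of frame vectors, corrected by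
divergences. -/
noncomputable def torsionVec (κ : ℝ) (i j : Fin 4) (x : E4) : E4 :=
  (κ * hopf x j) • hopf (basisVec i) - (κ * hopf x i) • hopf (basisVec j)
    - (2 * κ * hopfMatrix i j) • hopf x + (κ * x j) • basisVec i - (κ * x i) • basisVec j

theorem integral_divergence {F : Fin 4 → E4 → ℝ} (hF : ∀ l, ContDiff ℝ 1 (F l))
    (hc : ∀ l, HasCompactSupport (F l)) :
    ∫ x, ∑ l, fderiv ℝ (F l) x (basisVec l) = 0 := by
  have hi : ∀ l, Integrable fun x => fderiv ℝ (F l) x (basisVec l) := fun l =>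
    (((hF l).continuous_fderiv one_ne_zero).clm_apply continuous_const).integrable_of_hasCompactSupport
      ((hc l).fderiv_apply ℝ _)
  rw [integral_finsetSum _ fun l _ => hi l]
  refine Finset.sum_eq_zero fun l _ => ?_
  -- Integration by parts against the constant function `1`.
  have h := integral_mul_fderiv_eq_neg_fderiv_mul_of_integrable (μ := (volume : Measure E4))
    (f := fun _ => (1 : ℝ)) (g := F l) (v := basisVec l) (by simp) (by simpa using hi l)
    (by simpa using (hF l).continuous.integrable_of_hasCompactSupport (hc l))
    (fun _ _ => differentiableAt_const _) (fun x _ => (hF l).differentiable one_ne_zero x)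
  simpa using h

theorem contDiff_hopf_apply (i : Fin 4) : ContDiff ℝ ∞ fun x => hopf x i :=
  contDiff_euclidean.1 hopf_smooth i

theorem contDiff_flatFrame (κ : ℝ) (i : Fin 4) : ContDiff ℝ ∞ (flatFrame κ i) :=
  contDiff_const.add ((contDiff_const.mul (contDiff_hopf_apply i)).smul hopf_smooth)

/-- The divergence of `E_i` is `-κ x_i`: the linear Hopf map `J` is traceless and satisfies `J² =
-1`. The integrand is therefore the divergence of `F E_i`. -/
theorem integral_flatFrame (κ : ℝ) (i : Fin 4) {F : E4 → ℝ} (hF : ContDiff ℝ 1 F)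
    (hc : HasCompactSupport F) :
    ∫ x, (fderiv ℝ F x (flatFrame κ i x) - κ * x i * F x) = 0 := by
  have hw : ∀ l, ContDiff ℝ 1 fun x => flatFrame κ i x l := fun l =>
    (contDiff_euclidean.1 (contDiff_flatFrame κ i) l).of_le (by simp)
  rw [← integral_divergence (F := fun l x => flatFrame κ i x l * F x)
    (fun l => (hw l).mul hF) (fun l => hc.mul_left)]
  congr 1
  ext x
  have hd : ∀ l, fderiv ℝ (fun x => flatFrame κ i x l * F x) x (basisVec l) =
      flatFrame κ i x l * fderiv ℝ F x (basisVec l)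
        + F x * ((κ * hopf x i) * hopf (basisVec l) l + κ * hopf (basisVec l) i * hopf x l) := by
    intro l
    have h1 : HasFDerivAt (fun x => flatFrame κ i x l) _ x :=
      (EuclideanSpace.proj l : E4 →L[ℝ] ℝ).hasFDerivAt.comp x (hasFDerivAt_flatFrame κ i x)
    have h2 := h1.mul (hF.differentiable one_ne_zero x).hasFDerivAt
    rw [HasFDerivAt.fderiv (f := fun x => flatFrame κ i x l * F x) h2]
    simp [hopfCLM_apply, mul_add]
  simp only [hd]
  rw [flatFrame, map_add, map_smul, clm_hopf]
  simp only [Fin.sum_univ_four]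
  fin_cases i <;> simp [hopf] <;> ring

/-- A null Lagrangian made of two frame derivatives. -/
noncomputable def nullForm (κ : ℝ) (i j : Fin 4) (f g : E4 → ℝ) (x : E4) : ℝ :=
  fderiv ℝ f x (flatFrame κ i x) * fderiv ℝ g x (flatFrame κ j x)
    - fderiv ℝ f x (flatFrame κ j x) * fderiv ℝ g x (flatFrame κ i x)
    + f x * fderiv ℝ g x (torsionVec κ i j x)

-- The right side is `[E_i, E_j] - (div E_j) E_i + (div E_i) E_j`. The cubic terms of the bracket
-- cancel against those of the divergence corrections, leaving the quadratic field `torsionVec`.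
set_option maxHeartbeats 1000000 in
theorem torsionVec_eq (κ : ℝ) (i j : Fin 4) (x : E4) :
    torsionVec κ i j x =
      fderiv ℝ (flatFrame κ j) x (flatFrame κ i x) - fderiv ℝ (flatFrame κ i) x (flatFrame κ j x)
        + (κ * x j) • flatFrame κ i x - (κ * x i) • flatFrame κ j x := by
  rw [(hasFDerivAt_flatFrame κ j x).fderiv, (hasFDerivAt_flatFrame κ i x).fderiv]
  fin_cases i <;> fin_cases j <;> ext l <;> fin_cases l <;>
    simp [torsionVec, hopfCLM_apply, hopf, hopfMatrix, flatFrame] <;> ring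

/-- The form is the divergence of `(f E_j g) E_i - (f E_i g) E_j`: second derivatives of `g` cancel
by symmetry, and the commutator and divergences of the frame produce exactly `torsionVec`. -/
theorem integral_nullForm (κ : ℝ) (i j : Fin 4) {f g : E4 → ℝ} (hf : ContDiff ℝ ∞ f)
    (hg : ContDiff ℝ ∞ g) (hc : HasCompactSupport f) :
    ∫ x, nullForm κ i j f g x = 0 := by
  have hd : ∀ j, ContDiff ℝ 1 fun x => fderiv ℝ g x (flatFrame κ j x) := fun j =>
    (hg.fderiv_right (m := 1) one_add_one_le_infty).clm_apply ((contDiff_flatFrame κ j).of_le (by simp))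
  have hF : ∀ j, ContDiff ℝ 1 fun x => f x * fderiv ℝ g x (flatFrame κ j x) := fun j =>
    (hf.of_le (by simp)).mul (hd j)
  have hFc : ∀ j, HasCompactSupport fun x => f x * fderiv ℝ g x (flatFrame κ j x) := fun j =>
    hc.mul_right
  have hI : ∀ i j, Integrable fun x =>
      fderiv ℝ (fun x => f x * fderiv ℝ g x (flatFrame κ j x)) x (flatFrame κ i x)
        - κ * x i * (f x * fderiv ℝ g x (flatFrame κ j x)) := by
    intro i j
    refine Continuous.integrable_of_hasCompactSupport ?_ ?_
    · have h1 := ((hF j).continuous_fderiv one_ne_zero).clm_apply (contDiff_flatFrame κ i).continuous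
      have h2 := (hF j).continuous
      fun_prop
    · refine HasCompactSupport.sub ?_ (hFc j).mul_left
      refine ((hFc j).fderiv ℝ).mono fun x hx => ?_
      contrapose! hx
      simp only [Function.mem_support, ne_eq, not_not] at hx ⊢
      simp [hx]
  have h := integral_sub (hI i j) (hI j i)
  rw [integral_flatFrame κ i (hF j) (hFc j), integral_flatFrame κ j (hF i) (hFc i), sub_zero] at h
  rw [← h]
  congr 1
  ext x
  have hgd : ∀ i j, fderiv ℝ (fun x => f x * fderiv ℝ g x (flatFrame κ j x)) x (flatFrame κ i x)
      = f x * (fderiv ℝ (fderiv ℝ g) x (flatFrame κ i x) (flatFrame κ j x)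
          + fderiv ℝ g x (fderiv ℝ (flatFrame κ j) x (flatFrame κ i x)))
        + fderiv ℝ f x (flatFrame κ i x) * fderiv ℝ g x (flatFrame κ j x) := by
    intro i j
    have h1 := ((hg.fderiv_right (m := 1) one_add_one_le_infty).differentiable one_ne_zero x).hasFDerivAt
    have h2 := (hasFDerivAt_flatFrame κ j x)
    have h3 := (hf.differentiable (by simp) x).hasFDerivAt.mul (h1.clm_apply h2)
    rw [HasFDerivAt.fderiv (f := fun x => f x * fderiv ℝ g x (flatFrame κ j x)) h3, h2.fderiv]
    simp
    ring
  have hs : fderiv ℝ (fderiv ℝ g) x (flatFrame κ i x) (flatFrame κ j x)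
      = fderiv ℝ (fderiv ℝ g) x (flatFrame κ j x) (flatFrame κ i x) := by
    have := (hg.contDiffAt (x := x)).isSymmSndFDerivAt (by simpa [one_add_one_eq_two] using one_add_one_le_infty)
    exact this _ _
  rw [hgd, hgd, nullForm, torsionVec_eq, hs]
  simp only [map_add, map_sub, map_smul, smul_eq_mul]
  ring

end TaubNUT

/-! ### Pointwise Lichnerowicz identities in real coordinates. -/

namespace TaubNUT

/-- The connection form `spinForm` in real coordinates. -/
noncomputable def realSpinForm (κ β : ℝ) (x : E4) (s : Fin 4 → ℝ) (i : Fin 4) : Fin 4 → ℝ :=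
  ![-((κ + β) * hopf x i) * s 3 - β * ![-x 2, x 3, x 0, -x 1] i * s 2
      + β * ![-x 3, -x 2, x 1, x 0] i * s 1,
    (κ + β) * hopf x i * s 2 - β * ![-x 2, x 3, x 0, -x 1] i * s 3
      - β * ![-x 3, -x 2, x 1, x 0] i * s 0,
    -((κ + β) * hopf x i) * s 1 + β * ![-x 2, x 3, x 0, -x 1] i * s 0
      - β * ![-x 3, -x 2, x 1, x 0] i * s 3,
    (κ + β) * hopf x i * s 0 + β * ![-x 2, x 3, x 0, -x 1] i * s 1
      + β * ![-x 3, -x 2, x 1, x 0] i * s 2]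

/-- The value at a point of `nullForm`, antisymmetrized, on 1-jets of functions. -/
noncomputable def altForm (κ : ℝ) (x : E4) (s : Fin 4 → ℝ) (D : Fin 4 → E4 →L[ℝ] ℝ)
    (i j A B : Fin 4) : ℝ :=
  (D A (flatFrame κ i x) * D B (flatFrame κ j x) - D A (flatFrame κ j x) * D B (flatFrame κ i x)
    + s A * D B (torsionVec κ i j x))
  - (D B (flatFrame κ i x) * D A (flatFrame κ j x) - D B (flatFrame κ j x) * D A (flatFrame κ i x)
    + s B * D A (torsionVec κ i j x))

theorem clm_flatFrame (D : E4 →L[ℝ] ℝ) (κ : ℝ) (i : Fin 4) (x : E4) :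
    D (flatFrame κ i x) = D (basisVec i) + κ * hopf x i * (-x 1 * D (basisVec 0)
      + x 0 * D (basisVec 1) - x 3 * D (basisVec 2) + x 2 * D (basisVec 3)) := by
  rw [flatFrame, map_add, map_smul, clm_hopf, smul_eq_mul]

theorem clm_torsionVec (D : E4 →L[ℝ] ℝ) (κ : ℝ) (i j : Fin 4) (x : E4) :
    D (torsionVec κ i j x) =
      κ * hopf x j * (∑ l, hopfMatrix l i * D (basisVec l))
        - κ * hopf x i * (∑ l, hopfMatrix l j * D (basisVec l))
        - 2 * κ * hopfMatrix i j * (-x 1 * D (basisVec 0)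
          + x 0 * D (basisVec 1) - x 3 * D (basisVec 2) + x 2 * D (basisVec 3))
        + κ * x j * D (basisVec i) - κ * x i * D (basisVec j) := by
  have h : ∀ i, D (hopf (basisVec i)) = ∑ l, hopfMatrix l i * D (basisVec l) := by
    intro i
    rw [clm_hopf]
    fin_cases i <;> simp [hopfMatrix, Fin.sum_univ_four]
  simp only [torsionVec, map_add, map_sub, map_smul, smul_eq_mul, clm_hopf D x, h]

theorem clm_self (D : E4 →L[ℝ] ℝ) (x : E4) :
    D x = x 0 * D (basisVec 0) + x 1 * D (basisVec 1) + x 2 * D (basisVec 2)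
      + x 3 * D (basisVec 3) := by
  have h : x = x 0 • basisVec 0 + x 1 • basisVec 1 + x 2 • basisVec 2 + x 3 • basisVec 3 := by
    ext l; fin_cases l <;> simp
  conv_lhs => rw [h]
  simp only [map_add, map_smul, smul_eq_mul]

/-- The left side is `|∑ c_i X_i|²` on chirality `-1`, with `X_i ∈ ℂ² = ℝ⁴`. Since `c_i c_j` is skew
for `i ≠ j`, each cross term is a combination of 2×2 minors in the spinor indices. The factor `2` is
absorbed later by the antisymmetrization in `altForm`. -/
theorem cross_terms_neg (X : Fin 4 → Fin 4 → ℝ) :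
    (X 0 0 - X 3 1 - X 1 3 + X 2 2) ^ 2 + (X 0 1 + X 3 0 + X 1 2 + X 2 3) ^ 2
      + (X 0 2 - X 1 1 - X 2 0 + X 3 3) ^ 2 + (X 0 3 + X 1 0 - X 2 1 - X 3 2) ^ 2
    = ∑ i, ∑ A, X i A ^ 2
      + 2 * (-(X 0 0 * X 1 3 - X 0 3 * X 1 0) + (X 0 1 * X 1 2 - X 0 2 * X 1 1)
        + (X 0 0 * X 2 2 - X 0 2 * X 2 0) + (X 0 1 * X 2 3 - X 0 3 * X 2 1)
        - (X 0 0 * X 3 1 - X 0 1 * X 3 0) + (X 0 2 * X 3 3 - X 0 3 * X 3 2)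
        + (X 1 2 * X 2 3 - X 1 3 * X 2 2) - (X 1 0 * X 2 1 - X 1 1 * X 2 0)
        - (X 1 1 * X 3 3 - X 1 3 * X 3 1) - (X 1 0 * X 3 2 - X 1 2 * X 3 0)
        + (X 2 1 * X 3 2 - X 2 2 * X 3 1) - (X 2 0 * X 3 3 - X 2 3 * X 3 0)) := by
  simp only [Fin.sum_univ_four]
  ring

theorem cross_terms_pos (X : Fin 4 → Fin 4 → ℝ) :
    (-X 0 0 - X 3 1 - X 1 3 + X 2 2) ^ 2 + (-X 0 1 + X 3 0 + X 1 2 + X 2 3) ^ 2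
      + (-X 0 2 - X 1 1 - X 2 0 + X 3 3) ^ 2 + (-X 0 3 + X 1 0 - X 2 1 - X 3 2) ^ 2
    = ∑ i, ∑ A, X i A ^ 2
      + 2 * ((X 0 0 * X 1 3 - X 0 3 * X 1 0) - (X 0 1 * X 1 2 - X 0 2 * X 1 1)
        - (X 0 0 * X 2 2 - X 0 2 * X 2 0) - (X 0 1 * X 2 3 - X 0 3 * X 2 1)
        + (X 0 0 * X 3 1 - X 0 1 * X 3 0) - (X 0 2 * X 3 3 - X 0 3 * X 3 2)
        + (X 1 2 * X 2 3 - X 1 3 * X 2 2) - (X 1 0 * X 2 1 - X 1 1 * X 2 0)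
        - (X 1 1 * X 3 3 - X 1 3 * X 3 1) - (X 1 0 * X 3 2 - X 1 2 * X 3 0)
        + (X 2 1 * X 3 2 - X 2 2 * X 3 1) - (X 2 0 * X 3 3 - X 2 3 * X 3 0)) := by
  simp only [Fin.sum_univ_four]
  ring

-- On chirality `+1` there is no connection term. The combination of minors is such that the torsion
-- contributions cancel among the twelve null Lagrangians.
set_option maxHeartbeats 4000000 in
theorem lichnerowicz_pointwise_pos (κ : ℝ) (x : E4) (s : Fin 4 → ℝ)
    (D : Fin 4 → E4 →L[ℝ] ℝ) (X : Fin 4 → Fin 4 → ℝ)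
    (hX : ∀ i A, X i A = D A (flatFrame κ i x)) :
    (-X 0 0 - X 3 1 - X 1 3 + X 2 2) ^ 2 + (-X 0 1 + X 3 0 + X 1 2 + X 2 3) ^ 2
      + (-X 0 2 - X 1 1 - X 2 0 + X 3 3) ^ 2 + (-X 0 3 + X 1 0 - X 2 1 - X 3 2) ^ 2
    = ∑ i, ∑ A, X i A ^ 2
      + (altForm κ x s D 0 1 0 3 - altForm κ x s D 0 1 1 2
        - altForm κ x s D 0 2 0 2 - altForm κ x s D 0 2 1 3
        + altForm κ x s D 0 3 0 1 - altForm κ x s D 0 3 2 3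
        + altForm κ x s D 1 2 2 3 - altForm κ x s D 1 2 0 1
        - altForm κ x s D 1 3 1 3 - altForm κ x s D 1 3 0 2
        + altForm κ x s D 2 3 1 2 - altForm κ x s D 2 3 0 3) := by
  rw [cross_terms_pos]
  congr 1
  simp only [altForm, hX, clm_torsionVec, Fin.sum_univ_four]
  simp only [hopfMatrix, hopf, Matrix.of_apply, Matrix.cons_val', Matrix.cons_val_zero,
    Matrix.cons_val_one, Matrix.cons_val, Matrix.cons_val_fin_one]
  ring

-- The connection terms and the torsion terms no longer cancel, but what remains is, up to sign, the
-- divergence of `(κ - β) s_A² x` summed over `A`; note that `2β²‖x‖²` is the radial derivative of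
-- `κ - β`. The absence of any other zeroth-order term is the vanishing of the scalar curvature.
set_option maxRecDepth 10000 in
set_option maxHeartbeats 4000000 in
theorem lichnerowicz_pointwise_neg {κ β : ℝ} {x : E4} (s : Fin 4 → ℝ)
    (D : Fin 4 → E4 →L[ℝ] ℝ) (X : Fin 4 → Fin 4 → ℝ)
    (hX : ∀ i A, X i A = D A (flatFrame κ i x) + realSpinForm κ β x s i A)
    (hβ : β * (1 + κ * (x 0 ^ 2 + x 1 ^ 2 + x 2 ^ 2 + x 3 ^ 2)) = κ) :
    (X 0 0 - X 3 1 - X 1 3 + X 2 2) ^ 2 + (X 0 1 + X 3 0 + X 1 2 + X 2 3) ^ 2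
      + (X 0 2 - X 1 1 - X 2 0 + X 3 3) ^ 2 + (X 0 3 + X 1 0 - X 2 1 - X 3 2) ^ 2
    = ∑ i, ∑ A, X i A ^ 2
      + (-altForm κ x s D 0 1 0 3 + altForm κ x s D 0 1 1 2
        + altForm κ x s D 0 2 0 2 + altForm κ x s D 0 2 1 3
        - altForm κ x s D 0 3 0 1 + altForm κ x s D 0 3 2 3
        + altForm κ x s D 1 2 2 3 - altForm κ x s D 1 2 0 1
        - altForm κ x s D 1 3 1 3 - altForm κ x s D 1 3 0 2
        + altForm κ x s D 2 3 1 2 - altForm κ x s D 2 3 0 3)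
      - ∑ A, (2 * (κ - β) * s A * D A x
        + (4 * (κ - β) + 2 * β ^ 2 * (x 0 ^ 2 + x 1 ^ 2 + x 2 ^ 2 + x 3 ^ 2)) * s A ^ 2) := by
  rw [cross_terms_neg]
  refine (congrArg (_ + ·) ?_).trans (add_sub_assoc _ _ _).symm
  simp only [altForm, hX, clm_torsionVec, clm_self _ x, clm_flatFrame, Fin.sum_univ_four]
  simp only [hopfMatrix, hopf, realSpinForm, Matrix.of_apply, Matrix.cons_val', Matrix.cons_val_zero,
    Matrix.cons_val_one, Matrix.cons_val, Matrix.cons_val_fin_one]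
  generalize D 0 (basisVec 0) = P00
  generalize D 0 (basisVec 1) = P01
  generalize D 0 (basisVec 2) = P02
  generalize D 0 (basisVec 3) = P03
  generalize D 1 (basisVec 0) = P10
  generalize D 1 (basisVec 1) = P11
  generalize D 1 (basisVec 2) = P12
  generalize D 1 (basisVec 3) = P13
  generalize D 2 (basisVec 0) = P20
  generalize D 2 (basisVec 1) = P21
  generalize D 2 (basisVec 2) = P22
  generalize D 2 (basisVec 3) = P23
  generalize D 3 (basisVec 0) = P30
  generalize D 3 (basisVec 1) = P31
  generalize D 3 (basisVec 2) = P32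
  generalize D 3 (basisVec 3) = P33
  -- The relation between `β` and `κ` is needed only for derivatives along the Hopf field paired
  -- with `s`, and for the coefficient of `|s|²`; all other terms agree as polynomials.
  linear_combination (4 * ((-x 1 * P00 + x 0 * P01 - x 3 * P02 + x 2 * P03) * s 3
    - (-x 1 * P10 + x 0 * P11 - x 3 * P12 + x 2 * P13) * s 2
    + (-x 1 * P20 + x 0 * P21 - x 3 * P22 + x 2 * P23) * s 1
    - (-x 1 * P30 + x 0 * P31 - x 3 * P32 + x 2 * P33) * s 0)
    - 4 * (s 0 ^ 2 + s 1 ^ 2 + s 2 ^ 2 + s 3 ^ 2)) * hβ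

end TaubNUT

/-! ### Integrated Lichnerowicz formula and Hardy inequality, modulo functions of integral zero. -/

namespace TaubNUT

/-- Integrable functions with vanishing integral. -/
def IntegralZero (f : E4 → ℝ) : Prop := Integrable f ∧ ∫ x, f x = 0

theorem IntegralZero.add {f g : E4 → ℝ} (hf : IntegralZero f) (hg : IntegralZero g) :
    IntegralZero (fun x => f x + g x) :=
  ⟨hf.1.add hg.1, by rw [integral_add hf.1 hg.1, hf.2, hg.2, add_zero]⟩

theorem IntegralZero.sub {f g : E4 → ℝ} (hf : IntegralZero f) (hg : IntegralZero g) :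
    IntegralZero (fun x => f x - g x) :=
  ⟨hf.1.sub hg.1, by rw [integral_sub hf.1 hg.1, hf.2, hg.2, sub_zero]⟩

theorem IntegralZero.neg {f : E4 → ℝ} (hf : IntegralZero f) :
    IntegralZero (fun x => -f x) :=
  ⟨hf.1.neg, by rw [integral_neg, hf.2, neg_zero]⟩

theorem IntegralZero.sum {f : Fin 4 → E4 → ℝ} (hf : ∀ i, IntegralZero (f i)) :
    IntegralZero (fun x => ∑ i, f i x) :=
  ⟨integrable_finsetSum _ fun i _ => (hf i).1, by
    rw [integral_finsetSum _ fun i _ => (hf i).1]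
    exact Finset.sum_eq_zero fun i _ => (hf i).2⟩

theorem contDiff_torsionVec (κ : ℝ) (i j : Fin 4) : ContDiff ℝ ∞ (torsionVec κ i j) := by
  have h := contDiff_hopf_apply
  have h' := hopf_smooth
  have hc : ∀ i, ContDiff ℝ ∞ fun x : E4 => x i := fun i => contDiff_euclidean.1 contDiff_id i
  unfold torsionVec
  have h1 : ContDiff ℝ ∞ fun x => (κ * hopf x j) • hopf (basisVec i) :=
    (contDiff_const.mul (h j)).smul contDiff_const
  have h2 : ContDiff ℝ ∞ fun x => (κ * hopf x i) • hopf (basisVec j) :=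
    (contDiff_const.mul (h i)).smul contDiff_const
  have h3 : ContDiff ℝ ∞ fun x => (2 * κ * hopfMatrix i j) • hopf x := ContDiff.smul (f := fun _ : E4 => 2 * κ * hopfMatrix i j) contDiff_const h'
  have h4 : ContDiff ℝ ∞ fun x : E4 => (κ * x j) • basisVec i :=
    (contDiff_const.mul (hc j)).smul contDiff_const
  have h5 : ContDiff ℝ ∞ fun x : E4 => (κ * x i) • basisVec j :=
    (contDiff_const.mul (hc i)).smul contDiff_const
  exact (((h1.sub h2).sub h3).add h4).sub h5

theorem integralZero_nullForm (κ : ℝ) (i j : Fin 4) {f g : E4 → ℝ} (hf : ContDiff ℝ ∞ f)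
    (hg : ContDiff ℝ ∞ g) (hc : HasCompactSupport f) :
    IntegralZero (nullForm κ i j f g) := by
  refine ⟨Continuous.integrable_of_hasCompactSupport ?_ ?_, integral_nullForm κ i j hf hg hc⟩
  · have h1 : ∀ j, Continuous fun x => fderiv ℝ f x (flatFrame κ j x) := fun j =>
      (hf.continuous_fderiv (by simp)).clm_apply (contDiff_flatFrame κ j).continuous
    have h2 : ∀ j, Continuous fun x => fderiv ℝ g x (flatFrame κ j x) := fun j =>
      (hg.continuous_fderiv (by simp)).clm_apply (contDiff_flatFrame κ j).continuous
    have h3 : Continuous fun x => fderiv ℝ g x (torsionVec κ i j x) :=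
      (hg.continuous_fderiv (by simp)).clm_apply (contDiff_torsionVec κ i j).continuous
    have h4 := hf.continuous
    unfold nullForm
    fun_prop
  · refine HasCompactSupport.of_support_subset_isCompact hc.isCompact fun x hx => ?_
    by_contra hxs
    apply hx
    have h0 : f x = 0 := image_eq_zero_of_notMem_tsupport hxs
    have h1 : fderiv ℝ f x = 0 := by
      by_contra hne
      exact hxs (support_fderiv_subset ℝ hne)
    simp [nullForm, h0, h1]

theorem integralZero_altForm (κ : ℝ) {α : Fin 4 → E4 → ℝ} (hα : ∀ A, ContDiff ℝ ∞ (α A))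
    (hc : ∀ A, HasCompactSupport (α A)) (i j A B : Fin 4) :
    IntegralZero fun x => altForm κ x (fun A => α A x) (fun A => fderiv ℝ (α A) x) i j A B :=
  (integralZero_nullForm κ i j (hα A) (hα B) (hc A)).sub
    (integralZero_nullForm κ i j (hα B) (hα A) (hc B))

/-- The integrand is the divergence of `w f² x`; the coefficient `4` is the divergence of `x` in
dimension four. -/
theorem integralZero_radial {w f : E4 → ℝ} (hw : ContDiff ℝ ∞ w) (hf : ContDiff ℝ ∞ f)
    (hc : HasCompactSupport f) :
    IntegralZero fun x => 2 * w x * f x * fderiv ℝ f x x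
      + (4 * w x + fderiv ℝ w x x) * f x ^ 2 := by
  have hx : ∀ i, ContDiff ℝ ∞ fun x : E4 => x i := fun i => contDiff_euclidean.1 contDiff_id i
  refine ⟨Continuous.integrable_of_hasCompactSupport ?_ ?_, ?_⟩
  · have h1 : Continuous fun x => fderiv ℝ f x x :=
      (hf.continuous_fderiv (by simp)).clm_apply continuous_id
    have h2 : Continuous fun x => fderiv ℝ w x x :=
      (hw.continuous_fderiv (by simp)).clm_apply continuous_id
    have h3 := hf.continuous
    have h4 := hw.continuous
    fun_prop
  · refine hc.mono fun x hx => ?_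
    contrapose! hx
    simp only [Function.mem_support, ne_eq, not_not] at hx ⊢
    simp [hx]
  · rw [← integral_divergence (F := fun l x => w x * x l * (f x * f x))
      (fun l => ((hw.mul (hx l)).mul (hf.mul hf)).of_le (by simp))
      (fun l => (hc.mul_right (f' := f)).mul_left)]
    congr 1
    ext x
    have hd : ∀ l, fderiv ℝ (fun x => w x * x l * (f x * f x)) x (basisVec l) =
        w x * x l * (2 * f x * fderiv ℝ f x (basisVec l))
          + f x ^ 2 * (w x + x l * fderiv ℝ w x (basisVec l)) := by
      intro l
      have h0 := (hw.differentiable (by simp) x).hasFDerivAt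
      have h1 := (hf.differentiable (by simp) x).hasFDerivAt
      have h2 : HasFDerivAt (fun x : E4 => x l) _ x :=
        (EuclideanSpace.proj l : E4 →L[ℝ] ℝ).hasFDerivAt
      rw [HasFDerivAt.fderiv (f := fun x => w x * x l * (f x * f x)) ((h0.mul h2).mul (h1.mul h1))]
      simp
      ring
    simp only [hd, clm_self _ x, Fin.sum_univ_four]
    ring

theorem hasFDerivAt_norm_sq' (x : E4) :
    HasFDerivAt (fun y : E4 => ‖y‖ ^ 2) (2 • innerSL ℝ x) x :=
  (hasStrictFDerivAt_norm_sq x).hasFDerivAt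

theorem lichnerowicz_pos (κ : ℝ) {α : Fin 4 → E4 → ℝ}
    (hα : ∀ A, ContDiff ℝ ∞ (α A)) (hc : ∀ A, HasCompactSupport (α A))
    {X : Fin 4 → Fin 4 → E4 → ℝ}
    (hX : ∀ i A x, X i A x = fderiv ℝ (α A) x (flatFrame κ i x)) :
    ∃ Z, IntegralZero Z ∧ ∀ x,
      (-X 0 0 x - X 3 1 x - X 1 3 x + X 2 2 x) ^ 2 + (-X 0 1 x + X 3 0 x + X 1 2 x + X 2 3 x) ^ 2
        + (-X 0 2 x - X 1 1 x - X 2 0 x + X 3 3 x) ^ 2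
        + (-X 0 3 x + X 1 0 x - X 2 1 x - X 3 2 x) ^ 2
      = ∑ i, ∑ A, X i A x ^ 2 + Z x := by
  have h := integralZero_altForm κ hα hc
  -- The witness `Z` is read off by unification from the pointwise identity.
  refine ⟨_, ?_, fun x => lichnerowicz_pointwise_pos κ x (fun A => α A x)
    (fun A => fderiv ℝ (α A) x) (fun i A => X i A x) fun i A => hX i A x⟩
  exact ((((((((((((h _ _ _ _).sub (h _ _ _ _)).sub (h _ _ _ _)).sub (h _ _ _ _)).add
    (h _ _ _ _)).sub (h _ _ _ _)).add (h _ _ _ _)).sub (h _ _ _ _)).sub (h _ _ _ _)).sub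
    (h _ _ _ _)).add (h _ _ _ _)).sub (h _ _ _ _))

/-- Besides the null Lagrangians, the remainder contains the radial divergence with weight `w = κ -
β`, whose radial derivative is computed in `hdw`. -/
theorem lichnerowicz_neg {a b : ℝ} (ha : 0 < a) (hb : 0 < b) {α : Fin 4 → E4 → ℝ}
    (hα : ∀ A, ContDiff ℝ ∞ (α A)) (hc : ∀ A, HasCompactSupport (α A))
    {X : Fin 4 → Fin 4 → E4 → ℝ}
    (hX : ∀ i A x, X i A x = fderiv ℝ (α A) x (flatFrame (b / a) i x)
      + realSpinForm (b / a) (b / (a + b * ‖x‖ ^ 2)) x (fun A => α A x) i A) :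
    ∃ Z, IntegralZero Z ∧ ∀ x,
      (X 0 0 x - X 3 1 x - X 1 3 x + X 2 2 x) ^ 2 + (X 0 1 x + X 3 0 x + X 1 2 x + X 2 3 x) ^ 2
        + (X 0 2 x - X 1 1 x - X 2 0 x + X 3 3 x) ^ 2
        + (X 0 3 x + X 1 0 x - X 2 1 x - X 3 2 x) ^ 2
      = ∑ i, ∑ A, X i A x ^ 2 + Z x := by
  have h := integralZero_altForm (b / a) hα hc
  have hw : ContDiff ℝ ∞ fun x : E4 => b / a - b / (a + b * ‖x‖ ^ 2) :=
    contDiff_const.sub (contDiff_const.div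
      (contDiff_const.add (contDiff_const.mul (contDiff_norm_sq ℝ)))
      fun x => (conformal_pos ha hb x).ne')
  have hr := IntegralZero.sum fun A => integralZero_radial hw (hα A) (hc A)
  have hdw : ∀ x : E4, fderiv ℝ (fun x : E4 => b / a - b / (a + b * ‖x‖ ^ 2)) x x =
      2 * (b / (a + b * ‖x‖ ^ 2)) ^ 2 * ‖x‖ ^ 2 := by
    intro x
    have hm := (conformal_pos ha hb x).ne'
    have h1 : HasDerivAt (fun r : ℝ => b / a - b * (a + b * r)⁻¹)
        (-(b * (-b / (a + b * ‖x‖ ^ 2) ^ 2))) (‖x‖ ^ 2) := by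
      have h3 : HasDerivAt (fun r : ℝ => a + b * r) b (‖x‖ ^ 2) := by
        simpa using ((hasDerivAt_id (‖x‖ ^ 2)).const_mul b).const_add a
      exact ((h3.inv hm).const_mul b).const_sub _
    have h2 := h1.comp_hasFDerivAt x (hasFDerivAt_norm_sq' x)
    simp only [div_eq_mul_inv b (a + _)]
    rw [HasFDerivAt.fderiv (f := fun x : E4 => b / a - b * (a + b * ‖x‖ ^ 2)⁻¹) h2]
    simp
    field_simp
  refine ⟨_, ?_, fun x => (lichnerowicz_pointwise_neg (fun A => α A x)
    (fun A => fderiv ℝ (α A) x) (fun i A => X i A x) (fun i A => hX i A x) ?_).trans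
      (add_sub_assoc _ _ _)⟩
  · simp only [hdw] at hr
    simp only [← norm_sq_eq]
    exact (((((((((((((h _ _ _ _).neg.add (h _ _ _ _)).add (h _ _ _ _)).add (h _ _ _ _)).sub
      (h _ _ _ _)).add (h _ _ _ _)).add (h _ _ _ _)).sub (h _ _ _ _)).sub (h _ _ _ _)).sub
      (h _ _ _ _)).add (h _ _ _ _)).sub (h _ _ _ _))).sub hr
  · have hm := (conformal_pos ha hb x).ne'
    rw [← norm_sq_eq]
    field_simp

/-- Hardy's inequality by the vector field method: add the divergence of `α² x / (1 + ‖x‖²)` and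
complete the square. Only the radial derivative enters, and Cauchy–Schwarz bounds it by the full
energy. The regularized weight `1/(1+‖x‖²)` keeps the field smooth at the origin. -/
theorem hardy {α : Fin 4 → E4 → ℝ}
    (hα : ∀ A, ContDiff ℝ ∞ (α A)) (hc : ∀ A, HasCompactSupport (α A))
    {X : Fin 4 → Fin 4 → E4 → ℝ}
    (hX : ∀ A x, fderiv ℝ (α A) x x = ∑ i, x i * X i A x) :
    ∃ Z, IntegralZero Z ∧ ∀ x,
      (∑ A, α A x ^ 2) / (1 + ‖x‖ ^ 2) ≤ ∑ i, ∑ A, X i A x ^ 2 + Z x := by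
  have hw : ContDiff ℝ ∞ fun x : E4 => (1 + ‖x‖ ^ 2)⁻¹ :=
    ContDiff.inv (contDiff_const.add (contDiff_norm_sq ℝ)) fun x => by positivity
  have hdw : ∀ x : E4, fderiv ℝ (fun x : E4 => (1 + ‖x‖ ^ 2)⁻¹) x x =
      -2 * ‖x‖ ^ 2 / (1 + ‖x‖ ^ 2) ^ 2 := by
    intro x
    have hm : (1 + ‖x‖ ^ 2) ≠ 0 := by positivity
    have h1 : HasDerivAt (fun r : ℝ => (1 + r)⁻¹) (-1 / (1 + ‖x‖ ^ 2) ^ 2) (‖x‖ ^ 2) :=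
      ((hasDerivAt_id (‖x‖ ^ 2)).const_add 1).inv hm
    have h2 := h1.comp_hasFDerivAt x (hasFDerivAt_norm_sq' x)
    rw [HasFDerivAt.fderiv (f := fun x : E4 => (1 + ‖x‖ ^ 2)⁻¹) h2]
    simp
    ring
  have hr := IntegralZero.sum fun A => integralZero_radial hw (hα A) (hc A)
  refine ⟨_, hr, fun x => ?_⟩
  rw [Finset.sum_comm, ← Finset.sum_add_distrib, Finset.sum_div]
  refine Finset.sum_le_sum fun A _ => ?_
  rw [hdw]
  have hcs : fderiv ℝ (α A) x x ^ 2 ≤ ‖x‖ ^ 2 * ∑ i, X i A x ^ 2 := by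
    rw [hX, EuclideanSpace.real_norm_sq_eq]
    exact Finset.sum_mul_sq_le_sq_mul_sq _ _ _
  have hS : 0 ≤ ∑ i, X i A x ^ 2 := Finset.sum_nonneg fun i _ => sq_nonneg _
  generalize ∑ i, X i A x ^ 2 = S at hcs hS
  generalize fderiv ℝ (α A) x x = d at hcs
  generalize α A x = s
  have hρ : 0 ≤ ‖x‖ ^ 2 := by positivity
  generalize ‖x‖ ^ 2 = ρ at hcs hρ
  have h1 : 0 < 1 + ρ := by linarith
  -- From `d² ≤ ρS` one gets `S(1+ρ)² ≥ d²(1+ρ)`. Then `d² + 2sd ≥ -s²` leaves `(3+ρ)s²`, which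
  -- exceeds `(1+ρ)s²`.
  have key : s ^ 2 * (1 + ρ) ≤ S * (1 + ρ) ^ 2 + 2 * s * d * (1 + ρ)
      + (4 * (1 + ρ) - 2 * ρ) * s ^ 2 := by
    nlinarith [sq_nonneg (s + d), mul_nonneg hS h1.le, sq_nonneg s]
  have e : S + (2 * (1 + ρ)⁻¹ * s * d + (4 * (1 + ρ)⁻¹ + -2 * ρ / (1 + ρ) ^ 2) * s ^ 2)
      - s ^ 2 / (1 + ρ) = (S * (1 + ρ) ^ 2 + 2 * s * d * (1 + ρ)
      + (4 * (1 + ρ) - 2 * ρ) * s ^ 2 - s ^ 2 * (1 + ρ)) / (1 + ρ) ^ 2 := by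
    field_simp
    ring
  have : 0 ≤ (S * (1 + ρ) ^ 2 + 2 * s * d * (1 + ρ)
      + (4 * (1 + ρ) - 2 * ρ) * s ^ 2 - s ^ 2 * (1 + ρ)) / (1 + ρ) ^ 2 :=
    div_nonneg (by linarith) (by positivity)
  linarith

end TaubNUT

/-! ### The Hardy inequality for the Dirac operator on complex spinors. -/

namespace TaubNUT

/-- The real and imaginary parts of the `p`-th and `q`-th components of a spinor. -/
noncomputable def realCoord (p q : Fin 4) : Fin 4 → Spinor →L[ℝ] ℝ :=
  ![Complex.reCLM ∘L (EuclideanSpace.proj p : Spinor →L[ℂ] ℂ).restrictScalars ℝ,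
    Complex.imCLM ∘L (EuclideanSpace.proj p : Spinor →L[ℂ] ℂ).restrictScalars ℝ,
    Complex.reCLM ∘L (EuclideanSpace.proj q : Spinor →L[ℂ] ℂ).restrictScalars ℝ,
    Complex.imCLM ∘L (EuclideanSpace.proj q : Spinor →L[ℂ] ℂ).restrictScalars ℝ]

theorem realCoord_zero (p q : Fin 4) (ψ : Spinor) : realCoord p q 0 ψ = (ψ p).re := rfl
theorem realCoord_one (p q : Fin 4) (ψ : Spinor) : realCoord p q 1 ψ = (ψ p).im := rfl
theorem realCoord_two (p q : Fin 4) (ψ : Spinor) : realCoord p q 2 ψ = (ψ q).re := rfl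
theorem realCoord_three (p q : Fin 4) (ψ : Spinor) : realCoord p q 3 ψ = (ψ q).im := rfl

theorem norm_sq_spinor (ψ : Spinor) :
    ‖ψ‖ ^ 2 = ∑ A, realCoord 0 1 A ψ ^ 2 + ∑ A, realCoord 2 3 A ψ ^ 2 := by
  rw [EuclideanSpace.norm_sq_eq]
  simp only [Fin.sum_univ_four, ← Complex.normSq_eq_norm_sq, Complex.normSq_apply,
    realCoord_zero, realCoord_one, realCoord_two, realCoord_three]
  ring

/-- Clifford multiplication exchanges the chiralities, so the two halves land in orthogonal
subspaces and the Lichnerowicz formula can be applied to each half separately. -/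
theorem norm_sq_sum_cliff (Y : Fin 4 → Spinor) (U L : Fin 4 → Fin 4 → ℝ)
    (hU : ∀ i A, U i A = realCoord 0 1 A (Y i)) (hL : ∀ i A, L i A = realCoord 2 3 A (Y i)) :
    ‖∑ i, cliff i (Y i)‖ ^ 2 =
      ((U 0 0 - U 3 1 - U 1 3 + U 2 2) ^ 2 + (U 0 1 + U 3 0 + U 1 2 + U 2 3) ^ 2
        + (U 0 2 - U 1 1 - U 2 0 + U 3 3) ^ 2 + (U 0 3 + U 1 0 - U 2 1 - U 3 2) ^ 2)
      + ((-L 0 0 - L 3 1 - L 1 3 + L 2 2) ^ 2 + (-L 0 1 + L 3 0 + L 1 2 + L 2 3) ^ 2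
        + (-L 0 2 - L 1 1 - L 2 0 + L 3 3) ^ 2 + (-L 0 3 + L 1 0 - L 2 1 - L 3 2) ^ 2) := by
  rw [norm_sq_spinor]
  simp only [Fin.sum_univ_four, cliff_zero, cliff_one, cliff_two, cliff_three, hU, hL,
    realCoord_zero, realCoord_one, realCoord_two, realCoord_three]
  simp
  ring

theorem realCoord_spinForm_upper (κ β : ℝ) (x : E4) (i : Fin 4) (ψ : Spinor) (A : Fin 4) :
    realCoord 0 1 A (spinForm κ β x i ψ) =
      realSpinForm κ β x (fun A => realCoord 0 1 A ψ) i A := by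
  fin_cases A <;>
    simp [realCoord, spinForm, realSpinForm] <;> ring

theorem realCoord_spinForm_lower (κ β : ℝ) (x : E4) (i : Fin 4) (ψ : Spinor) (A : Fin 4) :
    realCoord 2 3 A (spinForm κ β x i ψ) = 0 := by
  fin_cases A <;> simp [realCoord, spinForm]

/-- The Hopf field is orthogonal to `x`, so the rank-one correction of the frame drops out and the
frame reproduces the radial field. -/
theorem sum_smul_flatFrame (κ : ℝ) (x : E4) : ∑ i, x i • flatFrame κ i x = x := by
  ext l
  fin_cases l <;> simp [Fin.sum_univ_four, flatFrame, hopf] <;> ring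

/-- The connection is in radial gauge: all three rotation fields in it are orthogonal to `x`. Radial
covariant and ordinary derivatives therefore agree, as needed to apply `hardy` with the covariant
`X`. -/
theorem sum_realSpinForm (κ β : ℝ) (x : E4) (s : Fin 4 → ℝ) (A : Fin 4) :
    ∑ i, x i * realSpinForm κ β x s i A = 0 := by
  fin_cases A <;> simp [Fin.sum_univ_four, realSpinForm, hopf] <;> ring

theorem hardy_dirac_pointwise {a b : ℝ} (ha : 0 < a) (hb : 0 < b) {φ : E4 → Spinor}
    (hφ : ContDiff ℝ ∞ φ) (hc : HasCompactSupport φ) :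
    ∃ Z, IntegralZero Z ∧ ∀ x, ‖φ x‖ ^ 2 / (1 + ‖x‖ ^ 2) ≤
      ‖flatDirac (b / a) (b / (a + b * ‖x‖ ^ 2)) φ x‖ ^ 2 + Z x := by
  have hα : ∀ p q A, ContDiff ℝ ∞ fun x => realCoord p q A (φ x) := fun p q A =>
    (realCoord p q A).contDiff.comp hφ
  have hcα : ∀ p q A, HasCompactSupport fun x => realCoord p q A (φ x) := fun p q A =>
    hc.comp_left (g := realCoord p q A) (map_zero _)
  have hd : ∀ p q A x v, fderiv ℝ (fun x => realCoord p q A (φ x)) x v =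
      realCoord p q A (fderiv ℝ φ x v) := by
    intro p q A x v
    rw [HasFDerivAt.fderiv (f := fun x => realCoord p q A (φ x))
      ((realCoord p q A).hasFDerivAt.comp x (hφ.differentiable (by simp) x).hasFDerivAt)]
    rfl
  have hd0 : ∀ p q A (x : E4), fderiv ℝ (fun x => realCoord p q A (φ x)) x x = ∑ i, x i *
      fderiv ℝ (fun x => realCoord p q A (φ x)) x (flatFrame (b / a) i x) := by
    intro p q A x
    have h := congrArg (fderiv ℝ (fun x => realCoord p q A (φ x)) x)
      (sum_smul_flatFrame (b / a) x)
    rw [← h]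
    simp only [map_sum, map_smul, smul_eq_mul]
  set Y : Fin 4 → E4 → Spinor := fun i x => fderiv ℝ φ x (flatFrame (b / a) i x)
    + spinForm (b / a) (b / (a + b * ‖x‖ ^ 2)) x i (φ x) with hY
  obtain ⟨Z₁, hZ₁, e₁⟩ := lichnerowicz_neg ha hb (hα 0 1) (hcα 0 1)
    (X := fun i A x => realCoord 0 1 A (Y i x))
    (fun i A x => by rw [hd, ← realCoord_spinForm_upper, ← map_add])
  obtain ⟨Z₂, hZ₂, e₂⟩ := lichnerowicz_pos (b / a) (hα 2 3) (hcα 2 3)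
    (X := fun i A x => realCoord 2 3 A (Y i x))
    (fun i A x => by rw [hd, hY, map_add, realCoord_spinForm_lower, add_zero])
  obtain ⟨Z₃, hZ₃, e₃⟩ := hardy (hα 0 1) (hcα 0 1)
    (X := fun i A x => realCoord 0 1 A (Y i x)) (fun A x => by
      simp only [hY, map_add, realCoord_spinForm_upper, mul_add, Finset.sum_add_distrib,
        sum_realSpinForm, add_zero, ← hd, ← hd0])
  obtain ⟨Z₄, hZ₄, e₄⟩ := hardy (hα 2 3) (hcα 2 3)
    (X := fun i A x => realCoord 2 3 A (Y i x)) (fun A x => by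
      simp only [hY, map_add, realCoord_spinForm_lower, add_zero, ← hd, ← hd0])
  refine ⟨_, ((hZ₃.add hZ₄).sub (hZ₁.add hZ₂)), fun x => ?_⟩
  have e : flatDirac (b / a) (b / (a + b * ‖x‖ ^ 2)) φ x = ∑ i, cliff i (Y i x) := by
    simp only [hY, flatDirac, map_add, Finset.sum_add_distrib, sum_cliff_spinForm]
  rw [e, norm_sq_sum_cliff _ _ _ (fun _ _ => rfl) (fun _ _ => rfl), e₁ x, e₂ x, norm_sq_spinor,
    add_div]
  linarith [e₃ x, e₄ x]

theorem continuous_flatDirac {a b : ℝ} (ha : 0 < a) (hb : 0 < b) {φ : E4 → Spinor}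
    (hφ : ContDiff ℝ ∞ φ) :
    Continuous fun x => flatDirac (b / a) (b / (a + b * ‖x‖ ^ 2)) φ x := by
  have h1 : ∀ i, Continuous fun x => fderiv ℝ φ x (flatFrame (b / a) i x) := fun i =>
    (hφ.continuous_fderiv (by simp)).clm_apply (contDiff_flatFrame _ i).continuous
  have h2 : Continuous fun x : E4 => b / (a + b * ‖x‖ ^ 2) :=
    continuous_const.div (by fun_prop) fun x => (conformal_pos ha hb x).ne'
  have h3 : Continuous fun x => negPart (φ x) := by
    have h4 := hφ.continuous
    have h5 : Continuous negPart := by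
      refine (PiLp.continuous_toLp 2 _).comp (continuous_pi fun i => ?_)
      fin_cases i <;> simp <;> fun_prop
    exact h5.comp h4
  unfold flatDirac
  fun_prop

theorem flatDirac_eq_zero (κ β : ℝ) {φ : E4 → Spinor} {x : E4} (hx : x ∉ tsupport φ) :
    flatDirac κ β φ x = 0 := by
  have h0 : φ x = 0 := image_eq_zero_of_notMem_tsupport hx
  have h1 : fderiv ℝ φ x = 0 := by
    by_contra hne
    exact hx (support_fderiv_subset ℝ hne)
  have h2 : negPart 0 = 0 := by
    ext i; fin_cases i <;> simp [negPart]
  simp [flatDirac, h0, h1, h2]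

theorem hardy_dirac {a b : ℝ} (ha : 0 < a) (hb : 0 < b) {φ : E4 → Spinor}
    (hφ : ContDiff ℝ ∞ φ) (hc : HasCompactSupport φ) :
    ∫⁻ x, ENNReal.ofReal (‖φ x‖ ^ 2 / (1 + ‖x‖ ^ 2)) ≤
      ∫⁻ x, ENNReal.ofReal (‖flatDirac (b / a) (b / (a + b * ‖x‖ ^ 2)) φ x‖ ^ 2) := by
  obtain ⟨Z, hZ, h⟩ := hardy_dirac_pointwise ha hb hφ hc
  have h1 : Integrable fun x => ‖φ x‖ ^ 2 / (1 + ‖x‖ ^ 2) := by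
    refine Continuous.integrable_of_hasCompactSupport ?_ ?_
    · exact (hφ.continuous.norm.pow 2).div (by fun_prop) fun x => by positivity
    · refine hc.mono fun x hx => ?_
      contrapose! hx
      simp only [Function.mem_support, ne_eq, not_not] at hx ⊢
      simp [hx]
  have h2 : Integrable fun x => ‖flatDirac (b / a) (b / (a + b * ‖x‖ ^ 2)) φ x‖ ^ 2 := by
    refine Continuous.integrable_of_hasCompactSupport ((continuous_flatDirac ha hb hφ).norm.pow 2)
      (HasCompactSupport.of_support_subset_isCompact hc.isCompact fun x hx => ?_)
    by_contra hxs
    exact hx (by simp [flatDirac_eq_zero _ _ hxs])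
  rw [← ofReal_integral_eq_lintegral_ofReal h1 (ae_of_all _ fun x => by positivity),
    ← ofReal_integral_eq_lintegral_ofReal h2 (ae_of_all _ fun x => by positivity)]
  refine ENNReal.ofReal_le_ofReal ?_
  have h3 := integral_mono h1 (h2.add hZ.1) h
  rwa [integral_add' h2 hZ.1, hZ.2, add_zero] at h3

end TaubNUT

namespace TaubNUT

/-! ### Averages over balls -/

-- A dominated convergence theorem with moving dominants of constant integral, obtained by applying
-- Fatou to `g n - r n`. The dominants will be ball averages of `|u|²`, which converge almost
-- everywhere and preserve the integral.
open Filter Metric in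
theorem tendsto_lintegral_zero_of_le {α : Type*} [MeasurableSpace α] {μ : Measure α}
    {r g : ℕ → α → ENNReal} {G : α → ENNReal}
    (hr : ∀ n, AEMeasurable (r n) μ) (hg : ∀ n, AEMeasurable (g n) μ)
    (hle : ∀ n x, r n x ≤ g n x) (hr0 : ∀ᵐ x ∂μ, Tendsto (fun n => r n x) atTop (nhds 0))
    (hgG : ∀ᵐ x ∂μ, Tendsto (fun n => g n x) atTop (nhds (G x)))
    (hint : ∀ n, ∫⁻ x, g n x ∂μ = ∫⁻ x, G x ∂μ) (hG : ∫⁻ x, G x ∂μ ≠ ⊤) :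
    Tendsto (fun n => ∫⁻ x, r n x ∂μ) atTop (nhds 0) := by
  have hrG : ∀ n, ∫⁻ x, r n x ∂μ ≤ ∫⁻ x, G x ∂μ := fun n =>
    (lintegral_mono (hle n)).trans (hint n).le
  have h1 : ∫⁻ x, G x ∂μ ≤ liminf (fun n => ∫⁻ x, G x ∂μ - ∫⁻ x, r n x ∂μ) atTop := by
    calc ∫⁻ x, G x ∂μ = ∫⁻ x, liminf (fun n => g n x - r n x) atTop ∂μ := by
          refine lintegral_congr_ae ?_
          filter_upwards [hr0, hgG] with x h0 h1
          have h2 := ENNReal.Tendsto.sub h1 h0 (Or.inr ENNReal.zero_ne_top)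
          rw [tsub_zero] at h2
          exact h2.liminf_eq.symm
      _ ≤ liminf (fun n => ∫⁻ x, g n x - r n x ∂μ) atTop :=
          lintegral_liminf_le' fun n => (hg n).sub (hr n)
      _ = _ := by
          congr 1
          ext n
          rw [lintegral_sub' (hr n) (ne_top_of_le_ne_top hG (hrG n)) (ae_of_all _ (hle n)), hint]
  rw [ENNReal.tendsto_nhds_zero]
  intro ε hε
  rcases eq_or_ne (∫⁻ x, G x ∂μ) 0 with h0 | h0
  · exact Eventually.of_forall fun n => ((hrG n).trans h0.le).trans zero_le
  · have h2 : ∫⁻ x, G x ∂μ - ε < ∫⁻ x, G x ∂μ := ENNReal.sub_lt_self hG h0 hε.ne'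
    filter_upwards [eventually_lt_of_lt_liminf (h2.trans_le h1)] with n hn
    by_contra hlt
    exact absurd hn (not_lt.2 (tsub_le_tsub_left (not_le.1 hlt).le _))

/-- The average of a function over a closed ball. -/
noncomputable def ballAvg (ε : ℝ) (F : E4 → ENNReal) (x : E4) : ENNReal :=
  (∫⁻ y in Metric.closedBall x ε, F y) / volume (Metric.closedBall (0 : E4) ε)

theorem volume_closedBall_ne_zero {ε : ℝ} (hε : 0 < ε) :
    volume (Metric.closedBall (0 : E4) ε) ≠ 0 :=
  (Metric.measure_closedBall_pos volume _ hε).ne'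

theorem volume_closedBall_ne_top (ε : ℝ) : volume (Metric.closedBall (0 : E4) ε) ≠ ⊤ :=
  measure_closedBall_lt_top.ne

/-- Cauchy–Schwarz against the constant `1` on the ball. -/
theorem ballAvg_sq_le {ε : ℝ} (hε : 0 < ε) {F : E4 → ENNReal} (hF : AEMeasurable F) (x : E4) :
    ballAvg ε F x ^ 2 ≤ ballAvg ε (fun y => F y ^ 2) x := by
  have h := ENNReal.lintegral_mul_le_Lp_mul_Lq (volume.restrict (Metric.closedBall x ε))
    Real.HolderConjugate.two_two hF.restrict (aemeasurable_const (b := (1 : ENNReal)))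
  have h2 : (∫⁻ y in Metric.closedBall x ε, F y) ^ 2 ≤
      (∫⁻ y in Metric.closedBall x ε, F y ^ 2) * volume (Metric.closedBall (0 : E4) ε) := by
    calc _ ≤ _ := pow_le_pow_left' (by simpa using h) 2
      _ = _ := by
        rw [mul_pow, ← ENNReal.rpow_natCast, ← ENNReal.rpow_natCast, ← ENNReal.rpow_mul,
          ← ENNReal.rpow_mul, Measure.addHaar_closedBall_center volume x]
        norm_num
  have hV := volume_closedBall_ne_zero hε
  have hV' := volume_closedBall_ne_top ε
  rw [ballAvg, ballAvg, ENNReal.div_eq_inv_mul, ENNReal.div_eq_inv_mul, mul_pow]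
  calc _ ≤ (volume (Metric.closedBall (0 : E4) ε))⁻¹ ^ 2 * ((∫⁻ y in Metric.closedBall x ε, F y ^ 2)
        * volume (Metric.closedBall (0 : E4) ε)) := by gcongr
    _ = (volume (Metric.closedBall (0 : E4) ε))⁻¹ * (∫⁻ y in Metric.closedBall x ε, F y ^ 2) *
        ((volume (Metric.closedBall (0 : E4) ε))⁻¹ * volume (Metric.closedBall (0 : E4) ε)) := by
      ring
    _ = _ := by rw [ENNReal.inv_mul_cancel hV hV', mul_one]

theorem aemeasurable_ball_indicator (ε : ℝ) {F : E4 → ENNReal} (hF : AEMeasurable F) :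
    AEMeasurable (fun p : E4 × E4 => (Metric.closedBall p.1 ε).indicator F p.2)
      (volume.prod volume) := by
  have h1 : MeasurableSet {p : E4 × E4 | dist p.2 p.1 ≤ ε} :=
    measurableSet_le (by fun_prop) measurable_const
  have h2 : AEMeasurable (fun p : E4 × E4 => F p.2) (volume.prod volume) :=
    hF.comp_quasiMeasurePreserving Measure.quasiMeasurePreserving_snd
  refine (h2.indicator h1).congr (ae_of_all _ fun p => ?_)
  change _ = (Metric.closedBall p.1 ε).indicator F p.2
  by_cases hp : dist p.2 p.1 ≤ ε
  · rw [Set.indicator_of_mem (by exact hp), Set.indicator_of_mem (by exact hp)]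
  · rw [Set.indicator_of_notMem (by exact hp), Set.indicator_of_notMem (by exact hp)]

theorem ballAvg_eq (ε : ℝ) (F : E4 → ENNReal) (x : E4) :
    ballAvg ε F x = (∫⁻ y, (Metric.closedBall x ε).indicator F y)
      / volume (Metric.closedBall (0 : E4) ε) := by
  rw [ballAvg, lintegral_indicator Metric.isClosed_closedBall.measurableSet]

theorem aemeasurable_ballAvg (ε : ℝ) {F : E4 → ENNReal} (hF : AEMeasurable F) :
    AEMeasurable (ballAvg ε F) := by
  have h := (aemeasurable_ball_indicator ε hF).lintegral_prod_right'
  simp only [funext (ballAvg_eq ε F)]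
  exact h.div_const _

/-- Tonelli, using that `y ∈ closedBall x ε` is symmetric in `x` and `y`. -/
theorem lintegral_ballAvg {ε : ℝ} (hε : 0 < ε) {F : E4 → ENNReal} (hF : AEMeasurable F) :
    ∫⁻ x, ballAvg ε F x = ∫⁻ x, F x := by
  have hV := volume_closedBall_ne_zero hε
  have hV' := volume_closedBall_ne_top ε
  simp only [ballAvg_eq, ENNReal.div_eq_inv_mul]
  rw [lintegral_const_mul' _ _ (ENNReal.inv_ne_top.2 hV),
    lintegral_lintegral_swap (aemeasurable_ball_indicator ε hF)]
  have h : ∀ y, ∫⁻ x, (Metric.closedBall x ε).indicator F y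
      = F y * volume (Metric.closedBall (0 : E4) ε) := by
    intro y
    rw [← Measure.addHaar_closedBall_center volume y, ← lintegral_indicator_const
      Metric.isClosed_closedBall.measurableSet]
    refine lintegral_congr fun x => ?_
    by_cases hx : dist y x ≤ ε
    · rw [Set.indicator_of_mem (by exact hx), Set.indicator_of_mem
        (by rw [Metric.mem_closedBall, dist_comm]; exact hx)]
    · rw [Set.indicator_of_notMem (by exact hx), Set.indicator_of_notMem
        (by rw [Metric.mem_closedBall, dist_comm]; exact hx)]
  simp only [h]
  rw [lintegral_mul_const' _ _ hV', mul_comm, mul_assoc, ENNReal.mul_inv_cancel hV hV', mul_one]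

open Filter in
theorem ae_tendsto_ballAvg {ε : ℕ → ℝ} (hε : Tendsto ε atTop (nhdsWithin 0 (Set.Ioi 0)))
    {F : E4 → ENNReal} (hF : AEMeasurable F) (hF' : ∫⁻ x, F x ≠ ⊤) :
    ∀ᵐ x, Tendsto (fun n => ballAvg (ε n) F x) atTop (nhds (F x)) := by
  filter_upwards [(Besicovitch.vitaliFamily (volume : Measure E4)).ae_tendsto_lintegral_div hF hF']
    with x hx
  refine ((hx.comp (Besicovitch.tendsto_filterAt volume x)).comp hε).congr fun n => ?_
  simp only [Function.comp, ballAvg, Measure.addHaar_closedBall_center volume x]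

-- Almost every point is a Lebesgue point, for the Besicovitch differentiation basis.
open Filter in
theorem ae_tendsto_ballAvg_sub {ε : ℕ → ℝ} (hε : Tendsto ε atTop (nhdsWithin 0 (Set.Ioi 0)))
    {u : E4 → Spinor} (hu : LocallyIntegrable u) :
    ∀ᵐ x, Tendsto (fun n => ballAvg (ε n) (fun y => ‖u y - u x‖ₑ) x) atTop (nhds 0) := by
  filter_upwards [(Besicovitch.vitaliFamily (volume :
    Measure E4)).ae_tendsto_lintegral_enorm_sub_div hu] with x hx
  refine ((hx.comp (Besicovitch.tendsto_filterAt volume x)).comp hε).congr fun n => ?_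
  simp only [Function.comp, ballAvg, Measure.addHaar_closedBall_center volume x]

theorem lintegral_sq_le_of_le_ballAvg {ε : ℝ} (hε : 0 < ε) {v : E4 → Spinor} {f : E4 → Spinor}
    (hf : AEStronglyMeasurable f) (K : ENNReal) (h : ∀ x, ‖v x‖ₑ ≤ K * ballAvg ε (‖f ·‖ₑ) x) :
    ∫⁻ x, ‖v x‖ₑ ^ 2 ≤ K ^ 2 * ∫⁻ x, ‖f x‖ₑ ^ 2 := by
  have hm : AEMeasurable fun x => ‖f x‖ₑ := hf.enorm
  rw [← lintegral_ballAvg hε (hm.pow_const 2),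
    ← lintegral_const_mul'' _ (aemeasurable_ballAvg ε (hm.pow_const 2))]
  refine lintegral_mono fun x => ?_
  calc ‖v x‖ₑ ^ 2 ≤ (K * ballAvg ε (‖f ·‖ₑ) x) ^ 2 := pow_le_pow_left' (h x) 2
    _ ≤ _ := by
      rw [mul_pow]
      gcongr
      exact ballAvg_sq_le hε hm x

-- Pointwise bounds by ball averages promote almost everywhere convergence to `L²` convergence: `K²`
-- times the average of `|u|²` is a dominant whose integral does not depend on `n`.
open Filter in
theorem tendsto_lintegral_sq_zero {ε : ℕ → ℝ} (hε : ∀ n, 0 < ε n)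
    (hε' : Tendsto ε atTop (nhds 0)) {v : ℕ → E4 → Spinor} {u : E4 → Spinor}
    (hv : ∀ n, AEStronglyMeasurable (v n)) (hu : MemLp u 2) (K : ENNReal) (hK : K ≠ ⊤)
    (h : ∀ n x, ‖v n x‖ₑ ≤ K * ballAvg (ε n) (‖u ·‖ₑ) x)
    (h0 : ∀ᵐ x, Tendsto (fun n => ‖v n x‖ₑ) atTop (nhds 0)) :
    Tendsto (fun n => ∫⁻ x, ‖v n x‖ₑ ^ 2) atTop (nhds 0) := by
  have hm : AEMeasurable fun x => ‖u x‖ₑ := hu.1.enorm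
  have hfin : ∫⁻ x, ‖u x‖ₑ ^ 2 ≠ ⊤ := by
    have := (lintegral_rpow_enorm_lt_top_of_eLpNorm_lt_top two_ne_zero ENNReal.ofNat_ne_top hu.2).ne
    simpa using this
  have hε2 : Tendsto ε atTop (nhdsWithin 0 (Set.Ioi 0)) :=
    tendsto_nhdsWithin_iff.2 ⟨hε', Eventually.of_forall hε⟩
  refine tendsto_lintegral_zero_of_le (g := fun n x => K ^ 2 * ballAvg (ε n) (‖u ·‖ₑ ^ 2) x)
    (G := fun x => K ^ 2 * ‖u x‖ₑ ^ 2) (fun n => (hv n).enorm.pow_const 2)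
    (fun n => (aemeasurable_ballAvg _ (hm.pow_const 2)).const_mul _) (fun n x => ?_) ?_ ?_
    (fun n => ?_) ?_
  · calc ‖v n x‖ₑ ^ 2 ≤ (K * ballAvg (ε n) (‖u ·‖ₑ) x) ^ 2 := pow_le_pow_left' (h n x) 2
      _ ≤ _ := by
        rw [mul_pow]
        gcongr
        exact ballAvg_sq_le (hε n) hm x
  · filter_upwards [h0] with x hx
    simpa using ENNReal.Tendsto.pow (n := 2) hx
  · filter_upwards [ae_tendsto_ballAvg hε2 (hm.pow_const 2) hfin] with x hx
    exact ENNReal.Tendsto.const_mul hx (Or.inr (ENNReal.pow_ne_top hK))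
  · rw [lintegral_const_mul'' _ (aemeasurable_ballAvg _ (hm.pow_const 2)),
      lintegral_ballAvg (hε n) (hm.pow_const 2), lintegral_const_mul'' _ (hm.pow_const 2)]
  · rw [lintegral_const_mul'' _ (hm.pow_const 2)]
    exact ENNReal.mul_ne_top (ENNReal.pow_ne_top hK) hfin

end TaubNUT

namespace TaubNUT

/-! ### Mollification -/

/-- A smooth approximate identity at scale `ε`, with the natural bounds. -/
structure IsMollifier (K ε : ℝ) (η : E4 → ℝ) : Prop where
  pos : 0 < ε
  contDiff : ContDiff ℝ ∞ η
  tsupport_subset : tsupport η ⊆ Metric.closedBall 0 ε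
  integral_eq : ∫ z, η z = 1
  bound : ∀ z, ‖η z‖ ≤ K / volume.real (Metric.closedBall (0 : E4) ε)
  fderiv_bound : ∀ z, ‖fderiv ℝ η z‖ ≤ K / (ε * volume.real (Metric.closedBall (0 : E4) ε))

theorem exists_isMollifier : ∃ K : ℝ, 0 ≤ K ∧ ∀ ε : ℝ, 0 < ε → ∃ η, IsMollifier K ε η := by
  let φ₀ : ContDiffBump (0 : E4) := ⟨1, 2, one_pos, one_lt_two⟩
  obtain ⟨M, hM⟩ := (φ₀.contDiff (n := 1)).continuous_fderiv one_ne_zero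
    |>.bounded_above_of_compact_support (φ₀.hasCompactSupport.fderiv ℝ)
  have hM0 : 0 ≤ M := (norm_nonneg _).trans (hM 0)
  -- Halving the radius divides the volume by `2⁴ = 16`, so the normalizing factor is at most
  -- `16/V`. The derivative of the bump rescaled to `ε/2` is at most `2M/ε`, whence `32M/(εV)`.
  refine ⟨16 + 32 * M, by positivity, fun ε hε => ?_⟩
  let φ : ContDiffBump (0 : E4) := ⟨ε / 2, ε, by positivity, by linarith⟩
  set V := volume.real (Metric.closedBall (0 : E4) ε) with hV
  have hV0 : 0 < V := ENNReal.toReal_pos (volume_closedBall_ne_zero hε) (volume_closedBall_ne_top ε)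
  have hVr : volume.real (Metric.closedBall (0 : E4) (ε / 2)) = V / 16 := by
    rw [hV, Measure.addHaar_real_closedBall volume _ hε.le,
      Measure.addHaar_real_closedBall volume _ (by positivity)]
    simp
    ring
  have hI : V / 16 ≤ ∫ x, φ x := hVr ▸ φ.measure_closedBall_le_integral volume
  have hI0 : 0 < ∫ x, φ x := (by positivity : 0 < V / 16).trans_le hI
  have hφ : ∀ z, φ z = φ₀ ((ε / 2)⁻¹ • z) := by
    intro z
    simp only [ContDiffBump.apply, φ, φ₀, sub_zero, inv_one, one_smul, div_one]
    congr 1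
    field_simp
  have hd : ∀ z, ‖fderiv ℝ φ z‖ ≤ M / (ε / 2) := by
    intro z
    have h1 : HasFDerivAt (fun z : E4 => (ε / 2)⁻¹ • z)
        ((ε / 2)⁻¹ • ContinuousLinearMap.id ℝ E4) z :=
      ((ε / 2)⁻¹ • ContinuousLinearMap.id ℝ E4).hasFDerivAt
    have h2 := (((φ₀.contDiff (n := 1)).differentiable one_ne_zero) ((ε / 2)⁻¹ • z)).hasFDerivAt.comp
      z h1
    have h3 : HasFDerivAt φ _ z := h2.congr_of_eventuallyEq (Filter.Eventually.of_forall hφ)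
    rw [h3.fderiv, ContinuousLinearMap.comp_smul, norm_smul, ContinuousLinearMap.comp_id,
      Real.norm_of_nonneg (by positivity), div_eq_inv_mul M]
    exact mul_le_mul_of_nonneg_left (hM _) (by positivity)
  refine ⟨φ.normed volume, hε, φ.contDiff_normed, φ.tsupport_normed_eq.le, φ.integral_normed,
    fun z => ?_, fun z => ?_⟩
  · rw [Real.norm_of_nonneg (φ.nonneg_normed z)]
    refine (φ.normed_le_div_measure_closedBall_rIn volume z).trans ?_
    change 1 / volume.real (Metric.closedBall (0 : E4) (ε / 2)) ≤ _
    rw [hVr, one_div_div]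
    gcongr
    linarith
  · have h : φ.normed volume = fun x => (∫ x, φ x)⁻¹ * φ x := by
      ext x
      rw [φ.normed_def, div_eq_inv_mul]
    rw [h, fderiv_const_mul ((φ.contDiff (n := 1)).differentiable one_ne_zero z), norm_smul,
      Real.norm_of_nonneg (by positivity)]
    calc _ ≤ (V / 16)⁻¹ * (M / (ε / 2)) := by gcongr; exact hd z
      _ = 32 * M / (ε * V) := by field_simp; ring
      _ ≤ _ := by gcongr; linarith

theorem IsMollifier.hasCompactSupport {K ε : ℝ} {η : E4 → ℝ} (h : IsMollifier K ε η) :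
    HasCompactSupport η :=
  (isCompact_closedBall 0 ε).of_isClosed_subset (isClosed_tsupport _) h.tsupport_subset

theorem IsMollifier.eq_zero {K ε : ℝ} {η : E4 → ℝ} (h : IsMollifier K ε η) {z : E4}
    (hz : ε < ‖z‖) : η z = 0 :=
  image_eq_zero_of_notMem_tsupport fun hm => by
    have := h.tsupport_subset hm
    rw [mem_closedBall_zero_iff] at this
    linarith

theorem IsMollifier.fderiv_eq_zero {K ε : ℝ} {η : E4 → ℝ} (h : IsMollifier K ε η) {z : E4}
    (hz : ε < ‖z‖) : fderiv ℝ η z = 0 := by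
  by_contra hne
  have := h.tsupport_subset (support_fderiv_subset ℝ hne)
  rw [mem_closedBall_zero_iff] at this
  linarith

/-- The convolution of a function with a mollifier. -/
noncomputable def mollify (η : E4 → ℝ) (u : E4 → Spinor) (x : E4) : Spinor :=
  ∫ y, η (x - y) • u y

theorem mollify_eq (η : E4 → ℝ) (u : E4 → Spinor) :
    mollify η u = convolution η u (ContinuousLinearMap.lsmul ℝ ℝ) volume := by
  ext1 x
  rw [convolution_lsmul_swap, mollify]

section

variable {K ε : ℝ} {η : E4 → ℝ} {u : E4 → Spinor}

theorem IsMollifier.contDiff_mollify (h : IsMollifier K ε η) (hu : LocallyIntegrable u) :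
    ContDiff ℝ ∞ (mollify η u) := by
  rw [mollify_eq]
  exact h.hasCompactSupport.contDiff_convolution_left _ h.contDiff hu

theorem IsMollifier.hasCompactSupport_mollify (h : IsMollifier K ε η)
    (hu : HasCompactSupport u) : HasCompactSupport (mollify η u) := by
  rw [mollify_eq]
  exact h.hasCompactSupport.convolution _ hu

theorem IsMollifier.fderiv_mollify (h : IsMollifier K ε η) (hu : LocallyIntegrable u) (x v : E4) :
    fderiv ℝ (mollify η u) x v = ∫ y, fderiv ℝ η (x - y) v • u y := by
  rw [mollify_eq, (h.hasCompactSupport.hasFDerivAt_convolution_left _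
    (h.contDiff.of_le (by simp)) hu x).fderiv, convolution_eq_swap,
    ContinuousLinearMap.integral_apply]
  · rfl
  · exact ((h.hasCompactSupport.fderiv ℝ).convolutionExists_left _
      (h.contDiff.continuous_fderiv (by simp)) hu x).integrable_swap

theorem integrable_smul_of_bound {k : E4 → ℝ} (hk : Continuous k) (hc : HasCompactSupport k)
    (hu : LocallyIntegrable u) : Integrable fun y => k y • u y :=
  hu.integrable_smul_left_of_hasCompactSupport hk hc

/-- Turns size and support bounds on a kernel into a pointwise bound by the ball average, the form
in which the `L²` lemmas consume it. -/
theorem enorm_integral_le_ballAvg {k : E4 → E4 → Spinor} {C : ℝ} (hC : 0 ≤ C)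
    {F : E4 → Spinor} {x : E4} (hε : 0 < ε)
    (hk : ∀ y, ‖k x y‖ ≤ C / volume.real (Metric.closedBall (0 : E4) ε) * ‖F y‖)
    (hk0 : ∀ y, ε < ‖x - y‖ → k x y = 0) :
    ‖∫ y, k x y‖ₑ ≤ ENNReal.ofReal C * ballAvg ε (‖F ·‖ₑ) x := by
  have hV0 : 0 < volume.real (Metric.closedBall (0 : E4) ε) :=
    ENNReal.toReal_pos (volume_closedBall_ne_zero hε) (volume_closedBall_ne_top ε)
  calc ‖∫ y, k x y‖ₑ ≤ ∫⁻ y, ‖k x y‖ₑ := enorm_integral_le_lintegral_enorm _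
    _ ≤ ∫⁻ y, (Metric.closedBall x ε).indicator (fun y => ENNReal.ofReal
          (C / volume.real (Metric.closedBall (0 : E4) ε)) * ‖F y‖ₑ) y := by
        refine lintegral_mono fun y => ?_
        by_cases hy : y ∈ Metric.closedBall x ε
        · rw [Set.indicator_of_mem hy, ← ofReal_norm, ← ofReal_norm,
            ← ENNReal.ofReal_mul (by positivity)]
          exact ENNReal.ofReal_le_ofReal (hk y)
        · rw [Set.indicator_of_notMem hy, hk0 y, enorm_zero]
          rwa [Metric.mem_closedBall, dist_comm, dist_eq_norm, not_le] at hy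
    _ = ENNReal.ofReal C * ballAvg ε (‖F ·‖ₑ) x := by
        rw [lintegral_indicator Metric.isClosed_closedBall.measurableSet,
          lintegral_const_mul' _ _ ENNReal.ofReal_ne_top, ballAvg,
          ENNReal.ofReal_div_of_pos hV0, measureReal_def,
          ENNReal.ofReal_toReal (volume_closedBall_ne_top ε), ENNReal.div_eq_inv_mul,
          ENNReal.div_eq_inv_mul]
        ring

end

end TaubNUT

namespace TaubNUT

/-! ### Friedrichs' commutator -/

theorem norm_cliff (i : Fin 4) (ψ : Spinor) : ‖cliff i ψ‖ = ‖ψ‖ := by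
  rw [← sq_eq_sq₀ (norm_nonneg _) (norm_nonneg _), EuclideanSpace.norm_sq_eq,
    EuclideanSpace.norm_sq_eq]
  fin_cases i <;> simp [Fin.sum_univ_four, cliff_zero, cliff_one, cliff_two, cliff_three] <;> ring

theorem inner_cliff_left (i : Fin 4) (ψ χ : Spinor) :
    inner ℂ (cliff i ψ) χ = -inner ℂ ψ (cliff i χ) := by
  fin_cases i <;> simp [PiLp.inner_apply, Fin.sum_univ_four, cliff_zero, cliff_one, cliff_two,
    cliff_three] <;> ring

/-- `negPart` as a continuous linear map. -/
noncomputable def negProj : Spinor →L[ℂ] Spinor :=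
  LinearMap.toContinuousLinearMap
    { toFun := negPart
      map_add' := fun x y => by ext i; fin_cases i <;> simp [negPart]
      map_smul' := fun c x => by ext i; fin_cases i <;> simp [negPart] }

theorem negProj_apply (ψ : Spinor) : negProj ψ = negPart ψ := rfl

theorem norm_negProj_le (ψ : Spinor) : ‖negProj ψ‖ ≤ ‖ψ‖ := by
  rw [← sq_le_sq₀ (norm_nonneg _) (norm_nonneg _), EuclideanSpace.norm_sq_eq,
    EuclideanSpace.norm_sq_eq, negProj_apply]
  simp only [Fin.sum_univ_four, negPart]
  simp
  linarith [sq_nonneg ‖ψ 2‖, sq_nonneg ‖ψ 3‖]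

theorem inner_negProj_left (ψ χ : Spinor) :
    inner ℂ (negProj ψ) χ = inner ℂ ψ (negProj χ) := by
  simp [PiLp.inner_apply, Fin.sum_univ_four, negProj_apply, negPart]

/-- Clifford multiplication swaps the half-spinor spaces, so `P c_i = c_i (1 - P)` for the
projection `P`. This makes the adjoint of the zeroth-order term explicit. -/
theorem negProj_cliff (i : Fin 4) (ψ : Spinor) :
    negProj (cliff i ψ) = cliff i ψ - cliff i (negProj ψ) := by
  fin_cases i <;> ext c <;> fin_cases c <;>
    simp [negProj_apply, negPart, cliff_zero, cliff_one, cliff_two, cliff_three]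

theorem flatDirac_eq (κ β : ℝ) (φ : E4 → Spinor) (x : E4) :
    flatDirac κ β φ x = ∑ i, (cliff i (fderiv ℝ φ x (flatFrame κ i x))
      + ((β - κ) * x i) • cliff i (negProj (φ x))) := by
  rw [flatDirac, Finset.sum_add_distrib, Finset.smul_sum]
  congr 1
  refine Finset.sum_congr rfl fun i _ => ?_
  rw [negProj_apply, ← Complex.coe_smul, smul_smul]
  push_cast
  rfl

/-- The formal adjoint of `flatDirac` for Lebesgue measure. -/
noncomputable def flatDiracAdjoint (κ β : ℝ) (φ : E4 → Spinor) (x : E4) : Spinor :=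
  flatDirac κ β φ x - β • ∑ i, x i • cliff i (φ x)

/-- Clifford multiplication by a smooth symbol, tested against spinors. -/
theorem inner_flatDiracAdjoint_smul (κ β : ℝ) {k : E4 → ℝ} {y : E4} (hk : DifferentiableAt ℝ k y)
    (s v : Spinor) :
    inner ℂ (flatDiracAdjoint κ β (fun y => k y • s) y) v =
      inner ℂ s (∑ i, ((-fderiv ℝ k y (flatFrame κ i y)) • cliff i v
        + ((β - κ) * y i * k y) • cliff i (negProj v) + (κ * y i * k y) • cliff i v)) := by
  have hd : ∀ w, fderiv ℝ (fun y => k y • s) y w = fderiv ℝ k y w • s := by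
    intro w
    rw [fderiv_smul_const hk]
    rfl
  rw [flatDiracAdjoint, flatDirac_eq, Finset.smul_sum, ← Finset.sum_sub_distrib, sum_inner,
    inner_sum]
  refine Finset.sum_congr rfl fun i _ => ?_
  simp only [hd]
  simp only [map_smul, ← Complex.coe_smul, inner_sub_left, inner_add_left,
    inner_smul_left, inner_add_right, inner_smul_right, inner_cliff_left, inner_negProj_left,
    negProj_cliff, inner_sub_right, Complex.conj_ofReal]
  push_cast
  ring

/-- The scalar kernel of the commutator of the divergence-free part of a frame field with the
convolution by `η`. -/
noncomputable def commCoeff (κ : ℝ) (η : E4 → ℝ) (i : Fin 4) (x y : E4) : ℝ :=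
  fderiv ℝ η (x - y) (flatFrame κ i x) - fderiv ℝ η (x - y) (flatFrame κ i y)
    - κ * y i * η (x - y)

/-- The kernel of the commutator of the Dirac operator with the convolution by `η`. -/
noncomputable def commKernel (κ : ℝ) (β : E4 → ℝ) (η : E4 → ℝ) (x y : E4) (s : Spinor) : Spinor :=
  ∑ i, (commCoeff κ η i x y • cliff i s
    + (η (x - y) * ((β x - κ) * x i - (β y - κ) * y i)) • cliff i (negProj s))

theorem norm_hopf (x : E4) : ‖hopf x‖ = ‖x‖ := by
  rw [← sq_eq_sq₀ (norm_nonneg _) (norm_nonneg _), norm_sq_eq, norm_sq_eq]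
  simp [hopf]
  ring

theorem abs_hopf_apply_le (x : E4) (i : Fin 4) : |hopf x i| ≤ ‖x‖ :=
  (PiLp.norm_apply_le (hopf x) i).trans (norm_hopf x).le

theorem hopf_sub (x y : E4) : hopf x - hopf y = hopf (x - y) := (map_sub hopfCLM x y).symm

theorem norm_flatFrame_sub_le {κ : ℝ} (hκ : 0 ≤ κ) (i : Fin 4) {x y : E4} {R : ℝ}
    (hx : ‖x‖ ≤ R) (hy : ‖y‖ ≤ R) :
    ‖flatFrame κ i x - flatFrame κ i y‖ ≤ 2 * κ * R * ‖x - y‖ := by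
  have e : flatFrame κ i x - flatFrame κ i y =
      (κ * hopf x i) • hopf (x - y) + (κ * hopf (x - y) i) • hopf y := by
    rw [← hopf_sub]
    ext l
    simp [flatFrame]
    ring
  have hR : 0 ≤ R := (norm_nonneg _).trans hx
  rw [e]
  refine (norm_add_le _ _).trans ?_
  rw [norm_smul, norm_smul, norm_hopf, norm_hopf, norm_mul, norm_mul, Real.norm_of_nonneg hκ,
    Real.norm_eq_abs, Real.norm_eq_abs]
  have h1 : κ * |hopf x i| * ‖x - y‖ ≤ κ * R * ‖x - y‖ := by
    gcongr; exact (abs_hopf_apply_le _ _).trans hx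
  have h2 : κ * |hopf (x - y) i| * ‖y‖ ≤ κ * ‖x - y‖ * R := by
    gcongr; exact abs_hopf_apply_le _ _
  linarith

/-- The essence of Friedrichs' lemma: the factor `1/ε` from the derivative of the mollifier is
compensated by the Lipschitz bound `2κRε` for the frame on the support. Together with the divergence
term this gives `3 = 2 + 1`. -/
theorem IsMollifier.abs_commCoeff_le {K ε κ : ℝ} {η : E4 → ℝ} (h : IsMollifier K ε η)
    (hK : 0 ≤ K) (hκ : 0 ≤ κ) (i : Fin 4) {x y : E4} {R : ℝ} (hx : ‖x‖ ≤ R) (hy : ‖y‖ ≤ R) :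
    ‖commCoeff κ η i x y‖ ≤ (3 * K * κ * R) / volume.real (Metric.closedBall (0 : E4) ε) := by
  set V := volume.real (Metric.closedBall (0 : E4) ε)
  have hV0 : 0 < V := ENNReal.toReal_pos (volume_closedBall_ne_zero h.pos)
    (volume_closedBall_ne_top ε)
  have hR : 0 ≤ R := (norm_nonneg _).trans hx
  have hε := h.pos
  have hb := h.bound (x - y)
  have h1 : ‖fderiv ℝ η (x - y) (flatFrame κ i x) - fderiv ℝ η (x - y) (flatFrame κ i y)‖
      ≤ K / V * (2 * κ * R) := by
    rcases lt_or_ge ε ‖x - y‖ with hxy | hxy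
    · rw [h.fderiv_eq_zero hxy]
      simp only [_root_.zero_apply, sub_zero, norm_zero]
      positivity
    · rw [← map_sub]
      calc _ ≤ K / (ε * V) * (2 * κ * R * ‖x - y‖) :=
            (ContinuousLinearMap.le_opNorm _ _).trans
              (mul_le_mul (h.fderiv_bound _) (norm_flatFrame_sub_le hκ i hx hy) (norm_nonneg _)
                (by positivity))
        _ ≤ K / (ε * V) * (2 * κ * R * ε) := by gcongr
        _ = _ := by field_simp
  have h2 : ‖κ * y i * η (x - y)‖ ≤ κ * R * (K / V) := by
    rw [norm_mul, norm_mul, Real.norm_of_nonneg hκ]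
    gcongr
    exact (PiLp.norm_apply_le y i).trans hy
  calc _ ≤ K / V * (2 * κ * R) + κ * R * (K / V) := (norm_sub_le _ _).trans (add_le_add h1 h2)
    _ = _ := by ring

/-- The constant is `20 = 4 · (3 + 2)`: four directions, with `3` from `commCoeff` and `2` from the
zeroth-order term. -/
theorem IsMollifier.norm_commKernel_le {K ε κ : ℝ} {η β : E4 → ℝ} (h : IsMollifier K ε η)
    (hK : 0 ≤ K) (hκ : 0 ≤ κ) (hβ : ∀ x, |β x - κ| ≤ κ) {x y : E4} {R : ℝ} (hx : ‖x‖ ≤ R)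
    (hy : ‖y‖ ≤ R) (s : Spinor) :
    ‖commKernel κ β η x y s‖ ≤
      (20 * K * κ * R) / volume.real (Metric.closedBall (0 : E4) ε) * ‖s‖ := by
  have h1 := fun i => h.abs_commCoeff_le hK hκ i hx hy
  have hb := h.bound (x - y)
  have hε := h.pos
  set V := volume.real (Metric.closedBall (0 : E4) ε)
  have hR : 0 ≤ R := (norm_nonneg _).trans hx
  have hcoord : ∀ (z : E4) (i : Fin 4), ‖z‖ ≤ R → |z i| ≤ R := fun z i hz =>
    (PiLp.norm_apply_le z i).trans hz
  have h3 : ∀ i, ‖η (x - y) * ((β x - κ) * x i - (β y - κ) * y i)‖ ≤ K / V * (κ * R + κ * R) := by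
    intro i
    rw [norm_mul]
    gcongr
    refine (norm_sub_le _ _).trans ?_
    rw [norm_mul, norm_mul]
    gcongr
    · exact hβ x
    · exact hcoord x i hx
    · exact hβ y
    · exact hcoord y i hy
  calc ‖commKernel κ β η x y s‖ ≤ ∑ _i : Fin 4, (3 * K * κ * R / V
        + K / V * (κ * R + κ * R)) * ‖s‖ := by
        refine norm_sum_le_of_le _ fun i _ => (norm_add_le _ _).trans ?_
        rw [norm_smul, norm_smul, norm_cliff, norm_cliff, add_mul]
        gcongr
        · exact h1 i
        · exact h3 i
        · exact norm_negProj_le s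
    _ = _ := by
        rw [Finset.sum_const, Finset.card_univ, Fintype.card_fin, nsmul_eq_mul]
        push_cast
        ring

theorem IsMollifier.commCoeff_eq_zero {K ε κ : ℝ} {η : E4 → ℝ} (h : IsMollifier K ε η)
    {x y : E4} (hxy : ε < ‖x - y‖) (i : Fin 4) : commCoeff κ η i x y = 0 := by
  simp [commCoeff, h.eq_zero hxy, h.fderiv_eq_zero hxy]

theorem IsMollifier.commKernel_eq_zero {K ε κ : ℝ} {η β : E4 → ℝ} (h : IsMollifier K ε η)
    {x y : E4} (hxy : ε < ‖x - y‖) (s : Spinor) : commKernel κ β η x y s = 0 := by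
  simp [commKernel, h.eq_zero hxy, h.commCoeff_eq_zero hxy]

end TaubNUT

namespace TaubNUT

/-! ### Convergence of the Friedrichs commutator -/

section

variable {K ε κ : ℝ} {η β : E4 → ℝ} {u f : E4 → Spinor}

theorem hasCompactSupport_of_eq_zero {x : E4} {k : E4 → ℝ}
    (hk : ∀ y, ε < ‖x - y‖ → k y = 0) : HasCompactSupport k :=
  HasCompactSupport.intro (isCompact_closedBall x ε) fun y hy => hk y (by
    rwa [Metric.mem_closedBall, dist_comm, dist_eq_norm, not_le] at hy)

theorem integrable_smul_clm {k : E4 → ℝ} (hk : Continuous k) (hc : HasCompactSupport k)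
    (hu : LocallyIntegrable u) (T : Spinor →L[ℂ] Spinor) :
    Integrable fun y => k y • T (u y) := by
  refine (T.integrable_comp (integrable_smul_of_bound hk hc hu)).congr (ae_of_all _ fun y => ?_)
  exact T.map_smul_of_tower (k y) (u y)

theorem integral_smul_clm {k : E4 → ℝ} (hk : Continuous k) (hc : HasCompactSupport k)
    (hu : LocallyIntegrable u) (T : Spinor →L[ℂ] Spinor) :
    ∫ y, k y • T (u y) = T (∫ y, k y • u y) := by
  rw [← T.integral_comp_comm (integrable_smul_of_bound hk hc hu)]
  exact integral_congr_ae (ae_of_all _ fun y => (T.map_smul_of_tower (k y) (u y)).symm)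

theorem IsMollifier.continuous_shift (h : IsMollifier K ε η) (x : E4) :
    Continuous fun y => η (x - y) :=
  h.contDiff.continuous.comp (continuous_const.sub continuous_id)

theorem IsMollifier.continuous_fderiv_shift (h : IsMollifier K ε η) (x : E4) {w : E4 → E4}
    (hw : Continuous w) : Continuous fun y => fderiv ℝ η (x - y) (w y) :=
  ((h.contDiff.continuous_fderiv (by simp)).comp (continuous_const.sub continuous_id)).clm_apply hw

theorem IsMollifier.fderiv_shift (h : IsMollifier K ε η) (x y v : E4) :
    fderiv ℝ (fun y => η (x - y)) y v = -fderiv ℝ η (x - y) v := by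
  have h1 : HasFDerivAt (fun y : E4 => x - y) (-ContinuousLinearMap.id ℝ E4) y :=
    (hasFDerivAt_id y).const_sub x
  have h2 := ((h.contDiff.differentiable (by simp)) (x - y)).hasFDerivAt.comp y h1
  have h3 : fderiv ℝ (fun y => η (x - y)) y = _ := h2.fderiv
  rw [h3]
  simp

theorem IsMollifier.integral_shift (h : IsMollifier K ε η) (x : E4) : ∫ y, η (x - y) = 1 := by
  rw [integral_sub_left_eq_self η volume x, h.integral_eq]

theorem continuous_flatFrame (κ : ℝ) (i : Fin 4) : Continuous (flatFrame κ i) :=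
  (contDiff_flatFrame κ i).continuous

theorem IsMollifier.continuous_commCoeff (h : IsMollifier K ε η) (i : Fin 4) (x : E4) :
    Continuous (commCoeff κ η i x) := by
  have h1 := h.continuous_fderiv_shift x (w := fun _ => flatFrame κ i x) continuous_const
  have h2 := h.continuous_fderiv_shift x (continuous_flatFrame κ i)
  have h3 := h.continuous_shift x
  have h4 : Continuous fun y : E4 => κ * y i := by fun_prop
  exact (h1.sub h2).sub (h4.mul h3)

/-- In `y`, the kernel is a difference of two divergences: those of `η(x - ·)` times `E_i`, and
times the constant vector `E_i(x)`. Its cancellation lets one replace `u y` by `u y - u x`. -/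
theorem IsMollifier.integral_commCoeff (h : IsMollifier K ε η) (i : Fin 4) (x : E4) :
    ∫ y, commCoeff κ η i x y = 0 := by
  have hF : ContDiff ℝ 1 fun y => η (x - y) :=
    (h.contDiff.of_le (by simp)).comp (contDiff_const.sub contDiff_id)
  have hc : HasCompactSupport fun y => η (x - y) :=
    hasCompactSupport_of_eq_zero fun y hy => h.eq_zero hy
  have h1 := integral_flatFrame κ i hF hc
  have h2 := integral_divergence (F := fun l y => flatFrame κ i x l * η (x - y))
    (fun l => contDiff_const.mul hF) (fun l => hc.mul_left)
  have h3 : ∀ y, ∑ l, fderiv ℝ (fun y => flatFrame κ i x l * η (x - y)) y (basisVec l)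
      = -fderiv ℝ η (x - y) (flatFrame κ i x) := by
    intro y
    rw [← h.fderiv_shift, clm_self, Fin.sum_univ_four]
    simp only [fderiv_const_mul (hF.differentiable one_ne_zero y)]
    rfl
  simp only [h3] at h2
  simp only [h.fderiv_shift] at h1
  have j1 : Integrable fun y => -fderiv ℝ η (x - y) (flatFrame κ i x) :=
    (h.continuous_fderiv_shift x continuous_const).neg.integrable_of_hasCompactSupport
      (hasCompactSupport_of_eq_zero (x := x) (ε := ε) fun y hy => by simp [h.fderiv_eq_zero hy])
  have j2 : Integrable fun y => -fderiv ℝ η (x - y) (flatFrame κ i y) - κ * y i * η (x - y) := by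
    refine Continuous.integrable_of_hasCompactSupport ?_
      (hasCompactSupport_of_eq_zero (x := x) (ε := ε) fun y hy => by
        simp [h.fderiv_eq_zero hy, h.eq_zero hy])
    have h4 : Continuous fun y : E4 => κ * y i := by fun_prop
    exact (h.continuous_fderiv_shift x (continuous_flatFrame κ i)).neg.sub
      (h4.mul (h.continuous_shift x))
  have := integral_sub j2 j1
  rw [h1, h2, sub_zero] at this
  rw [← this]
  refine integral_congr_ae (ae_of_all _ fun y => ?_)
  simp only [commCoeff]
  ring

/-- The hypothesis says `flatDirac u = f` weakly. Differentiating `η * u` puts the derivative on `η`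
with coefficients frozen at `x`, while testing the weak equation puts them at `y`; the difference is
the commutator kernel. -/
theorem IsMollifier.flatDirac_mollify_sub (h : IsMollifier K ε η) (hβ : Continuous β)
    (hu : LocallyIntegrable u) (hf : LocallyIntegrable f)
    (hw : ∀ φ : E4 → Spinor, ContDiff ℝ ∞ φ → HasCompactSupport φ →
      ∫ x, inner ℂ (flatDiracAdjoint κ (β x) φ x) (u x) = ∫ x, inner ℂ (φ x) (f x)) (x : E4) :
    flatDirac κ (β x) (mollify η u) x - mollify η f x = ∫ y, commKernel κ β η x y (u y) := by
  set k : E4 → ℝ := fun y => η (x - y) with hk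
  have hkc : Continuous k := h.continuous_shift x
  have hks : HasCompactSupport k := hasCompactSupport_of_eq_zero fun y hy => h.eq_zero hy
  have hkd : ContDiff ℝ ∞ k := h.contDiff.comp (contDiff_const.sub contDiff_id)
  have hF := continuous_flatFrame κ
  have hcoord : ∀ i : Fin 4, Continuous fun y : E4 => y i := fun i => by fun_prop
  have hint : ∀ (k' : E4 → ℝ), Continuous k' → (∀ y, ε < ‖x - y‖ → k' y = 0) →
      ∀ T : Spinor →L[ℂ] Spinor, Integrable fun y => k' y • T (u y) := fun k' h1 h2 T =>
    integrable_smul_clm h1 (hasCompactSupport_of_eq_zero h2) hu T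
  have i1 := fun i => hint (fun y => fderiv ℝ η (x - y) (flatFrame κ i x))
    (h.continuous_fderiv_shift x continuous_const) (fun y hy => by simp [h.fderiv_eq_zero hy])
    (cliff i)
  have i2 := fun i => hint (fun y => (β x - κ) * x i * k y) (by fun_prop)
    (fun y hy => by simp [k, h.eq_zero hy]) (cliff i ∘L negProj)
  have i3 := fun i => hint (fun y => fderiv ℝ η (x - y) (flatFrame κ i y))
    (h.continuous_fderiv_shift x (hF i)) (fun y hy => by simp [h.fderiv_eq_zero hy]) (cliff i)
  have i4 := fun i => hint (fun y => (β y - κ) * y i * k y) (by fun_prop)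
    (fun y hy => by simp [k, h.eq_zero hy]) (cliff i ∘L negProj)
  have i5 := fun i => hint (fun y => κ * y i * k y) (by fun_prop)
    (fun y hy => by simp [k, h.eq_zero hy]) (cliff i)
  have iH : Integrable fun y => ∑ i, (fderiv ℝ η (x - y) (flatFrame κ i x) • cliff i (u y)
      + ((β x - κ) * x i * k y) • (cliff i ∘L negProj) (u y)) :=
    integrable_finsetSum _ fun i _ => (i1 i).add (i2 i)
  have iG : Integrable fun y => ∑ i, (fderiv ℝ η (x - y) (flatFrame κ i y) • cliff i (u y)
      + ((β y - κ) * y i * k y) • (cliff i ∘L negProj) (u y) + (κ * y i * k y) • cliff i (u y)) :=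
    integrable_finsetSum _ fun i _ => ((i3 i).add (i4 i)).add (i5 i)
  have e1 : flatDirac κ (β x) (mollify η u) x = ∫ y, ∑ i,
      (fderiv ℝ η (x - y) (flatFrame κ i x) • cliff i (u y)
      + ((β x - κ) * x i * k y) • (cliff i ∘L negProj) (u y)) := by
    rw [flatDirac_eq, integral_finsetSum]
    swap
    · exact fun i _ => (i1 i).add (i2 i)
    refine Finset.sum_congr rfl fun i _ => ?_
    rw [integral_add (i1 i) (i2 i)]
    congr 1
    · rw [h.fderiv_mollify hu, integral_smul_clm (h.continuous_fderiv_shift x continuous_const)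
        (hasCompactSupport_of_eq_zero (x := x) (ε := ε) fun y hy => by
          simp [h.fderiv_eq_zero hy]) hu]
    · simp only [mul_smul ((β x - κ) * x i)]
      rw [integral_smul, integral_smul_clm hkc hks hu]
      rfl
  have e2 : mollify η f x = ∫ y, ∑ i, (fderiv ℝ η (x - y) (flatFrame κ i y) • cliff i (u y)
      + ((β y - κ) * y i * k y) • (cliff i ∘L negProj) (u y)
      + (κ * y i * k y) • cliff i (u y)) := by
    refine ext_inner_left ℂ fun s => ?_
    rw [← integral_inner iG, mollify, ← integral_inner (integrable_smul_of_bound hkc hks hf)]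
    -- The weak equation is tested with the translated mollifier times an arbitrary constant spinor
    -- `s`.
    have := hw (fun y => k y • s) (hkd.smul contDiff_const) hks.smul_right
    calc ∫ y, inner ℂ s (k y • f y) = ∫ y, inner ℂ (k y • s) (f y) := by
          refine integral_congr_ae (ae_of_all _ fun y => ?_)
          simp only [← Complex.coe_smul, inner_smul_left, inner_smul_right, Complex.conj_ofReal]
      _ = _ := this.symm
      _ = _ := by
          refine integral_congr_ae (ae_of_all _ fun y => ?_)
          beta_reduce
          rw [inner_flatDiracAdjoint_smul κ (β y) (hkd.differentiable (by simp) y)]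
          congr 1
          refine Finset.sum_congr rfl fun i _ => ?_
          rw [h.fderiv_shift, neg_neg]
          rfl
  rw [e1, e2, ← integral_sub iH iG]
  refine integral_congr_ae (ae_of_all _ fun y => ?_)
  beta_reduce
  rw [← Finset.sum_sub_distrib, commKernel]
  refine Finset.sum_congr rfl fun i _ => ?_
  simp only [commCoeff, ContinuousLinearMap.comp_apply, k]
  module

theorem commKernel_zero (κ : ℝ) (β η : E4 → ℝ) (x y : E4) : commKernel κ β η x y 0 = 0 := by
  simp [commKernel]

/-- The frame has only locally bounded derivatives, so compact support of `u` is essential: the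
kernel is nonzero only for `‖x - y‖ ≤ ε ≤ 1`, hence `‖x‖ ≤ r + 1`. -/
theorem IsMollifier.enorm_integral_commKernel_le (h : IsMollifier K ε η) (hK : 0 ≤ K)
    (hκ : 0 ≤ κ) (hβ : ∀ x, |β x - κ| ≤ κ) (hε : ε ≤ 1) {r : ℝ} (hr : 0 ≤ r)
    (hu : ∀ y, r < ‖y‖ → u y = 0) (x : E4) :
    ‖∫ y, commKernel κ β η x y (u y)‖ₑ ≤
      ENNReal.ofReal (20 * K * κ * (r + 1)) * ballAvg ε (‖u ·‖ₑ) x := by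
  have hV : 0 ≤ volume.real (Metric.closedBall (0 : E4) ε) := measureReal_nonneg
  refine enorm_integral_le_ballAvg (k := fun x y => commKernel κ β η x y (u y)) (by positivity)
    h.pos (fun y => ?_) fun y hy => h.commKernel_eq_zero hy _
  by_cases hy : r < ‖y‖
  · simp only [hu y hy, commKernel_zero, norm_zero, mul_zero, le_refl]
  by_cases hxy : ε < ‖x - y‖
  · simp only [h.commKernel_eq_zero hxy, norm_zero]
    positivity
  · refine h.norm_commKernel_le hK hκ hβ ?_ (by linarith) _
    have : ‖x‖ ≤ ‖x - y‖ + ‖y‖ := by simpa using norm_add_le (x - y) y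
    linarith

theorem IsMollifier.enorm_mollify_le (h : IsMollifier K ε η) (hK : 0 ≤ K) (x : E4) :
    ‖mollify η u x‖ₑ ≤ ENNReal.ofReal K * ballAvg ε (‖u ·‖ₑ) x := by
  refine enorm_integral_le_ballAvg (k := fun x y => η (x - y) • u y) hK
    h.pos (fun y => ?_) fun y hy => by simp [h.eq_zero hy]
  rw [norm_smul]
  gcongr
  exact h.bound _

theorem IsMollifier.enorm_mollify_sub_le (h : IsMollifier K ε η) (hK : 0 ≤ K)
    (hu : LocallyIntegrable u) (x : E4) :
    ‖mollify η u x - u x‖ₑ ≤ ENNReal.ofReal K * ballAvg ε (fun y => ‖u y - u x‖ₑ) x := by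
  have hkc : Continuous fun y => η (x - y) := h.continuous_shift x
  have hks : HasCompactSupport fun y => η (x - y) :=
    hasCompactSupport_of_eq_zero fun y hy => h.eq_zero hy
  have e : mollify η u x - u x = mollify η (fun y => u y - u x) x := by
    simp only [mollify, smul_sub]
    rw [integral_sub (integrable_smul_of_bound hkc hks hu)
      ((hkc.integrable_of_hasCompactSupport hks).smul_const _), integral_smul_const,
      h.integral_shift, one_smul]
  rw [e]
  exact h.enorm_mollify_le hK x

/-- Since the kernel has integral zero, `u x` can be subtracted, and the bound tends to zero at
Lebesgue points. -/
theorem IsMollifier.enorm_integral_commCoeff_le (h : IsMollifier K ε η) (hK : 0 ≤ K)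
    (hκ : 0 ≤ κ) (hε : ε ≤ 1) (hu : LocallyIntegrable u) (i : Fin 4) (x : E4) :
    ‖∫ y, commCoeff κ η i x y • u y‖ₑ ≤
      ENNReal.ofReal (3 * K * κ * (‖x‖ + 1)) * ballAvg ε (fun y => ‖u y - u x‖ₑ) x := by
  have hkc := h.continuous_commCoeff (κ := κ) i x
  have hks : HasCompactSupport (commCoeff κ η i x) :=
    hasCompactSupport_of_eq_zero fun y hy => h.commCoeff_eq_zero hy i
  have hV : 0 ≤ volume.real (Metric.closedBall (0 : E4) ε) := measureReal_nonneg
  have e : ∫ y, commCoeff κ η i x y • u y = ∫ y, commCoeff κ η i x y • (u y - u x) := by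
    simp only [smul_sub]
    rw [integral_sub (integrable_smul_of_bound hkc hks hu)
      ((hkc.integrable_of_hasCompactSupport hks).smul_const _), integral_smul_const,
      h.integral_commCoeff, zero_smul, sub_zero]
  rw [e]
  refine enorm_integral_le_ballAvg (k := fun x' y => commCoeff κ η i x' y • (u y - u x))
    (by positivity) h.pos (fun y => ?_) fun y hy => by rw [h.commCoeff_eq_zero hy, zero_smul]
  rw [norm_smul]
  by_cases hxy : ε < ‖x - y‖
  · simp only [h.commCoeff_eq_zero hxy, norm_zero, zero_mul]
    positivity
  · refine mul_le_mul_of_nonneg_right (h.abs_commCoeff_le hK hκ i (by linarith) ?_) (norm_nonneg _)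
    have : ‖y‖ ≤ ‖y - x‖ + ‖x‖ := by simpa using norm_add_le (y - x) x
    rw [norm_sub_rev] at this
    linarith

theorem IsMollifier.integral_commKernel (h : IsMollifier K ε η) (hβ : Continuous β)
    (hu : LocallyIntegrable u) (x : E4) :
    ∫ y, commKernel κ β η x y (u y) = ∑ i, (cliff i (∫ y, commCoeff κ η i x y • u y)
      + ((β x - κ) * x i) • cliff i (negProj (mollify η u x))
      - cliff i (negProj (mollify η (fun y => ((β y - κ) * y i) • u y) x))) := by
  have hkc : Continuous fun y => η (x - y) := h.continuous_shift x
  have hks : HasCompactSupport fun y => η (x - y) :=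
    hasCompactSupport_of_eq_zero fun y hy => h.eq_zero hy
  have hp : ∀ i, Continuous fun y : E4 => (β y - κ) * y i := fun i => by fun_prop
  have hcs : ∀ i, HasCompactSupport (commCoeff κ η i x) := fun i =>
    hasCompactSupport_of_eq_zero fun y hy => h.commCoeff_eq_zero hy i
  have hcc : ∀ i, Continuous (commCoeff κ η i x) := fun i => h.continuous_commCoeff (κ := κ) i x
  have i1 := fun i => integrable_smul_clm (hcc i) (hcs i) hu (cliff i)
  have i2 : ∀ i, Integrable fun y => ((β x - κ) * x i) • η (x - y) • (cliff i ∘L negProj) (u y) :=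
    fun i => (integrable_smul_clm hkc hks hu (cliff i ∘L negProj)).smul ((β x - κ) * x i)
  have i12 : ∀ i, Integrable fun y => commCoeff κ η i x y • cliff i (u y)
      + ((β x - κ) * x i) • η (x - y) • (cliff i ∘L negProj) (u y) := fun i => (i1 i).add (i2 i)
  have hpc : ∀ i, Continuous fun y : E4 => η (x - y) * ((β y - κ) * y i) := fun i =>
    hkc.mul (hp i)
  have hps : ∀ i : Fin 4, HasCompactSupport fun y : E4 => η (x - y) * ((β y - κ) * y i) :=
    fun i => hks.mul_right
  have i3 := fun i => integrable_smul_clm (hpc i) (hps i) hu (cliff i ∘L negProj)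
  calc ∫ y, commKernel κ β η x y (u y) = ∫ y, ∑ i, (commCoeff κ η i x y • cliff i (u y)
        + ((β x - κ) * x i) • η (x - y) • (cliff i ∘L negProj) (u y)
        - (η (x - y) * ((β y - κ) * y i)) • (cliff i ∘L negProj) (u y)) := by
        refine integral_congr_ae (ae_of_all _ fun y => ?_)
        beta_reduce
        rw [commKernel]
        refine Finset.sum_congr rfl fun i _ => ?_
        simp only [ContinuousLinearMap.comp_apply]
        module
    _ = _ := by
        rw [integral_finsetSum]
        swap
        · exact fun i _ => (i12 i).sub (i3 i)
        refine Finset.sum_congr rfl fun i _ => ?_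
        rw [integral_sub (i12 i) (i3 i), integral_add (i1 i) (i2 i),
          integral_smul_clm (hcc i) (hcs i) hu, integral_smul, integral_smul_clm hkc hks hu,
          integral_smul_clm (hpc i) (hps i) hu]
        simp only [mollify, mul_smul, ContinuousLinearMap.comp_apply]

end

section

open Filter

variable {K κ : ℝ} {ε : ℕ → ℝ} {η : ℕ → E4 → ℝ} {β : E4 → ℝ} {u f : E4 → Spinor}

theorem ae_tendsto_mollify (h : ∀ n, IsMollifier K (ε n) (η n)) (hK : 0 ≤ K)
    (hε : Tendsto ε atTop (nhdsWithin 0 (Set.Ioi 0))) (hu : LocallyIntegrable u) :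
    ∀ᵐ x, Tendsto (fun n => mollify (η n) u x) atTop (nhds (u x)) := by
  filter_upwards [ae_tendsto_ballAvg_sub hε hu] with x hx
  rw [tendsto_iff_edist_tendsto_0]
  have h0 := ENNReal.Tendsto.const_mul (a := ENNReal.ofReal K) hx (Or.inr ENNReal.ofReal_ne_top)
  rw [mul_zero] at h0
  refine tendsto_of_tendsto_of_tendsto_of_le_of_le tendsto_const_nhds h0 (fun _ => zero_le)
    fun n => ?_
  rw [edist_eq_enorm_sub]
  exact (h n).enorm_mollify_sub_le hK hu x

/-- The first-order part vanishes at Lebesgue points. In the zeroth-order part, multiplying by `(β -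
κ)x_i` before or after mollifying gives the same limit. -/
theorem ae_tendsto_integral_commKernel (h : ∀ n, IsMollifier K (ε n) (η n)) (hK : 0 ≤ K)
    (hκ : 0 ≤ κ) (hε1 : ∀ n, ε n ≤ 1) (hβ : Continuous β)
    (hε : Tendsto ε atTop (nhdsWithin 0 (Set.Ioi 0))) (hu : LocallyIntegrable u) :
    ∀ᵐ x, Tendsto (fun n => ∫ y, commKernel κ β (η n) x y (u y)) atTop (nhds 0) := by
  have hp : ∀ i, LocallyIntegrable fun y : E4 => ((β y - κ) * y i) • u y := fun i =>
    hu.continuous_smul (by fun_prop)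
  filter_upwards [ae_tendsto_ballAvg_sub hε hu, ae_tendsto_mollify h hK hε hu,
    ae_all_iff.2 fun i => ae_tendsto_mollify h hK hε (hp i)] with x h1 h2 h3
  simp only [(h _).integral_commKernel hβ hu]
  have h4 : ∀ i, Tendsto (fun n => ∫ y, commCoeff κ (η n) i x y • u y) atTop (nhds 0) := by
    intro i
    rw [tendsto_zero_iff_enorm_tendsto_zero]
    have h0 := ENNReal.Tendsto.const_mul (a := ENNReal.ofReal (3 * K * κ * (‖x‖ + 1))) h1
      (Or.inr ENNReal.ofReal_ne_top)
    rw [mul_zero] at h0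
    exact tendsto_of_tendsto_of_tendsto_of_le_of_le tendsto_const_nhds h0 (fun _ => zero_le)
      fun n => (h n).enorm_integral_commCoeff_le hK hκ (hε1 n) hu i x
  have h5 := tendsto_finsetSum Finset.univ fun i _ =>
    ((((cliff i).continuous.tendsto _).comp (h4 i)).add
      ((((cliff i ∘L negProj).continuous.tendsto _).comp h2).const_smul ((β x - κ) * x i))).sub
      (((cliff i ∘L negProj).continuous.tendsto _).comp (h3 i))
  convert h5 using 2
  · rfl
  · refine (Finset.sum_eq_zero fun i _ => ?_).symm
    rw [map_zero, zero_add, ContinuousLinearMap.map_smul_of_tower, sub_self]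

end

end TaubNUT

namespace TaubNUT

/-! ### Hardy's inequality for weak solutions -/

theorem ofReal_norm_sq (z : Spinor) : ENNReal.ofReal (‖z‖ ^ 2) = ‖z‖ₑ ^ 2 := by
  rw [ENNReal.ofReal_pow (norm_nonneg _), ofReal_norm]

theorem enorm_add_sq_le (p q : Spinor) : ‖p + q‖ₑ ^ 2 ≤ 2 * ‖p‖ₑ ^ 2 + 2 * ‖q‖ₑ ^ 2 := by
  simp only [← ofReal_norm_sq]
  calc ENNReal.ofReal (‖p + q‖ ^ 2) ≤ ENNReal.ofReal (2 * ‖p‖ ^ 2 + 2 * ‖q‖ ^ 2) := by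
        refine ENNReal.ofReal_le_ofReal ?_
        have h := norm_add_le p q
        nlinarith [sq_nonneg (‖p‖ - ‖q‖), norm_nonneg (p + q)]
    _ = _ := by
        rw [ENNReal.ofReal_add (by positivity) (by positivity), ENNReal.ofReal_mul zero_le_two,
          ENNReal.ofReal_mul zero_le_two, ENNReal.ofReal_ofNat]

theorem abs_conformal_sub_le {a b : ℝ} (ha : 0 < a) (hb : 0 < b) (x : E4) :
    |b / (a + b * ‖x‖ ^ 2) - b / a| ≤ b / a := by
  have h1 : b / (a + b * ‖x‖ ^ 2) ≤ b / a := by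
    gcongr
    nlinarith [sq_nonneg ‖x‖]
  have h2 : 0 ≤ b / (a + b * ‖x‖ ^ 2) := by positivity
  rw [abs_le]
  constructor <;> linarith

-- `hardy_dirac` is applied to the mollifications `η_n * u`, whose `flatDirac` is `η_n * f` plus a
-- commutator tending to `0` in `L²`. Fatou then passes to the limit on the left.
open Filter in
theorem hardy_weak {a b : ℝ} (ha : 0 < a) (hb : 0 < b) : ∃ C : ENNReal, C ≠ ⊤ ∧
    ∀ u f : E4 → Spinor, MemLp u 2 → HasCompactSupport u → MemLp f 2 →
      (∀ φ : E4 → Spinor, ContDiff ℝ ∞ φ → HasCompactSupport φ →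
        ∫ x, inner ℂ (flatDiracAdjoint (b / a) (b / (a + b * ‖x‖ ^ 2)) φ x) (u x)
          = ∫ x, inner ℂ (φ x) (f x)) →
      ∫⁻ x, ENNReal.ofReal (‖u x‖ ^ 2 / (1 + ‖x‖ ^ 2)) ≤ C * ∫⁻ x, ‖f x‖ₑ ^ 2 := by
  obtain ⟨K, hK, hη⟩ := exists_isMollifier
  -- The `2` comes from `|p + q|² ≤ 2|p|² + 2|q|²`, and `K²` from the `L²` bound on mollification.
  refine ⟨2 * ENNReal.ofReal K ^ 2, by finiteness, fun u f hu huc hf hw => ?_⟩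
  have hκ : 0 ≤ b / a := by positivity
  have hβ : Continuous fun x : E4 => b / (a + b * ‖x‖ ^ 2) :=
    continuous_const.div (by fun_prop) fun x => (conformal_pos ha hb x).ne'
  have hβ' := abs_conformal_sub_le ha hb
  have hul := hu.locallyIntegrable one_le_two
  have hfl := hf.locallyIntegrable one_le_two
  set ε : ℕ → ℝ := fun n => 1 / ((n : ℝ) + 1) with hεdef
  have hε : ∀ n, 0 < ε n := fun n => by positivity
  have hε1 : ∀ n, ε n ≤ 1 := fun n => by
    rw [hεdef]
    exact div_le_one_of_le₀ (by simp) (by positivity)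
  have hε0 : Tendsto ε atTop (nhds 0) := tendsto_one_div_add_atTop_nhds_zero_nat
  have hε2 : Tendsto ε atTop (nhdsWithin 0 (Set.Ioi 0)) :=
    tendsto_nhdsWithin_iff.2 ⟨hε0, Eventually.of_forall hε⟩
  choose η h using fun n => hη (ε n) (hε n)
  obtain ⟨r, hr, hur⟩ := huc.isCompact.isBounded.exists_pos_norm_le
  have hu0 : ∀ y, r < ‖y‖ → u y = 0 := fun y hy =>
    image_eq_zero_of_notMem_tsupport fun hm => absurd (hur y hm) (not_le.2 hy)
  set R : ℕ → E4 → Spinor := fun n x =>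
    ∫ y, commKernel (b / a) (fun x => b / (a + b * ‖x‖ ^ 2)) (η n) x y (u y) with hR
  have hcomm : ∀ n x, flatDirac (b / a) (b / (a + b * ‖x‖ ^ 2)) (mollify (η n) u) x
      = R n x + mollify (η n) f x := fun n x =>
    sub_eq_iff_eq_add.1 ((h n).flatDirac_mollify_sub hβ hul hfl hw x)
  have hRc : ∀ n, AEStronglyMeasurable (R n) := by
    intro n
    have : R n = fun x => flatDirac (b / a) (b / (a + b * ‖x‖ ^ 2)) (mollify (η n) u) x
        - mollify (η n) f x := by
      ext1 x
      rw [hcomm, add_sub_cancel_right]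
    rw [this]
    exact ((continuous_flatDirac ha hb ((h n).contDiff_mollify hul)).sub
      ((h n).contDiff_mollify hfl).continuous).aestronglyMeasurable
  have hR0 : Tendsto (fun n => ∫⁻ x, ‖R n x‖ₑ ^ 2) atTop (nhds 0) := by
    refine tendsto_lintegral_sq_zero hε hε0 hRc hu (ENNReal.ofReal (20 * K * (b / a) * (r + 1)))
      ENNReal.ofReal_ne_top
      (fun n x => (h n).enorm_integral_commKernel_le hK hκ hβ' (hε1 n) hr.le hu0 x) ?_
    filter_upwards [ae_tendsto_integral_commKernel h hK hκ hε1 hβ hε2 hul] with x hx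
    exact tendsto_zero_iff_enorm_tendsto_zero.1 hx
  have hfn : ∀ n, ∫⁻ x, ‖mollify (η n) f x‖ₑ ^ 2 ≤ ENNReal.ofReal K ^ 2 * ∫⁻ x, ‖f x‖ₑ ^ 2 :=
    fun n => lintegral_sq_le_of_le_ballAvg (hε n) hf.1 _ fun x => (h n).enorm_mollify_le hK x
  have hbound : ∀ n, ∫⁻ x, ENNReal.ofReal (‖mollify (η n) u x‖ ^ 2 / (1 + ‖x‖ ^ 2)) ≤
      2 * (∫⁻ x, ‖R n x‖ₑ ^ 2) + 2 * ENNReal.ofReal K ^ 2 * ∫⁻ x, ‖f x‖ₑ ^ 2 := by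
    intro n
    calc _ ≤ ∫⁻ x, ENNReal.ofReal
          (‖flatDirac (b / a) (b / (a + b * ‖x‖ ^ 2)) (mollify (η n) u) x‖ ^ 2) :=
          hardy_dirac ha hb ((h n).contDiff_mollify hul) ((h n).hasCompactSupport_mollify huc)
      _ ≤ ∫⁻ x, (2 * ‖R n x‖ₑ ^ 2 + 2 * ‖mollify (η n) f x‖ₑ ^ 2) := by
          refine lintegral_mono fun x => ?_
          rw [ofReal_norm_sq, hcomm]
          exact enorm_add_sq_le _ _
      _ = 2 * (∫⁻ x, ‖R n x‖ₑ ^ 2) + 2 * ∫⁻ x, ‖mollify (η n) f x‖ₑ ^ 2 := by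
          rw [lintegral_add_left' (((hRc n).enorm.pow_const 2).const_mul 2),
            lintegral_const_mul' _ _ ENNReal.ofNat_ne_top,
            lintegral_const_mul' _ _ ENNReal.ofNat_ne_top]
      _ ≤ _ := by
          rw [mul_assoc 2 (ENNReal.ofReal K ^ 2)]
          gcongr
          exact hfn n
  have hlim : Tendsto (fun n => 2 * (∫⁻ x, ‖R n x‖ₑ ^ 2)
      + 2 * ENNReal.ofReal K ^ 2 * ∫⁻ x, ‖f x‖ₑ ^ 2) atTop
      (nhds (2 * ENNReal.ofReal K ^ 2 * ∫⁻ x, ‖f x‖ₑ ^ 2)) := by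
    have := (ENNReal.Tendsto.const_mul (a := 2) hR0 (Or.inr ENNReal.ofNat_ne_top)).add_const
      (2 * ENNReal.ofReal K ^ 2 * ∫⁻ x, ‖f x‖ₑ ^ 2)
    rwa [mul_zero, zero_add] at this
  calc ∫⁻ x, ENNReal.ofReal (‖u x‖ ^ 2 / (1 + ‖x‖ ^ 2))
      = ∫⁻ x, liminf (fun n => ENNReal.ofReal (‖mollify (η n) u x‖ ^ 2 / (1 + ‖x‖ ^ 2))) atTop := by
        refine lintegral_congr_ae ?_
        filter_upwards [ae_tendsto_mollify h hK hε2 hul] with x hx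
        exact ((ENNReal.continuous_ofReal.tendsto _).comp
          ((hx.norm.pow 2).div_const (1 + ‖x‖ ^ 2))).liminf_eq.symm
    _ ≤ liminf (fun n => ∫⁻ x, ENNReal.ofReal (‖mollify (η n) u x‖ ^ 2 / (1 + ‖x‖ ^ 2))) atTop := by
        refine lintegral_liminf_le fun n => ?_
        have := ((h n).contDiff_mollify hul).continuous
        exact (ENNReal.continuous_ofReal.comp ((this.norm.pow 2).div (by fun_prop)
          fun x => by positivity)).measurable
    _ ≤ liminf (fun n => 2 * (∫⁻ x, ‖R n x‖ₑ ^ 2)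
      + 2 * ENNReal.ofReal K ^ 2 * ∫⁻ x, ‖f x‖ₑ ^ 2) atTop :=
        liminf_le_liminf (Eventually.of_forall hbound)
    _ = _ := hlim.liminf_eq

end TaubNUT

namespace TaubNUT

/-! ### Cutoffs -/

theorem flatDirac_smul (κ β : ℝ) {s : E4 → ℝ} {φ : E4 → Spinor} {x : E4}
    (hs : DifferentiableAt ℝ s x) (hφ : DifferentiableAt ℝ φ x) :
    flatDirac κ β (fun y => s y • φ y) x = s x • flatDirac κ β φ x
      + ∑ i, fderiv ℝ s x (flatFrame κ i x) • cliff i (φ x) := by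
  have h : ∀ v, fderiv ℝ (fun y => s y • φ y) x v = s x • fderiv ℝ φ x v + fderiv ℝ s x v • φ x := by
    intro v
    rw [fderiv_fun_smul hs hφ]
    simp
  rw [flatDirac_eq, flatDirac_eq, Finset.smul_sum, ← Finset.sum_add_distrib]
  refine Finset.sum_congr rfl fun i _ => ?_
  rw [h, map_add, ContinuousLinearMap.map_smul_of_tower, ContinuousLinearMap.map_smul_of_tower,
    ContinuousLinearMap.map_smul_of_tower, ContinuousLinearMap.map_smul_of_tower]
  module

theorem flatDiracAdjoint_smul (κ β : ℝ) {s : E4 → ℝ} {φ : E4 → Spinor} {x : E4}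
    (hs : DifferentiableAt ℝ s x) (hφ : DifferentiableAt ℝ φ x) :
    flatDiracAdjoint κ β (fun y => s y • φ y) x = s x • flatDiracAdjoint κ β φ x
      + ∑ i, fderiv ℝ s x (flatFrame κ i x) • cliff i (φ x) := by
  rw [flatDiracAdjoint, flatDirac_smul κ β hs hφ, flatDiracAdjoint]
  simp only [ContinuousLinearMap.map_smul_of_tower, smul_comm _ (s x), ← Finset.smul_sum]
  module

/-! ### Radial functions and the passage from the Riemannian to the Lebesgue weak equation. -/

theorem inner_self_flatFrame (κ : ℝ) (i : Fin 4) (x : E4) : inner ℝ x (flatFrame κ i x) = x i := by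
  rw [flatFrame, inner_add_right, inner_smul_right, inner_self_hopf,
    EuclideanSpace.inner_single_right]
  simp

theorem hasFDerivAt_radial {g : ℝ → ℝ} {g' : ℝ} {x : E4} (hg : HasDerivAt g g' (‖x‖ ^ 2)) :
    HasFDerivAt (fun y : E4 => g (‖y‖ ^ 2)) (g' • (2 : ℝ) • innerSL ℝ x) x := by
  have h1 : HasFDerivAt (fun y : E4 => ‖y‖ ^ 2) ((2 : ℝ) • innerSL ℝ x) x := by
    rw [ofNat_smul_eq_nsmul]
    exact (hasStrictFDerivAt_norm_sq x).hasFDerivAt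
  exact hg.comp_hasFDerivAt x h1

theorem fderiv_radial {g : ℝ → ℝ} {g' : ℝ} {x : E4} (hg : HasDerivAt g g' (‖x‖ ^ 2)) (κ : ℝ)
    (i : Fin 4) : fderiv ℝ (fun y : E4 => g (‖y‖ ^ 2)) x (flatFrame κ i x) = 2 * g' * x i := by
  rw [(hasFDerivAt_radial hg).fderiv]
  simp only [_root_.smul_apply, innerSL_apply_apply, inner_self_flatFrame, smul_eq_mul]
  ring

theorem hasDerivAt_inv_sqrt {c : ℝ} {b t : ℝ} (hm : 0 < c + b * t) :
    HasDerivAt (fun t : ℝ => (√(c + b * t))⁻¹)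
      (-(b / (2 * (c + b * t)) * (√(c + b * t))⁻¹)) t := by
  have hr : 0 < √(c + b * t) := Real.sqrt_pos.2 hm
  have h := ((((hasDerivAt_id t).const_mul b).const_add c).sqrt hm.ne').inv hr.ne'
  refine h.congr_deriv ?_
  have hrr : √(c + b * t) ^ 2 = c + b * t := Real.sq_sqrt hm.le
  simp only [id, mul_one]
  rw [hrr]
  field_simp

theorem contDiff_inv_sqrt_conformal {a b : ℝ} (ha : 0 < a) (hb : 0 < b) :
    ContDiff ℝ ∞ fun x : E4 => (√(a + b * ‖x‖ ^ 2))⁻¹ := by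
  have hm : ∀ x : E4, 0 < a + b * ‖x‖ ^ 2 := conformal_pos ha hb
  have h1 : ContDiff ℝ ∞ fun x : E4 => a + b * ‖x‖ ^ 2 :=
    contDiff_const.add (contDiff_const.mul (contDiff_norm_sq ℝ))
  exact (h1.sqrt fun x => (hm x).ne').inv fun x => (Real.sqrt_pos.2 (hm x)).ne'

/-- Rescaling the test spinor by `m^{-1/2}` turns `D` into the Lebesgue adjoint of `flatDirac`. The
prefactor `1/(2m)` then cancels against the volume density `16am`, leaving the constant `8a`. -/
theorem dirac_inv_sqrt_smul {a b : ℝ} (ha : 0 < a) (hb : 0 < b) {φ : E4 → Spinor}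
    (hφ : ContDiff ℝ ∞ φ) (x : E4) :
    (taubNUTFrame a b ha hb).dirac (fun y => (√(a + b * ‖y‖ ^ 2))⁻¹ • φ y) x
      = ((1 / (2 * (a + b * ‖x‖ ^ 2)) : ℝ) : ℂ) •
        flatDiracAdjoint (b / a) (b / (a + b * ‖x‖ ^ 2)) φ x := by
  have hm := conformal_pos ha hb x
  have hd := fderiv_radial (hasDerivAt_inv_sqrt hm) (b / a)
  have hrr : √(a + b * ‖x‖ ^ 2) ^ 2 = a + b * ‖x‖ ^ 2 := Real.sq_sqrt hm.le
  rw [dirac_taubNUT, flatDirac_smul _ _ ((contDiff_inv_sqrt_conformal ha hb).differentiable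
    (by simp) x) (hφ.differentiable (by simp) x), flatDiracAdjoint]
  simp only [hd]
  generalize flatDirac (b / a) (b / (a + b * ‖x‖ ^ 2)) φ x = d
  have e : ∀ m q : ℝ, 0 < m → q ^ 2 = m → 1 / (2 * m) = 1 / (2 * q) * q⁻¹ := by
    intro m q h1 h2
    rw [← h2]
    field_simp
  rw [e _ _ hm hrr]
  generalize (√(a + b * ‖x‖ ^ 2)) = q
  generalize ha' : a + b * ‖x‖ ^ 2 = m at hm
  have e2 : ∑ i, (2 * -(b / (2 * m) * q⁻¹) * x i) • cliff i (φ x)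
      = -(q⁻¹ * (b / m)) • ∑ i, x i • cliff i (φ x) := by
    rw [Finset.smul_sum]
    refine Finset.sum_congr rfl fun i _ => ?_
    rw [smul_smul]
    congr 1
    field_simp
  rw [e2, Complex.coe_smul, Complex.coe_smul]
  module

theorem integral_vol {a b : ℝ} (ha : 0 < a) (hb : 0 < b) (F : E4 → ℂ) :
    ∫ x, F x ∂(taubNUT a b ha hb).vol = ∫ x, ((16 * a * (a + b * ‖x‖ ^ 2) : ℝ) : ℂ) * F x := by
  rw [vol_taubNUT, integral_withDensity_eq_integral_toReal_smul (by fun_prop)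
    (ae_of_all _ fun x => ENNReal.ofReal_lt_top)]
  refine integral_congr_ae (ae_of_all _ fun x => ?_)
  have h := conformal_pos ha hb x
  beta_reduce
  rw [ENNReal.toReal_ofReal (by positivity), Complex.real_smul]

/-- The weak equation, tested against Lebesgue measure. -/
theorem integral_flatDiracAdjoint {a b : ℝ} (ha : 0 < a) (hb : 0 < b) {ψ : E4 → Spinor}
    (hψ : (taubNUTFrame a b ha hb).IsWeakSolution ψ) {φ : E4 → Spinor} (hφ : ContDiff ℝ ∞ φ)
    (hc : HasCompactSupport φ) :
    ∫ x, inner ℂ (flatDiracAdjoint (b / a) (b / (a + b * ‖x‖ ^ 2)) φ x) (ψ x) = 0 := by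
  have h1 : ContDiff ℝ ∞ fun y : E4 => (√(a + b * ‖y‖ ^ 2))⁻¹ • φ y :=
    ContDiff.smul (f := fun y : E4 => (√(a + b * ‖y‖ ^ 2))⁻¹)
      (contDiff_inv_sqrt_conformal ha hb) hφ
  have h0 : HasCompactSupport fun y : E4 => (√(a + b * ‖y‖ ^ 2))⁻¹ • φ y :=
    hc.smul_left (f := fun y : E4 => (√(a + b * ‖y‖ ^ 2))⁻¹)
  have h := hψ _ h1 h0
  rw [integral_vol] at h
  have h2 : ∀ x, ((16 * a * (a + b * ‖x‖ ^ 2) : ℝ) : ℂ) *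
      inner ℂ ((taubNUTFrame a b ha hb).dirac (fun y => (√(a + b * ‖y‖ ^ 2))⁻¹ • φ y) x) (ψ x)
      = ((8 * a : ℝ) : ℂ) *
        inner ℂ (flatDiracAdjoint (b / a) (b / (a + b * ‖x‖ ^ 2)) φ x) (ψ x) := by
    intro x
    have h3 := conformal_pos ha hb x
    rw [dirac_inv_sqrt_smul ha hb hφ, inner_smul_left, Complex.conj_ofReal, ← mul_assoc,
      ← Complex.ofReal_mul]
    congr 2
    field_simp
    norm_num
  simp only [h2] at h
  rw [integral_const_mul] at h
  have h4 : ((8 * a : ℝ) : ℂ) ≠ 0 := Complex.ofReal_ne_zero.2 (by positivity)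
  exact (mul_eq_zero.1 h).resolve_left h4

/-- A smooth radial cutoff at scale `R`. -/
noncomputable def cutoff (R : ℝ) (x : E4) : ℝ := Real.smoothTransition (2 - ‖x‖ ^ 2 / R ^ 2)

theorem contDiff_cutoff (R : ℝ) : ContDiff ℝ ∞ (cutoff R) :=
  Real.smoothTransition.contDiff.comp
    (contDiff_const.sub ((contDiff_norm_sq ℝ).div_const _))

theorem cutoff_eq_one {R : ℝ} (hR : 0 < R) {x : E4} (hx : ‖x‖ ≤ R) : cutoff R x = 1 := by
  refine Real.smoothTransition.one_of_one_le ?_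
  have : ‖x‖ ^ 2 / R ^ 2 ≤ 1 := div_le_one_of_le₀ (by gcongr) (by positivity)
  linarith

theorem cutoff_eq_zero {R : ℝ} (hR : 0 < R) {x : E4} (hx : 2 * R < ‖x‖) : cutoff R x = 0 := by
  refine Real.smoothTransition.zero_of_nonpos ?_
  have : 2 ≤ ‖x‖ ^ 2 / R ^ 2 := by
    rw [le_div_iff₀ (by positivity)]
    nlinarith
  linarith

theorem hasCompactSupport_cutoff {R : ℝ} (hR : 0 < R) : HasCompactSupport (cutoff R) :=
  HasCompactSupport.intro (isCompact_closedBall 0 (2 * R)) fun x hx =>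
    cutoff_eq_zero hR (by rwa [mem_closedBall_zero_iff, not_le] at hx)

/-- The argument `2 - ‖x‖²/R²` of the cutoff never exceeds `2`, and the derivative vanishes on
negative arguments, so compactness of `[0, 2]` suffices. -/
theorem exists_deriv_smoothTransition_le : ∃ M : ℝ, 0 ≤ M ∧ ∀ t ≤ 2,
    |deriv Real.smoothTransition t| ≤ M := by
  have h1 : Continuous (deriv Real.smoothTransition) :=
    (Real.smoothTransition.contDiff (n := 1)).continuous_deriv le_rfl
  obtain ⟨M, hM⟩ := (isCompact_Icc (a := (0 : ℝ)) (b := 2)).exists_bound_of_continuousOn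
    h1.continuousOn
  have hM0 : 0 ≤ M := (norm_nonneg _).trans (hM 0 (by simp))
  refine ⟨M, hM0, fun t ht => ?_⟩
  rcases lt_or_ge t 0 with h0 | h0
  · have h2 : Real.smoothTransition =ᶠ[nhds t] fun _ => 0 := by
      filter_upwards [Iio_mem_nhds h0] with s hs
      exact Real.smoothTransition.zero_of_nonpos (le_of_lt hs)
    rw [h2.deriv_eq, deriv_const, abs_zero]
    exact hM0
  · exact hM t ⟨h0, ht⟩

/-- Half the radial derivative of the cutoff, over `‖x‖`. -/
noncomputable def cutoffDeriv (R : ℝ) (x : E4) : ℝ :=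
  -(deriv Real.smoothTransition (2 - ‖x‖ ^ 2 / R ^ 2) / R ^ 2)

theorem fderiv_cutoff (κ R : ℝ) (i : Fin 4) (x : E4) :
    fderiv ℝ (cutoff R) x (flatFrame κ i x) = 2 * cutoffDeriv R x * x i := by
  have h1 : HasDerivAt (fun t : ℝ => 2 - t / R ^ 2) (-(1 / R ^ 2)) (‖x‖ ^ 2) :=
    ((hasDerivAt_id _).div_const _).const_sub 2
  have h2 := (((Real.smoothTransition.contDiff (n := 1)).differentiable one_ne_zero)
    (2 - ‖x‖ ^ 2 / R ^ 2)).hasDerivAt.comp (‖x‖ ^ 2) h1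
  have h3 := fderiv_radial h2 κ i
  refine Eq.trans ?_ (h3.trans ?_)
  · rfl
  · rw [cutoffDeriv]
    ring

theorem continuous_cutoffDeriv (R : ℝ) : Continuous (cutoffDeriv R) := by
  have h1 : Continuous (deriv Real.smoothTransition) :=
    (Real.smoothTransition.contDiff (n := 1)).continuous_deriv le_rfl
  exact ((h1.comp (by fun_prop)).div_const _).neg

theorem cutoffDeriv_eq_zero {R : ℝ} (hR : 0 < R) {x : E4} (hx : 2 * R < ‖x‖) :
    cutoffDeriv R x = 0 := by
  have h0 : 2 - ‖x‖ ^ 2 / R ^ 2 < 0 := by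
    have : 2 < ‖x‖ ^ 2 / R ^ 2 := by
      rw [lt_div_iff₀ (by positivity)]
      nlinarith
    linarith
  have h2 : Real.smoothTransition =ᶠ[nhds (2 - ‖x‖ ^ 2 / R ^ 2)] fun _ => 0 := by
    filter_upwards [Iio_mem_nhds h0] with s hs
    exact Real.smoothTransition.zero_of_nonpos (le_of_lt hs)
  rw [cutoffDeriv, h2.deriv_eq, deriv_const, zero_div, neg_zero]

/-- On the support `|x_i| ≤ 2R`, so each of the four directions contributes at most `2 · (M/R²) ·
2R`. -/
theorem norm_cutoffDeriv_smul_le {R M : ℝ} (hR : 0 < R) (hM0 : 0 ≤ M)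
    (hM : ∀ t ≤ 2, |deriv Real.smoothTransition t| ≤ M) (x : E4) (s : Spinor) :
    ‖∑ i, (2 * cutoffDeriv R x * x i) • cliff i s‖ ≤ 16 * M / R * ‖s‖ := by
  rcases lt_or_ge (2 * R) ‖x‖ with hx | hx
  · simp only [cutoffDeriv_eq_zero hR hx, mul_zero, zero_mul, zero_smul, Finset.sum_const_zero,
      norm_zero]
    positivity
  · have h1 : |cutoffDeriv R x| ≤ M / R ^ 2 := by
      rw [cutoffDeriv, abs_neg, abs_div, abs_of_pos (by positivity : 0 < R ^ 2)]
      gcongr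
      refine hM _ ?_
      have : 0 ≤ ‖x‖ ^ 2 / R ^ 2 := by positivity
      linarith
    calc _ ≤ ∑ _i : Fin 4, 2 * (M / R ^ 2) * (2 * R) * ‖s‖ := by
          refine norm_sum_le_of_le _ fun i _ => ?_
          rw [norm_smul, norm_cliff, norm_mul, norm_mul, Real.norm_ofNat]
          gcongr
          · exact h1
          · exact (PiLp.norm_apply_le x i).trans hx
      _ = _ := by
          rw [Finset.sum_const, Finset.card_univ, Fintype.card_fin, nsmul_eq_mul]
          field_simp
          ring

theorem cutoff_mem_Icc (R : ℝ) (x : E4) : cutoff R x ∈ Set.Icc 0 1 :=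
  ⟨Real.smoothTransition.nonneg _, Real.smoothTransition.le_one _⟩

theorem memLp_cutoff_smul (R : ℝ) {ψ : E4 → Spinor} (hψ : MemLp ψ 2) :
    MemLp (fun x => cutoff R x • ψ x) 2 := by
  have hm : AEStronglyMeasurable (cutoff R) volume :=
    (contDiff_cutoff R).continuous.aestronglyMeasurable
  refine hψ.of_le_mul (c := 1) (hm.smul hψ.1)
    (ae_of_all _ fun x => ?_)
  rw [norm_smul, Real.norm_of_nonneg (cutoff_mem_Icc R x).1]
  gcongr
  exact (cutoff_mem_Icc R x).2

theorem memLp_cutoffDeriv_smul {R : ℝ} (hR : 0 < R) {ψ : E4 → Spinor} (hψ : MemLp ψ 2) :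
    MemLp (fun x => ∑ i, (2 * cutoffDeriv R x * x i) • cliff i (ψ x)) 2 := by
  obtain ⟨M, hM0, hM⟩ := exists_deriv_smoothTransition_le
  refine hψ.of_le_mul (c := 16 * M / R) ?_
    (ae_of_all _ fun x => norm_cutoffDeriv_smul_le hR hM0 hM x (ψ x))
  refine Finset.aestronglyMeasurable_fun_sum _ fun i _ => ?_
  have h1 := continuous_cutoffDeriv R
  have h2 : Continuous fun x : E4 => 2 * cutoffDeriv R x * x i := by fun_prop
  exact h2.aestronglyMeasurable.smul ((cliff i).continuous.comp_aestronglyMeasurable hψ.1)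

theorem memLp_flatDiracAdjoint {a b : ℝ} (ha : 0 < a) (hb : 0 < b) {φ : E4 → Spinor}
    (hφ : ContDiff ℝ ∞ φ) (hc : HasCompactSupport φ) :
    MemLp (fun x => flatDiracAdjoint (b / a) (b / (a + b * ‖x‖ ^ 2)) φ x) 2 := by
  refine Continuous.memLp_of_hasCompactSupport ?_ ?_
  · have h1 := continuous_flatDirac ha hb hφ
    have h2 : Continuous fun x : E4 => b / (a + b * ‖x‖ ^ 2) :=
      continuous_const.div (by fun_prop) fun x => (conformal_pos ha hb x).ne'
    have h3 := hφ.continuous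
    unfold flatDiracAdjoint
    fun_prop
  · refine hc.mono' fun x hx => ?_
    by_contra hxs
    apply hx
    simp [flatDiracAdjoint, flatDirac_eq_zero _ _ hxs, image_eq_zero_of_notMem_tsupport hxs]

theorem integrable_inner_of_memLp {u v : E4 → Spinor} (hu : MemLp u 2) (hv : MemLp v 2) :
    Integrable fun x => inner ℂ (u x) (v x) := by
  refine (L2.integrable_inner (𝕜 := ℂ) (hu.toLp u) (hv.toLp v)).congr ?_
  filter_upwards [hu.coeFn_toLp, hv.coeFn_toLp] with x h1 h2
  rw [h1, h2]

/-- The cutoff is moved onto the test spinor. The Leibniz term then changes sign because Clifford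
multiplication is skew, so `χ_R ψ` has weak `flatDirac` equal to `c(dχ_R) ψ`. -/
theorem integral_inner_cutoff_smul {a b : ℝ} (ha : 0 < a) (hb : 0 < b) {ψ : E4 → Spinor}
    (hψ : (taubNUTFrame a b ha hb).IsWeakSolution ψ) (hψl : MemLp ψ 2) {R : ℝ} (hR : 0 < R)
    {φ : E4 → Spinor} (hφ : ContDiff ℝ ∞ φ) (hc : HasCompactSupport φ) :
    ∫ x, inner ℂ (flatDiracAdjoint (b / a) (b / (a + b * ‖x‖ ^ 2)) φ x) (cutoff R x • ψ x)
      = ∫ x, inner ℂ (φ x) (∑ i, (2 * cutoffDeriv R x * x i) • cliff i (ψ x)) := by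
  have hs := contDiff_cutoff R
  have h0 := integral_flatDiracAdjoint ha hb hψ (hs.smul hφ) hc.smul_left
  have e : ∀ x, inner ℂ (flatDiracAdjoint (b / a) (b / (a + b * ‖x‖ ^ 2)) φ x) (cutoff R x • ψ x)
      - inner ℂ (φ x) (∑ i, (2 * cutoffDeriv R x * x i) • cliff i (ψ x))
      = inner ℂ (flatDiracAdjoint (b / a) (b / (a + b * ‖x‖ ^ 2)) (fun y => cutoff R y • φ y) x)
        (ψ x) := by
    intro x
    rw [flatDiracAdjoint_smul _ _ (hs.differentiable (by simp) x)
      (hφ.differentiable (by simp) x), inner_add_left, sum_inner, inner_sum, sub_eq_add_neg,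
      ← Finset.sum_neg_distrib]
    congr 1
    · rw [← Complex.coe_smul, ← Complex.coe_smul, inner_smul_left, inner_smul_right,
        Complex.conj_ofReal]
    · refine Finset.sum_congr rfl fun i _ => ?_
      rw [fderiv_cutoff, ← Complex.coe_smul, ← Complex.coe_smul, inner_smul_left,
        inner_smul_right, Complex.conj_ofReal, inner_cliff_left]
      ring
  rw [← sub_eq_zero, ← integral_sub, ← h0]
  · exact integral_congr_ae (ae_of_all _ e)
  · exact integrable_inner_of_memLp (memLp_flatDiracAdjoint ha hb hφ hc) (memLp_cutoff_smul R hψl)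
  · exact integrable_inner_of_memLp (hφ.continuous.memLp_of_hasCompactSupport hc)
      (memLp_cutoffDeriv_smul hR hψl)

/-- The density `16am` is at least `16a²`, so square integrability for the Riemannian volume implies
it for Lebesgue measure. -/
theorem volume_le_smul_vol {a b : ℝ} (ha : 0 < a) (hb : 0 < b) :
    (volume : Measure E4) ≤ (ENNReal.ofReal (16 * a * a))⁻¹ • (taubNUT a b ha hb).vol := by
  have h0 : ENNReal.ofReal (16 * a * a) ≠ 0 := by simpa using by positivity
  rw [vol_taubNUT, Measure.le_iff]
  intro s hs
  rw [Measure.smul_apply, withDensity_apply _ hs, smul_eq_mul]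
  calc volume s = (ENNReal.ofReal (16 * a * a))⁻¹ * ∫⁻ _ in s, ENNReal.ofReal (16 * a * a) := by
        rw [setLIntegral_const, ← mul_assoc, ENNReal.inv_mul_cancel h0 ENNReal.ofReal_ne_top,
          one_mul]
    _ ≤ _ := by
        gcongr with x
        nlinarith [sq_nonneg ‖x‖]

/-! ### Vanishing of square-integrable harmonic spinors. -/

open Filter in
theorem ae_eq_zero_of_isWeakSolution {a b : ℝ} (ha : 0 < a) (hb : 0 < b) {ψ : E4 → Spinor}
    (hψ : (taubNUTFrame a b ha hb).IsWeakSolution ψ) (hψl : MemLp ψ 2) : ψ =ᵐ[volume] 0 := by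
  obtain ⟨C, hC, hardy⟩ := hardy_weak ha hb
  obtain ⟨M, hM0, hM⟩ := exists_deriv_smoothTransition_le
  have hfin : ∫⁻ x, ‖ψ x‖ₑ ^ 2 ≠ ⊤ := by
    have := (lintegral_rpow_enorm_lt_top_of_eLpNorm_lt_top two_ne_zero ENNReal.ofNat_ne_top
      hψl.2).ne
    simpa using this
  set R : ℕ → ℝ := fun n => (n : ℝ) + 1 with hRdef
  have hR : ∀ n, 0 < R n := fun n => by positivity
  have hbound : ∀ n, ∫⁻ x, ENNReal.ofReal (‖cutoff (R n) x • ψ x‖ ^ 2 / (1 + ‖x‖ ^ 2)) ≤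
      C * (ENNReal.ofReal (16 * M / R n) ^ 2 * ∫⁻ x, ‖ψ x‖ₑ ^ 2) := by
    intro n
    refine (hardy _ _ (memLp_cutoff_smul (R n) hψl) (hasCompactSupport_cutoff (hR n)).smul_right
      (memLp_cutoffDeriv_smul (hR n) hψl) fun φ hφ hc =>
      integral_inner_cutoff_smul ha hb hψ hψl (hR n) hφ hc).trans ?_
    gcongr
    rw [← lintegral_const_mul' _ _ (by finiteness)]
    refine lintegral_mono fun x => ?_
    rw [← mul_pow]
    gcongr
    rw [← ofReal_norm, ← ofReal_norm, ← ENNReal.ofReal_mul (by have := hR n; positivity)]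
    exact ENNReal.ofReal_le_ofReal (norm_cutoffDeriv_smul_le (hR n) hM0 hM x (ψ x))
  have hlim : Tendsto (fun n => C * (ENNReal.ofReal (16 * M / R n) ^ 2 * ∫⁻ x, ‖ψ x‖ₑ ^ 2)) atTop
      (nhds 0) := by
    have h1 : Tendsto (fun n => 16 * M / R n) atTop (nhds 0) :=
      (tendsto_natCast_atTop_atTop.atTop_add tendsto_const_nhds).const_div_atTop _
    have h2 := ENNReal.Tendsto.pow (n := 2) ((ENNReal.continuous_ofReal.tendsto _).comp h1)
    rw [ENNReal.ofReal_zero, zero_pow two_ne_zero] at h2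
    have h3 := ENNReal.Tendsto.const_mul (a := C)
      (ENNReal.Tendsto.mul_const (b := ∫⁻ x, ‖ψ x‖ₑ ^ 2) h2 (Or.inr hfin)) (Or.inr hC)
    rwa [zero_mul, mul_zero] at h3
  have hmeas : ∀ v : E4 → Spinor, AEStronglyMeasurable v →
      AEMeasurable fun x => ENNReal.ofReal (‖v x‖ ^ 2 / (1 + ‖x‖ ^ 2)) := by
    intro v hv
    exact (((hv.norm.aemeasurable.pow_const 2).div (by fun_prop)).ennreal_ofReal)
  have hzero : ∫⁻ x, ENNReal.ofReal (‖ψ x‖ ^ 2 / (1 + ‖x‖ ^ 2)) = 0 := by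
    refine le_antisymm ?_ zero_le
    calc ∫⁻ x, ENNReal.ofReal (‖ψ x‖ ^ 2 / (1 + ‖x‖ ^ 2))
        = ∫⁻ x, liminf (fun n =>
            ENNReal.ofReal (‖cutoff (R n) x • ψ x‖ ^ 2 / (1 + ‖x‖ ^ 2))) atTop := by
          refine lintegral_congr fun x => ?_
          refine (Tendsto.liminf_eq (tendsto_const_nhds.congr' ?_)).symm
          -- At a fixed `x` the cutoff equals `1` as soon as `n ≥ ‖x‖`, so the sequence is
          -- eventually constant and Fatou applies.
          filter_upwards [eventually_ge_atTop ⌈‖x‖⌉₊] with n hn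
          rw [cutoff_eq_one (hR n) ?_, one_smul]
          have : ‖x‖ ≤ n := Nat.ceil_le.1 hn
          simp only [hRdef]
          linarith
      _ ≤ liminf (fun n => ∫⁻ x,
            ENNReal.ofReal (‖cutoff (R n) x • ψ x‖ ^ 2 / (1 + ‖x‖ ^ 2))) atTop :=
          lintegral_liminf_le' fun n => hmeas _ (memLp_cutoff_smul (R n) hψl).1
      _ ≤ liminf (fun n => C * (ENNReal.ofReal (16 * M / R n) ^ 2 * ∫⁻ x, ‖ψ x‖ₑ ^ 2)) atTop :=
          liminf_le_liminf (Eventually.of_forall hbound)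
      _ = 0 := hlim.liminf_eq
  filter_upwards [(lintegral_eq_zero_iff' (hmeas ψ hψl.1)).1 hzero] with x hx
  rw [Pi.zero_apply, ENNReal.ofReal_eq_zero] at hx
  have h1 : ‖ψ x‖ ^ 2 ≤ 0 := by
    by_contra hne
    have : 0 < ‖ψ x‖ ^ 2 / (1 + ‖x‖ ^ 2) := div_pos (not_le.1 hne) (by positivity)
    linarith
  exact norm_eq_zero.1 (pow_eq_zero_iff two_ne_zero |>.1 (le_antisymm h1 (sq_nonneg _)))

theorem ae_vol_eq_zero_of_isWeakSolution {a b : ℝ} (ha : 0 < a) (hb : 0 < b) {ψ : E4 → Spinor}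
    (hψl : MemLp ψ 2 (taubNUT a b ha hb).vol) (hψ : (taubNUTFrame a b ha hb).IsWeakSolution ψ) :
    ψ =ᵐ[(taubNUT a b ha hb).vol] 0 := by
  have h0 : ENNReal.ofReal (16 * a * a) ≠ 0 := by simpa using by positivity
  have h := ae_eq_zero_of_isWeakSolution ha hb hψ
    (hψl.of_measure_le_smul (ENNReal.inv_ne_top.2 h0) (volume_le_smul_vol ha hb))
  rw [vol_taubNUT]
  exact (withDensity_absolutelyContinuous _ _).ae_eq h

theorem chiralKernel_eq_bot {a b : ℝ} (ha : 0 < a) (hb : 0 < b) (s : ℂ) :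
    (taubNUTFrame a b ha hb).chiralKernel s = ⊥ := by
  refine (Submodule.eq_bot_iff _).2 fun ψ hψ => ?_
  exact (Lp.eq_zero_iff_ae_eq_zero).2 (ae_vol_eq_zero_of_isWeakSolution ha hb (Lp.memLp ψ) hψ.1)

end TaubNUT

theorem theorem1 (a b : ℝ) (ha : 0 < a) (hb : 0 < b) :
    (∀ ψ : TaubNUT.E4 → TaubNUT.Spinor,
      MeasureTheory.MemLp ψ 2 (TaubNUT.taubNUT a b ha hb).vol →
      (TaubNUT.taubNUTFrame a b ha hb).IsWeakSolution ψ →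
      ψ =ᵐ[(TaubNUT.taubNUT a b ha hb).vol] 0) ∧
    FiniteDimensional ℂ ((TaubNUT.taubNUTFrame a b ha hb).chiralKernel 1) ∧
    FiniteDimensional ℂ ((TaubNUT.taubNUTFrame a b ha hb).chiralKernel (-1)) ∧
    (TaubNUT.taubNUTFrame a b ha hb).l2Index = 0 := by
  have h := TaubNUT.chiralKernel_eq_bot ha hb
  refine ⟨fun ψ hψ hw => TaubNUT.ae_vol_eq_zero_of_isWeakSolution ha hb hψ hw, ?_, ?_, ?_⟩
  · rw [h]
    infer_instance
  · rw [h]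
    infer_instance
  · rw [TaubNUT.OrthonormalFrame.l2Index, h, h]
    simp
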